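/- Let $d\in\mathbb N$, $m>0$, $T>0$ and $x_-,x_+\in\mathbb R^d$. Let $w$ be a standard Brownian motion on $\mathbb R^d$, let $v_0\sim\mathcal N\bigl(0,\tfrac1{2m}I\bigr)$ be independent of $w$, and let $(x,v)$ have continuous paths on $[0,T]$ and solve (the case $f\equiv0$ of the second order Langevin equation) $$dx(t)=v(t)\,dt,\quad x(0)=x_-,\qquad m\,dv(t)=-v(t)\,dt+dw(t),\quad v(0)=v_0 .$$ Let $Q_0^{0,x_-;T,x_+}$ denote the law on $L^2([0,T],\mathbb R^d)$ of the path $(x(t))_{0\le t\le T}$ conditioned on $x(T)=x_+$, that is, the value at $x_+$ of a weakly continuous regular conditional distribution $y\mapsto\mathrm{Law}(x\mid x(T)=y)$. Let $\mathcal L=-m^2\partial_t^4+\partial_t^2$ on $L^2([0,T],\mathbb R^d)$ with domain $$\mathcal D(\mathcal L)=\bigl\{u\in H^4([0,T],\mathbb R^d) : u(0)=u(T)=0,\; m\,\partial_t^2u(0)=\partial_tu(0),\; m\,\partial_t^2u(T)=-\partial_tu(T)\bigr\},$$ where $H^4$ is the Sobolev space of functions with weak derivatives up to order four in $L^2$.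 Then: 1. $\mathcal L$ is self-adjoint and negative definite ($\langle\mathcal Lu,u\rangle<0$ for $0\ne u\in\mathcal D(\mathcal L)$), and $-\mathcal L$ has an everywhere defined bounded inverse $-\mathcal L^{-1}$. 2. There is exactly one $\bar x\in C^4([0,T],\mathbb R^d)$ with $-m^2\bar x''''+\bar x''=0$ on $[0,T]$, $\bar x(0)=x_-$, $\bar x(T)=x_+$, $m\,\bar x''(0)=\bar x'(0)$ and $m\,\bar x''(T)=-\bar x'(T)$. 3. $Q_0^{0,x_-;T,x_+}$ exists, is unique, and is the Gaussian measure $\mathcal N(\bar x,-\mathcal L^{-1})$ on $L^2([0,T],\mathbb R^d)$, with mean $\bar x$ and covariance operator $-\mathcal L^{-1}$. 4. The covariance operator is the integral operator $(-\mathcal L^{-1}g)(s)=\int_0^TG(s,t)\,g(t)\,dt$, where $G\colon[0,T]^2\to\mathbb R$ is the Green's function of $-\mathcal L$: $G$ is continuous and, for each $s\in[0,T]$, $G(s,\cdot)\in C^2([0,T])$ satisfies $m^2\partial_t^4G(s,\cdot)-\partial_t^2G(s,\cdot)=\delta_s$ in the sense of distributions on $(0,T)$ (so the right-hand side vanishes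 on $(0,T)$ if $s\in\{0,T\}$), $G(s,0)=G(s,T)=0$, $m\,\partial_t^2G(s,0)=\partial_tG(s,0)$ and $m\,\partial_t^2G(s,T)=-\partial_tG(s,T)$. -/

import Mathlib

open MeasureTheory ProbabilityTheory Set Filter
open scoped NNReal RealInnerProductSpace BoundedContinuousFunction

noncomputable section

namespace LangevinBridge

/-! ### The space `L²([0,T], ℝᵈ)` -/

/-- The Euclidean space `ℝᵈ`. -/
abbrev E (d : ℕ) : Type := EuclideanSpace ℝ (Fin d)

/-- The Hilbert space `L²([0,T], ℝᵈ)`. -/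
abbrev L2 (d : ℕ) (T : ℝ) : Type := Lp (E d) 2 (volume.restrict (Icc (0 : ℝ) T))

/-- `L²([0,T], ℝᵈ)` carries its Borel σ-algebra. -/
instance instMeasurableSpaceL2 (d : ℕ) (T : ℝ) : MeasurableSpace (L2 d T) := borel _

instance instBorelSpaceL2 (d : ℕ) (T : ℝ) : BorelSpace (L2 d T) := ⟨rfl⟩

open Classical in
/-- The element of `L²([0,T], ℝᵈ)` given by a path (and `0` if the path is not square
integrable, which does not happen for paths that are continuous on `[0,T]`). -/
def toL2 {d : ℕ} (T : ℝ) (x : ℝ → E d) : L2 d T :=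
  if h : MemLp x 2 (volume.restrict (Icc (0 : ℝ) T)) then h.toLp x else 0

/-! ### The Langevin equation and its conditioned law -/

/-- A standard Brownian motion on `ℝᵈ`: the components are independent one-dimensional standard
Brownian motions. -/
structure IsBrownianVector {Ω : Type*} [MeasurableSpace Ω] {d : ℕ}
    (W : ℝ≥0 → Ω → E d) (P : Measure Ω) : Prop where
  component : ∀ i : Fin d, IsBrownianReal (fun t ω => W t ω i) P
  indep : iIndepFun (fun (i : Fin d) (ω : Ω) (t : ℝ≥0) => W t ω i) P

/-- The normal distribution `𝒩(0, 1/(2m))` on `ℝᵈ`, with covariance matrix `(1/(2m)) I`. -/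
def velocityLaw (d : ℕ) (m : ℝ) : Measure (E d) :=
  (stdGaussian (E d)).map (fun y => (Real.sqrt (2 * m))⁻¹ • y)

/-- `(x, v)` is a solution on `[0,T]` of
`dx = v dt`, `m dv = f(x) dt - v dt + dW`, `x(0) = x₀`, `v(0) ∼ 𝒩(0, 1/(2m))`,
where `W` is a standard Brownian motion independent of `v(0)`.  Since the noise is additive, the
equation is a pathwise integral equation. -/
structure IsLangevinSolution {Ω : Type*} [MeasurableSpace Ω] {d : ℕ} (m T : ℝ)
    (f : E d → E d) (x₀ : E d) (P : Measure Ω)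
    (W : ℝ≥0 → Ω → E d) (x v : ℝ → Ω → E d) : Prop where
  brownian : IsBrownianVector W P
  velocity_law : HasLaw (v 0) (velocityLaw d m) P
  velocity_indep : IndepFun (v 0) (fun ω t => W t ω) P
  aemeasurable_position : ∀ t ∈ Icc (0 : ℝ) T, AEMeasurable (x t) P
  aemeasurable_velocity : ∀ t ∈ Icc (0 : ℝ) T, AEMeasurable (v t) P
  continuous_position : ∀ᵐ ω ∂P, ContinuousOn (fun t => x t ω) (Icc 0 T)
  continuous_velocity : ∀ᵐ ω ∂P, ContinuousOn (fun t => v t ω) (Icc 0 T)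
  integrable_drift : ∀ᵐ ω ∂P, IntervalIntegrable (fun t => f (x t ω)) volume 0 T
  position_eq : ∀ᵐ ω ∂P, ∀ t ∈ Icc (0 : ℝ) T, x t ω = x₀ + ∫ s in (0 : ℝ)..t, v s ω
  velocity_eq : ∀ᵐ ω ∂P, ∀ t ∈ Icc (0 : ℝ) T,
    m • v t ω = m • v 0 ω + (∫ s in (0 : ℝ)..t, f (x s ω)) - (∫ s in (0 : ℝ)..t, v s ω)
      + W t.toNNReal ω

/-- `Q` is the law of `X` conditioned on `Y = y`, in the sense of the weakly continuous regular
conditional distribution: there is a Markov kernel `κ`, weakly continuous in its parameter, which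
is a regular conditional distribution of `X` given `Y`, and `Q = κ y`.  (If the law of `Y` has
full support, such a kernel is determined at every point.) -/
def IsConditionedLaw {Ω 𝓧 𝓨 : Type*} [MeasurableSpace Ω]
    [TopologicalSpace 𝓧] [MeasurableSpace 𝓧] [TopologicalSpace 𝓨] [MeasurableSpace 𝓨]
    (P : Measure Ω) (X : Ω → 𝓧) (Y : Ω → 𝓨) (y : 𝓨) (Q : Measure 𝓧) : Prop :=
  ∃ κ : Kernel 𝓨 𝓧, IsMarkovKernel κ ∧
    (∀ F : 𝓧 →ᵇ ℝ, Continuous fun z => ∫ u, F u ∂(κ z)) ∧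
    HasCondDistrib X Y κ P ∧ κ y = Q

/-- `Q` is the target distribution of the Langevin bridge on `L²([0,T], ℝᵈ)`: the law of the path
`(x(t))_{0 ≤ t ≤ T}` conditioned on `x(T) = xplus`, where `x` is the position component of a solution
of the Langevin equation. -/
def IsTargetLaw {Ω : Type*} [MeasurableSpace Ω] {d : ℕ} (T : ℝ) (P : Measure Ω)
    (x : ℝ → Ω → E d) (xplus : E d) (Q : Measure (L2 d T)) : Prop :=
  IsConditionedLaw P (fun ω => toL2 T (fun t => x t ω)) (x T) xplus Q

/-- `μ` is the Gaussian measure `𝒩(a, C)` on a Hilbert space. -/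
structure IsGaussianWith {H : Type*} [NormedAddCommGroup H] [InnerProductSpace ℝ H]
    [MeasurableSpace H] [BorelSpace H] (μ : Measure H) (a : H) (C : H →L[ℝ] H) : Prop where
  gaussian : IsGaussian μ
  mean : ∫ u, u ∂μ = a
  covariance : ∀ g h : H, covarianceBilin μ g h = ⟪C g, h⟫

/-! ### The differential operator -/

/-- `φ` is a test function on the open interval `(0,T)`. -/
structure IsTestFunction (T : ℝ) (φ : ℝ → ℝ) : Prop where
  smooth : ContDiff ℝ (⊤ : ℕ∞) φ
  compact : HasCompactSupport φ
  support : tsupport φ ⊆ Ioo 0 T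

/-- `g ∈ L²` is the weak derivative of order `k` of `u ∈ L²` on `(0,T)`. -/
def IsWeakDeriv {d : ℕ} {T : ℝ} (k : ℕ) (u g : L2 d T) : Prop :=
  ∀ φ : ℝ → ℝ, IsTestFunction T φ →
    ∫ t in Icc (0 : ℝ) T, iteratedDeriv k φ t • u t
      = (-1 : ℝ) ^ k • ∫ t in Icc (0 : ℝ) T, φ t • g t

lemma integrable_smul_L2 {d : ℕ} {T : ℝ} {ψ : ℝ → ℝ} (hψ : Continuous ψ) (u : L2 d T) :
    IntegrableOn (fun t => ψ t • u t) (Icc (0 : ℝ) T) := by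
  have hu : IntegrableOn (fun t => u t) (Icc (0 : ℝ) T) :=
    (Lp.memLp u).integrable (by norm_num)
  exact hu.continuousOn_smul hψ.continuousOn isCompact_Icc

lemma IsTestFunction.continuous_iteratedDeriv {T : ℝ} {φ : ℝ → ℝ} (h : IsTestFunction T φ)
    (k : ℕ) : Continuous (iteratedDeriv k φ) :=
  h.smooth.continuous_iteratedDeriv k (by exact_mod_cast le_top)

lemma isWeakDeriv_zero {d : ℕ} {T : ℝ} (k : ℕ) : IsWeakDeriv k (0 : L2 d T) 0 := by
  intro φ _
  have h0 := Lp.coeFn_zero (E d) 2 (volume.restrict (Icc (0 : ℝ) T))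
  have key : ∀ ψ : ℝ → ℝ, ∫ t in Icc (0 : ℝ) T, ψ t • (0 : L2 d T) t = 0 := fun ψ => by
    rw [integral_congr_ae (g := fun _ => (0 : E d)) (by filter_upwards [h0] with t ht; rw [ht]; simp)]
    simp
  rw [key, key, smul_zero]

lemma IsWeakDeriv.add {d : ℕ} {T : ℝ} {k : ℕ} {u u' g g' : L2 d T}
    (h : IsWeakDeriv k u g) (h' : IsWeakDeriv k u' g') :
    IsWeakDeriv k (u + u') (g + g') := by
  intro φ hφ
  have key : ∀ ψ : ℝ → ℝ, Continuous ψ → ∀ a b : L2 d T,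
      ∫ t in Icc (0 : ℝ) T, ψ t • (a + b : L2 d T) t
        = (∫ t in Icc (0 : ℝ) T, ψ t • a t) + ∫ t in Icc (0 : ℝ) T, ψ t • b t := by
    intro ψ hψ a b
    rw [← integral_add (integrable_smul_L2 hψ a) (integrable_smul_L2 hψ b)]
    refine integral_congr_ae ?_
    filter_upwards [Lp.coeFn_add a b] with t ht
    rw [ht, Pi.add_apply, smul_add]
  rw [key _ (hφ.continuous_iteratedDeriv k), key _ hφ.smooth.continuous, h φ hφ, h' φ hφ, smul_add]

lemma IsWeakDeriv.smul {d : ℕ} {T : ℝ} {k : ℕ} {u g : L2 d T} (c : ℝ)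
    (h : IsWeakDeriv k u g) : IsWeakDeriv k (c • u) (c • g) := by
  intro φ hφ
  have key : ∀ ψ : ℝ → ℝ, ∀ a : L2 d T,
      ∫ t in Icc (0 : ℝ) T, ψ t • (c • a : L2 d T) t
        = c • ∫ t in Icc (0 : ℝ) T, ψ t • a t := by
    intro ψ a
    rw [← integral_smul]
    refine integral_congr_ae ?_
    filter_upwards [Lp.coeFn_smul c a] with t ht
    simp only [ht, Pi.smul_apply]
    rw [smul_comm]
  rw [key, key, h φ hφ, smul_comm]

/-- Weak derivatives are unique. -/
lemma IsWeakDeriv.unique {d : ℕ} {T : ℝ} {k : ℕ} {u g g' : L2 d T}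
    (h : IsWeakDeriv k u g) (h' : IsWeakDeriv k u g') : g = g' := by
  have hz : IsWeakDeriv k (0 : L2 d T) (g - g') := by
    have := h.add (h'.smul (-1))
    simpa [sub_eq_add_neg] using this
  have hint : ∀ w : L2 d T, IntegrableOn (fun t => w t) (Icc (0 : ℝ) T) := fun w =>
    (Lp.memLp w).integrable (by norm_num)
  have hae : ∀ᵐ t : ℝ, t ∈ Ioo (0 : ℝ) T → (g - g' : L2 d T) t = 0 := by
    refine IsOpen.ae_eq_zero_of_integral_contDiff_smul_eq_zero isOpen_Ioo
      ((hint _).mono_set Ioo_subset_Icc_self).locallyIntegrableOn ?_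
    intro φ h1 h2 h3
    have e := hz φ ⟨h1, h2, h3⟩
    have h0 := Lp.coeFn_zero (E d) 2 (volume.restrict (Icc (0 : ℝ) T))
    rw [integral_congr_ae (g := fun _ => (0 : E d))
      (by filter_upwards [h0] with t ht; rw [ht]; simp)] at e
    simp only [integral_zero] at e
    have e2 : ∫ t in Icc (0 : ℝ) T, φ t • (g - g' : L2 d T) t = 0 := by
      rcases smul_eq_zero.1 e.symm with h | h
      · exact absurd h (pow_ne_zero _ (by norm_num))
      · exact h
    rw [← e2]
    refine (setIntegral_eq_integral_of_forall_compl_eq_zero ?_).symm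
    intro t ht
    have : φ t = 0 := image_eq_zero_of_notMem_tsupport
      (fun hh => ht (Ioo_subset_Icc_self (h3 hh)))
    simp [this]
  have : (g - g' : L2 d T) = 0 := by
    refine Lp.ext ?_
    have h0 := Lp.coeFn_zero (E d) 2 (volume.restrict (Icc (0 : ℝ) T))
    have hmem : ∀ᵐ t ∂(volume.restrict (Icc (0 : ℝ) T)), t ∈ Ioo (0 : ℝ) T := by
      rw [← Measure.restrict_congr_set (Ioo_ae_eq_Icc (μ := volume) (a := (0 : ℝ)) (b := T))]
      exact ae_restrict_mem measurableSet_Ioo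
    filter_upwards [h0, hmem, ae_restrict_of_ae hae] with t h1 h2 h3
    rw [h3 h2, h1]; rfl
  exact sub_eq_zero.1 this

/-- The weak derivative of order `k` as an unbounded operator on `L²([0,T], ℝᵈ)`, with its maximal
domain. -/
def weakDeriv (d : ℕ) (T : ℝ) (k : ℕ) : L2 d T →ₗ.[ℝ] L2 d T where
  domain :=
    { carrier := {u | ∃ g, IsWeakDeriv k u g}
      zero_mem' := ⟨0, isWeakDeriv_zero k⟩
      add_mem' := fun ⟨g, hg⟩ ⟨g', hg'⟩ => ⟨g + g', hg.add hg'⟩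
      smul_mem' := fun c _ ⟨g, hg⟩ => ⟨c • g, hg.smul c⟩ }
  toFun :=
    { toFun := fun u => Classical.choose u.2
      map_add' := fun u u' => (Classical.choose_spec (u + u').2).unique
        ((Classical.choose_spec u.2).add (Classical.choose_spec u'.2))
      map_smul' := fun c u => (Classical.choose_spec (c • u).2).unique
        ((Classical.choose_spec u.2).smul c) }

lemma weakDeriv_spec {d : ℕ} {T : ℝ} {k : ℕ} (u : (weakDeriv d T k).domain) :
    IsWeakDeriv k (u : L2 d T) (weakDeriv d T k u) :=
  Classical.choose_spec u.2

/-- The Sobolev space `H⁴([0,T], ℝᵈ)`: the functions in `L²` whose weak derivatives up to order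
four exist in `L²`. -/
def sobolevH4 (d : ℕ) (T : ℝ) : Submodule ℝ (L2 d T) :=
  (weakDeriv d T 1).domain ⊓ (weakDeriv d T 2).domain ⊓
    (weakDeriv d T 3).domain ⊓ (weakDeriv d T 4).domain

/-- The boundary value `u(t) = a` for `u ∈ L²`: it is the value at `t` of the representative of
`u` that is continuous on `[0,T]`. -/
def HasTrace {d : ℕ} {T : ℝ} (u : L2 d T) (t : ℝ) (a : E d) : Prop :=
  ∃ c : ℝ → E d, ContinuousOn c (Icc 0 T) ∧ u =ᵐ[volume.restrict (Icc (0 : ℝ) T)] c ∧ c t = a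

lemma hasTrace_zero {d : ℕ} {T : ℝ} (t : ℝ) : HasTrace (0 : L2 d T) t 0 :=
  ⟨0, continuousOn_const, Lp.coeFn_zero _ _ _, rfl⟩

lemma HasTrace.add {d : ℕ} {T t : ℝ} {u u' : L2 d T} {a a' : E d}
    (h : HasTrace u t a) (h' : HasTrace u' t a') : HasTrace (u + u') t (a + a') := by
  obtain ⟨c, h1, h2, h3⟩ := h
  obtain ⟨c', h1', h2', h3'⟩ := h'
  exact ⟨c + c', h1.add h1', (Lp.coeFn_add u u').trans (h2.add h2'), by simp [h3, h3']⟩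

lemma HasTrace.smul {d : ℕ} {T t : ℝ} {u : L2 d T} {a : E d} (r : ℝ)
    (h : HasTrace u t a) : HasTrace (r • u) t (r • a) := by
  obtain ⟨c, h1, h2, h3⟩ := h
  exact ⟨r • c, h1.const_smul r, (Lp.coeFn_smul r u).trans (h2.const_smul r), by simp [h3]⟩

/-- The relation `m ∂ₜ²u(t) = σ ∂ₜu(t)` between boundary values of weak derivatives of `u`. -/
def HasRobinRelation {d : ℕ} {T : ℝ} (m σ t : ℝ) (u : L2 d T) : Prop :=
  ∃ (u₁ u₂ : L2 d T) (a b : E d), IsWeakDeriv 1 u u₁ ∧ IsWeakDeriv 2 u u₂ ∧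
    HasTrace u₁ t a ∧ HasTrace u₂ t b ∧ m • b = σ • a

/-- The domain of the operator: all `u ∈ H⁴` with `u(0) = u(T) = 0`, `m ∂ₜ²u(0) = ∂ₜu(0)` and
`m ∂ₜ²u(T) = -∂ₜu(T)`. -/
def operatorDomain (d : ℕ) (m T : ℝ) : Submodule ℝ (L2 d T) where
  carrier := {u | u ∈ sobolevH4 d T ∧ HasTrace u 0 0 ∧ HasTrace u T 0 ∧
    HasRobinRelation m 1 0 u ∧ HasRobinRelation m (-1) T u}
  zero_mem' := by
    have h : ∀ σ t : ℝ, HasRobinRelation m σ t (0 : L2 d T) := fun σ t =>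
      ⟨0, 0, 0, 0, isWeakDeriv_zero 1, isWeakDeriv_zero 2, hasTrace_zero t, hasTrace_zero t,
        by simp⟩
    exact ⟨zero_mem _, hasTrace_zero _, hasTrace_zero _, h _ _, h _ _⟩
  add_mem' := by
    have h : ∀ (σ t : ℝ) (u u' : L2 d T), HasRobinRelation m σ t u →
        HasRobinRelation m σ t u' → HasRobinRelation m σ t (u + u') := by
      rintro σ t u u' ⟨u₁, u₂, a, b, h1, h2, h3, h4, h5⟩ ⟨u₁', u₂', a', b', h1', h2', h3', h4', h5'⟩
      exact ⟨_, _, _, _, h1.add h1', h2.add h2', h3.add h3', h4.add h4', by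
        rw [smul_add, smul_add, h5, h5']⟩
    rintro u u' ⟨h1, h2, h3, h4, h5⟩ ⟨h1', h2', h3', h4', h5'⟩
    exact ⟨add_mem h1 h1', by simpa using h2.add h2', by simpa using h3.add h3',
      h _ _ _ _ h4 h4', h _ _ _ _ h5 h5'⟩
  smul_mem' := by
    have h : ∀ (r σ t : ℝ) (u : L2 d T), HasRobinRelation m σ t u →
        HasRobinRelation m σ t (r • u) := by
      rintro r σ t u ⟨u₁, u₂, a, b, h1, h2, h3, h4, h5⟩
      exact ⟨_, _, _, _, h1.smul r, h2.smul r, h3.smul r, h4.smul r, by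
        rw [smul_comm m r, h5, smul_comm]⟩
    rintro r u ⟨h1, h2, h3, h4, h5⟩
    exact ⟨Submodule.smul_mem _ r h1, by simpa using h2.smul r, by simpa using h3.smul r,
      h _ _ _ _ h4, h _ _ _ _ h5⟩

/-- The operator `𝓛 = -m² ∂ₜ⁴ + ∂ₜ²` on `L²([0,T], ℝᵈ)` with domain `operatorDomain`. -/
def operatorL (d : ℕ) (m T : ℝ) : L2 d T →ₗ.[ℝ] L2 d T :=
  ((-(m ^ 2)) • weakDeriv d T 4 + weakDeriv d T 2).domRestrict (operatorDomain d m T)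

/-- `C` is the everywhere defined bounded inverse of the unbounded operator `A`. -/
structure IsBoundedInverse {H : Type*} [NormedAddCommGroup H] [NormedSpace ℝ H]
    (A : H →ₗ.[ℝ] H) (C : H →L[ℝ] H) : Prop where
  right_inv : ∀ g : H, ∃ hg : C g ∈ A.domain, A ⟨C g, hg⟩ = g
  left_inv : ∀ u : A.domain, C (A u) = u

/-- `y` is a classical solution on `[0,T]` of `-m² y'''' + y'' = 0` with
`y(0) = xminus`, `y(T) = xplus`, `m y''(0) = y'(0)`, `m y''(T) = -y'(T)`. -/
structure IsMeanPath {d : ℕ} (m T : ℝ) (xminus xplus : E d) (y : ℝ → E d) : Prop where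
  contDiffOn : ContDiffOn ℝ 4 y (Icc 0 T)
  equation : ∀ t ∈ Icc (0 : ℝ) T,
    (-(m ^ 2)) • iteratedDerivWithin 4 y (Icc 0 T) t + iteratedDerivWithin 2 y (Icc 0 T) t = 0
  left_value : y 0 = xminus
  right_value : y T = xplus
  left_deriv : m • iteratedDerivWithin 2 y (Icc 0 T) 0 = derivWithin y (Icc 0 T) 0
  right_deriv : m • iteratedDerivWithin 2 y (Icc 0 T) T = -derivWithin y (Icc 0 T) T

/-- `G` is the (scalar) Green's function of `-L = m² ∂ₜ⁴ - ∂ₜ²` on `[0,T]` with the boundary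
conditions `u(0) = u(T) = 0`, `m u''(0) = u'(0)`, `m u''(T) = -u'(T)`: it is continuous, and for
each `s` the function `G(s, ·)` is `C²` up to the boundary, satisfies the boundary conditions, and
solves `m² ∂ₜ⁴ G(s, ·) - ∂ₜ² G(s, ·) = δ_s` in the sense of distributions on `(0,T)`. -/
structure IsGreenFunction (m T : ℝ) (G : ℝ → ℝ → ℝ) : Prop where
  continuousOn : ContinuousOn (Function.uncurry G) (Icc 0 T ×ˢ Icc 0 T)
  contDiffOn : ∀ s ∈ Icc (0 : ℝ) T, ContDiffOn ℝ 2 (G s) (Icc 0 T)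
  equation : ∀ s ∈ Icc (0 : ℝ) T, ∀ φ : ℝ → ℝ, IsTestFunction T φ →
    ∫ t in Icc (0 : ℝ) T, G s t * (m ^ 2 * iteratedDeriv 4 φ t - iteratedDeriv 2 φ t) = φ s
  left_value : ∀ s ∈ Icc (0 : ℝ) T, G s 0 = 0
  right_value : ∀ s ∈ Icc (0 : ℝ) T, G s T = 0
  left_deriv : ∀ s ∈ Icc (0 : ℝ) T,
    m * iteratedDerivWithin 2 (G s) (Icc 0 T) 0 = derivWithin (G s) (Icc 0 T) 0
  right_deriv : ∀ s ∈ Icc (0 : ℝ) T,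
    m * iteratedDerivWithin 2 (G s) (Icc 0 T) T = -derivWithin (G s) (Icc 0 T) T

end LangevinBridge

end

noncomputable section

namespace LangevinBridge

/-! ### The covariance of the bridge -/

/-! The velocity is a stationary Ornstein–Uhlenbeck process, so `x - x₋` is a centred Gaussian
process with covariance `R(s,t) I`, where `R` is `freeCov`. Linear regression on the endpoint splits
the path as `x = x̄_{x(T)} + Z`: here `x̄_y = x₋ + R(T,·)/R(T,T) (y - x₋)`, and `Z` is centred
Gaussian with covariance `G(s,t) = R(s,t) - R(s,T) R(T,t) / R(T,T)`. Since `Z` is uncorrelated with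
`x(T)` it is independent of it, and conditioning on `x(T) = y` only translates the law of `Z` by
`x̄_y` (`isConditionedLaw_of_indepFun`). The endpoint has a nondegenerate Gaussian law, hence full
support, which makes the weakly continuous version unique (`IsConditionedLaw.unique`).

The link with the operator is explicit: `∂ₜ² R(s,t) = (exp(-t/m) - exp(-|t-s|/m)) / (2m)`, which `m²
∂ₜ² - 1` sends to `δ_s`. Moreover `R(s,·)` vanishes at `0` and satisfies the derivative conditions
at both ends. The function `R(T,·)` has the same boundary behaviour and solves the homogeneous
equation, so subtracting a multiple of it corrects the value at `T` and disturbs nothing else. Thus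
`G` is the Green's function (`isGreenFunction_bridgeCov`), and the regression coefficient gives the
mean path.

By Fubini against test functions the integral operator of `G` is a right inverse of `-𝓛`. An energy
identity (`eq_zero_of_robin_boundary`) gives injectivity of `𝓛` and uniqueness of the mean path. A
symmetric bounded inverse forces self-adjointness (`IsBoundedInverse.isSelfAdjoint`). Definiteness
is read off from probability: a covariance operator is positive semidefinite.

The noise is additive, so the equation is solved pathwise (`path_eq`) and no stochastic integral
occurs: each `x(t)` is a continuous linear functional of the pair `(w, v(0))`. Gaussian statements
pass from finitely many times to `L²` through characteristic functions of step approximations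
(`IsGaussianField.transform_toL2`). -/

/-- The covariance `𝔼[(xᵢ(s) - xᵢ(0)) (xᵢ(t) - xᵢ(0))]` of the free Langevin path for `t ≤ s`. -/
def lowerCov (m s t : ℝ) : ℝ :=
  t - m / 2 * (1 - Real.exp (-s / m) - Real.exp (-t / m) + Real.exp ((t - s) / m))

/-- The covariance of the components of the free Langevin path. -/
def freeCov (m s t : ℝ) : ℝ := lowerCov m (max s t) (min s t)

lemma freeCov_comm (m s t : ℝ) : freeCov m s t = freeCov m t s := by
  rw [freeCov, freeCov, max_comm, min_comm]

lemma continuous_lowerCov (m : ℝ) : Continuous fun p : ℝ × ℝ => lowerCov m p.1 p.2 := by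
  unfold lowerCov
  fun_prop

lemma continuous_freeCov (m : ℝ) : Continuous fun p : ℝ × ℝ => freeCov m p.1 p.2 :=
  (continuous_lowerCov m).comp
    ((continuous_fst.max continuous_snd).prodMk (continuous_fst.min continuous_snd))

lemma freeCov_of_le {m s t : ℝ} (h : t ≤ s) : freeCov m s t = lowerCov m s t := by
  rw [freeCov, max_eq_left h, min_eq_right h]

lemma freeCov_of_ge {m s t : ℝ} (h : s ≤ t) : freeCov m s t = lowerCov m t s := by
  rw [freeCov_comm, freeCov_of_le h]

lemma lowerCov_self {m : ℝ} (T : ℝ) : lowerCov m T T = T - m * (1 - Real.exp (-T / m)) := by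
  simp only [lowerCov, sub_self, zero_div, Real.exp_zero]
  ring

/-- The strict inequality `1 + y < exp y` at `y = -T/m`. This nondegeneracy of the endpoint is what
permits the division in `bridgeCoeff`, and later gives `x(T)` full support. -/
lemma lowerCov_self_pos {m T : ℝ} (hm : 0 < m) (hT : 0 < T) : 0 < lowerCov m T T := by
  rw [lowerCov_self]
  have h := Real.add_one_lt_exp (x := -T / m) (div_ne_zero (by linarith) hm.ne')
  have h2 : m * (-T / m + 1) < m * Real.exp (-T / m) := mul_lt_mul_of_pos_left h hm
  have h3 : m * (-T / m + 1) = -T + m := by field_simp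
  linarith

lemma lowerCov_zero_right (m s : ℝ) : lowerCov m s 0 = 0 := by
  simp [lowerCov]

/-- The regression coefficient of `x(t)` on `x(T)`. -/
def bridgeCoeff (m T t : ℝ) : ℝ := lowerCov m T t / lowerCov m T T

lemma bridgeCoeff_zero (m T : ℝ) : bridgeCoeff m T 0 = 0 := by
  simp [bridgeCoeff, lowerCov_zero_right]

lemma bridgeCoeff_self {m T : ℝ} (hm : 0 < m) (hT : 0 < T) : bridgeCoeff m T T = 1 :=
  div_self (lowerCov_self_pos hm hT).ne'

lemma continuous_bridgeCoeff (m T : ℝ) : Continuous (bridgeCoeff m T) := by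
  unfold bridgeCoeff lowerCov
  fun_prop

/-- The covariance of the bridge. -/
def bridgeCov (m T s t : ℝ) : ℝ :=
  freeCov m s t - bridgeCoeff m T s * lowerCov m T t

lemma bridgeCov_comm (m T s t : ℝ) : bridgeCov m T s t = bridgeCov m T t s := by
  rw [bridgeCov, bridgeCov, freeCov_comm, bridgeCoeff, bridgeCoeff]
  ring

lemma continuous_bridgeCov (m T : ℝ) : Continuous fun p : ℝ × ℝ => bridgeCov m T p.1 p.2 := by
  unfold bridgeCov
  refine (continuous_freeCov m).sub (((continuous_bridgeCoeff m T).comp continuous_fst).mul ?_)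
  exact (continuous_lowerCov m).comp (continuous_const.prodMk continuous_snd)

/-! ### Piecewise derivatives of the covariance kernels -/

/-- The `j`-th derivative of `t ↦ lowerCov m s t`. -/
def lowerCovDeriv (m : ℝ) (j : ℕ) (s t : ℝ) : ℝ :=
  match j with
  | 0 => lowerCov m s t
  | 1 => 1 - (Real.exp (-t / m) + Real.exp ((t - s) / m)) / 2
  | 2 => (Real.exp (-t / m) - Real.exp ((t - s) / m)) / (2 * m)
  | 3 => -(Real.exp (-t / m) + Real.exp ((t - s) / m)) / (2 * m ^ 2)
  -- This branch is meant for `j = 4`; values for `j ≥ 5` are placeholders. Written as the second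
  -- derivative over `m ^ 2`, it displays the differential equation.
  | _ => (Real.exp (-t / m) - Real.exp ((t - s) / m)) / (2 * m) / m ^ 2

/-- The `j`-th derivative of `t ↦ lowerCov m t s`. -/
def upperCovDeriv (m : ℝ) (j : ℕ) (s t : ℝ) : ℝ :=
  match j with
  | 0 => lowerCov m t s
  | 1 => -(Real.exp (-t / m) - Real.exp ((s - t) / m)) / 2
  | 2 => (Real.exp (-t / m) - Real.exp ((s - t) / m)) / (2 * m)
  | 3 => -(Real.exp (-t / m) - Real.exp ((s - t) / m)) / (2 * m ^ 2)
  | _ => (Real.exp (-t / m) - Real.exp ((s - t) / m)) / (2 * m) / m ^ 2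

lemma continuous_lowerCovDeriv (m : ℝ) (j : ℕ) :
    Continuous fun p : ℝ × ℝ => lowerCovDeriv m j p.1 p.2 := by
  have h2 := continuous_lowerCov m
  unfold lowerCovDeriv
  rcases j with _ | _ | _ | _ | j
  · exact h2
  all_goals fun_prop

lemma continuous_upperCovDeriv (m : ℝ) (j : ℕ) :
    Continuous fun p : ℝ × ℝ => upperCovDeriv m j p.1 p.2 := by
  have h2 := (continuous_lowerCov m).comp (continuous_snd.prodMk continuous_fst)
  unfold upperCovDeriv
  rcases j with _ | _ | _ | _ | j
  · exact h2
  all_goals fun_prop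

lemma hasDerivAt_lowerCovDeriv {m : ℝ} (hm : m ≠ 0) {j : ℕ} (hj : j ≤ 3) (s t : ℝ) :
    HasDerivAt (lowerCovDeriv m j s) (lowerCovDeriv m (j + 1) s t) t := by
  have h1 : HasDerivAt (fun t : ℝ => Real.exp (-t / m)) (Real.exp (-t / m) * (-1 / m)) t :=
    (((hasDerivAt_id t).neg).div_const m).exp
  have h2 : HasDerivAt (fun t : ℝ => Real.exp ((t - s) / m)) (Real.exp ((t - s) / m) * (1 / m)) t :=
    (((hasDerivAt_id t).sub_const s).div_const m).exp
  interval_cases j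
  · have h := (hasDerivAt_id t).sub
      (((h1.const_sub (1 - Real.exp (-s / m))).add h2).const_mul (m / 2))
    refine HasDerivAt.congr_deriv h ?_
    simp only [lowerCovDeriv]
    field_simp
  · refine HasDerivAt.congr_deriv (((h1.add h2).div_const 2).const_sub 1) ?_
    simp only [lowerCovDeriv]
    field_simp
    ring
  · refine HasDerivAt.congr_deriv ((h1.sub h2).div_const (2 * m)) ?_
    simp only [lowerCovDeriv]
    field_simp
    ring
  · refine HasDerivAt.congr_deriv ((h1.add h2).neg.div_const (2 * m ^ 2)) ?_
    simp only [lowerCovDeriv]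
    field_simp
    ring

lemma hasDerivAt_upperCovDeriv {m : ℝ} (hm : m ≠ 0) {j : ℕ} (hj : j ≤ 3) (s t : ℝ) :
    HasDerivAt (upperCovDeriv m j s) (upperCovDeriv m (j + 1) s t) t := by
  have h1 : HasDerivAt (fun t : ℝ => Real.exp (-t / m)) (Real.exp (-t / m) * (-1 / m)) t :=
    (((hasDerivAt_id t).neg).div_const m).exp
  have h3 : HasDerivAt (fun t : ℝ => Real.exp ((s - t) / m))
      (Real.exp ((s - t) / m) * (-1 / m)) t :=
    (((hasDerivAt_id t).const_sub s).div_const m).exp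
  interval_cases j
  · have h := (((h1.const_sub 1).sub_const (Real.exp (-s / m))).add h3).const_mul (m / 2)
    refine HasDerivAt.congr_deriv
      (f := fun t => s - m / 2 * (1 - Real.exp (-t / m) - Real.exp (-s / m) +
        Real.exp ((s - t) / m))) (h.const_sub s) ?_
    simp only [upperCovDeriv]
    field_simp
    ring
  · refine HasDerivAt.congr_deriv ((h1.sub h3).neg.div_const 2) ?_
    simp only [upperCovDeriv]
    field_simp
    ring
  · refine HasDerivAt.congr_deriv ((h1.sub h3).div_const (2 * m)) ?_
    simp only [upperCovDeriv]
    field_simp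
    ring
  · refine HasDerivAt.congr_deriv ((h1.sub h3).neg.div_const (2 * m ^ 2)) ?_
    simp only [upperCovDeriv]
    field_simp
    ring

/-- The `j`-th derivative of `bridgeCov m T s` on `t ≤ s`. -/
def bridgeCovLower (m T : ℝ) (j : ℕ) (s t : ℝ) : ℝ :=
  lowerCovDeriv m j s t - bridgeCoeff m T s * lowerCovDeriv m j T t

/-- The `j`-th derivative of `bridgeCov m T s` on `s < t`. -/
def bridgeCovUpper (m T : ℝ) (j : ℕ) (s t : ℝ) : ℝ :=
  upperCovDeriv m j s t - bridgeCoeff m T s * lowerCovDeriv m j T t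

/-- The `j`-th derivative of `bridgeCov m T s`. -/
def bridgeCovDeriv (m T : ℝ) (j : ℕ) (s t : ℝ) : ℝ :=
  if t ≤ s then bridgeCovLower m T j s t else bridgeCovUpper m T j s t

lemma bridgeCovDeriv_zero (m T s t : ℝ) : bridgeCovDeriv m T 0 s t = bridgeCov m T s t := by
  unfold bridgeCovDeriv bridgeCov
  split_ifs with h
  · rw [freeCov_of_le h]; rfl
  · rw [freeCov_of_ge (not_le.1 h).le]; rfl

/-- The homogeneous equation off the diagonal. On the diagonal it concerns only the chosen left
branch; the delta mass comes from the jump of the third derivative. -/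
lemma bridgeCovDeriv_four (m T s t : ℝ) :
    bridgeCovDeriv m T 4 s t = bridgeCovDeriv m T 2 s t / m ^ 2 := by
  unfold bridgeCovDeriv bridgeCovLower bridgeCovUpper
  split_ifs <;> simp only [lowerCovDeriv, upperCovDeriv] <;> ring

lemma continuous_bridgeCovLower (m T : ℝ) (j : ℕ) :
    Continuous fun p : ℝ × ℝ => bridgeCovLower m T j p.1 p.2 :=
  (continuous_lowerCovDeriv m j).sub (((continuous_bridgeCoeff m T).comp continuous_fst).mul
    ((continuous_lowerCovDeriv m j).comp (continuous_const.prodMk continuous_snd)))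

lemma continuous_bridgeCovUpper (m T : ℝ) (j : ℕ) :
    Continuous fun p : ℝ × ℝ => bridgeCovUpper m T j p.1 p.2 :=
  (continuous_upperCovDeriv m j).sub (((continuous_bridgeCoeff m T).comp continuous_fst).mul
    ((continuous_lowerCovDeriv m j).comp (continuous_const.prodMk continuous_snd)))

lemma measurable_bridgeCovDeriv (m T : ℝ) (j : ℕ) :
    Measurable fun p : ℝ × ℝ => bridgeCovDeriv m T j p.1 p.2 :=
  Measurable.ite (measurableSet_le measurable_snd measurable_fst)
    (continuous_bridgeCovLower m T j).measurable (continuous_bridgeCovUpper m T j).measurable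

/-- The two branches join in a `C²` way, so that distributional derivatives up to order three carry
no point mass. -/
lemma bridgeCovLower_eq_upper_diag (m T : ℝ) {j : ℕ} (hj : j ≤ 2) (s : ℝ) :
    bridgeCovLower m T j s s = bridgeCovUpper m T j s s := by
  unfold bridgeCovLower bridgeCovUpper
  congr 1
  interval_cases j <;>
    simp only [lowerCovDeriv, upperCovDeriv, sub_self, zero_div, Real.exp_zero]
  ring

/-- The jump, left minus right, which after multiplication by `m ^ 2` becomes the unit mass `δ_s`.
-/
lemma bridgeCovLower_sub_upper_three_diag (m T s : ℝ) :
    bridgeCovLower m T 3 s s - bridgeCovUpper m T 3 s s = -1 / m ^ 2 := by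
  simp only [bridgeCovLower, bridgeCovUpper, lowerCovDeriv, upperCovDeriv, sub_self, zero_div,
    Real.exp_zero]
  ring

lemma continuous_bridgeCovDeriv (m T : ℝ) {j : ℕ} (hj : j ≤ 2) :
    Continuous fun p : ℝ × ℝ => bridgeCovDeriv m T j p.1 p.2 := by
  refine Continuous.if_le (continuous_bridgeCovLower m T j) (continuous_bridgeCovUpper m T j)
    continuous_snd continuous_fst fun p hp => ?_
  rw [hp]
  exact bridgeCovLower_eq_upper_diag m T hj p.1

lemma hasDerivAt_bridgeCovLower {m : ℝ} (hm : m ≠ 0) (T : ℝ) {j : ℕ} (hj : j ≤ 3) (s t : ℝ) :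
    HasDerivAt (bridgeCovLower m T j s) (bridgeCovLower m T (j + 1) s t) t :=
  (hasDerivAt_lowerCovDeriv hm hj s t).sub ((hasDerivAt_lowerCovDeriv hm hj T t).const_mul _)

lemma hasDerivAt_bridgeCovUpper {m : ℝ} (hm : m ≠ 0) (T : ℝ) {j : ℕ} (hj : j ≤ 3) (s t : ℝ) :
    HasDerivAt (bridgeCovUpper m T j s) (bridgeCovUpper m T (j + 1) s t) t :=
  (hasDerivAt_upperCovDeriv hm hj s t).sub ((hasDerivAt_lowerCovDeriv hm hj T t).const_mul _)

/-- At the junction the one-sided derivatives exist and agree, and together they give a two-sided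
derivative. -/
lemma hasDerivAt_ite_le {s : ℝ} {f f' g g' : ℝ → ℝ} (hf : ∀ t, HasDerivAt f (f' t) t)
    (hg : ∀ t, HasDerivAt g (g' t) t) (h : f s = g s) (h' : f' s = g' s) (t : ℝ) :
    HasDerivAt (fun t => if t ≤ s then f t else g t) (if t ≤ s then f' t else g' t) t := by
  rcases lt_trichotomy t s with hts | rfl | hts
  · rw [if_pos hts.le]
    refine (hf t).congr_of_eventuallyEq ?_
    filter_upwards [Iio_mem_nhds hts] with r hr
    rw [if_pos hr.le]
  · rw [if_pos le_rfl, ← hasDerivWithinAt_univ, ← Iic_union_Ici (a := t)]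
    refine HasDerivWithinAt.union ?_ ?_
    · refine (hf t).hasDerivWithinAt.congr (fun r hr => ?_) ?_
      · exact if_pos hr
      · exact if_pos le_rfl
    · rw [h']
      refine (hg t).hasDerivWithinAt.congr (fun r hr => ?_) ?_
      · rcases eq_or_lt_of_le (mem_Ici.1 hr) with rfl | hr
        · rw [if_pos le_rfl, h]
        · exact if_neg hr.not_ge
      · rw [if_pos le_rfl, h]
  · rw [if_neg hts.not_ge]
    refine (hg t).congr_of_eventuallyEq ?_
    filter_upwards [Ioi_mem_nhds hts] with r hr
    rw [if_neg hr.not_ge]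

/-- The bound `j ≤ 1` is sharp: the second derivative has a corner on the diagonal. -/
lemma hasDerivAt_bridgeCovDeriv {m : ℝ} (hm : m ≠ 0) (T : ℝ) {j : ℕ} (hj : j ≤ 1) (s t : ℝ) :
    HasDerivAt (bridgeCovDeriv m T j s) (bridgeCovDeriv m T (j + 1) s t) t :=
  hasDerivAt_ite_le (hasDerivAt_bridgeCovLower hm T (by omega) s)
    (hasDerivAt_bridgeCovUpper hm T (by omega) s)
    (bridgeCovLower_eq_upper_diag m T (by omega) s)
    (bridgeCovLower_eq_upper_diag m T (by omega) s) t

lemma bridgeCov_zero_right (m T : ℝ) {s : ℝ} (hs : 0 ≤ s) : bridgeCov m T s 0 = 0 := by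
  rw [bridgeCov, freeCov_of_le hs, lowerCov_zero_right, lowerCov_zero_right, mul_zero, sub_zero]

lemma bridgeCov_self_right {m T s : ℝ} (hm : 0 < m) (hT : 0 < T) (hs : s ≤ T) :
    bridgeCov m T s T = 0 := by
  rw [bridgeCov, freeCov_of_ge hs, bridgeCoeff, div_mul_cancel₀ _ (lowerCov_self_pos hm hT).ne',
    sub_self]

lemma lowerCovDeriv_robin_left {m : ℝ} (hm : m ≠ 0) (s : ℝ) :
    m * lowerCovDeriv m 2 s 0 = lowerCovDeriv m 1 s 0 := by
  simp only [lowerCovDeriv, neg_zero, zero_div, Real.exp_zero]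
  field_simp
  ring

/-- Needed only with both arguments equal to `T`: it says that the correction term `R(T,·)` does not
spoil the condition at the right end. -/
lemma lowerCovDeriv_robin_right {m : ℝ} (hm : m ≠ 0) (T : ℝ) :
    m * lowerCovDeriv m 2 T T = -lowerCovDeriv m 1 T T := by
  simp only [lowerCovDeriv, sub_self, zero_div, Real.exp_zero]
  field_simp
  ring

/-- To the right of `s` the kernel is a constant plus a multiple of `exp(-t/m)`, so the right-hand
condition holds at every point. -/
lemma upperCovDeriv_robin {m : ℝ} (hm : m ≠ 0) (s t : ℝ) :
    m * upperCovDeriv m 2 s t = -upperCovDeriv m 1 s t := by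
  simp only [upperCovDeriv]
  field_simp

lemma bridgeCovDeriv_robin_left {m : ℝ} (hm : m ≠ 0) (T : ℝ) {s : ℝ} (hs : 0 ≤ s) :
    m * bridgeCovDeriv m T 2 s 0 = bridgeCovDeriv m T 1 s 0 := by
  simp only [bridgeCovDeriv, if_pos hs, bridgeCovLower]
  linear_combination lowerCovDeriv_robin_left hm s - bridgeCoeff m T s * lowerCovDeriv_robin_left hm T

lemma bridgeCovDeriv_robin_right {m : ℝ} (hm : m ≠ 0) {T s : ℝ} (hs : s ≤ T) :
    m * bridgeCovDeriv m T 2 s T = -bridgeCovDeriv m T 1 s T := by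
  -- For `s = T` the endpoint lies on the diagonal, where the definition picks the lower branch; up
  -- to order two the branches agree there.
  have e : ∀ j ≤ 2, bridgeCovDeriv m T j s T = bridgeCovUpper m T j s T := fun j hj => by
    rcases eq_or_lt_of_le hs with rfl | h
    · rw [bridgeCovDeriv, if_pos le_rfl, bridgeCovLower_eq_upper_diag m s hj]
    · rw [bridgeCovDeriv, if_neg h.not_ge]
  rw [e 2 le_rfl, e 1 (by norm_num), bridgeCovUpper, bridgeCovUpper]
  linear_combination upperCovDeriv_robin hm s T - bridgeCoeff m T s * lowerCovDeriv_robin_right hm T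

/-! ### Test functions -/

lemma IsTestFunction.deriv {T : ℝ} {φ : ℝ → ℝ} (h : IsTestFunction T φ) :
    IsTestFunction T (deriv φ) where
  smooth := ((contDiff_infty_iff_deriv (𝕜 := ℝ)).1 h.smooth).2
  compact := h.compact.deriv
  support := (closure_minimal (support_deriv_subset) (isClosed_tsupport φ)).trans h.support

lemma IsTestFunction.iteratedDeriv {T : ℝ} {φ : ℝ → ℝ} (h : IsTestFunction T φ) (k : ℕ) :
    IsTestFunction T (iteratedDeriv k φ) := by
  induction k with
  | zero => simpa using h
  | succ k ih => rw [iteratedDeriv_succ]; exact ih.deriv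

lemma IsTestFunction.left_value {T : ℝ} {φ : ℝ → ℝ} (h : IsTestFunction T φ) : φ 0 = 0 :=
  image_eq_zero_of_notMem_tsupport fun hh => lt_irrefl _ (h.support hh).1

lemma IsTestFunction.right_value {T : ℝ} {φ : ℝ → ℝ} (h : IsTestFunction T φ) : φ T = 0 :=
  image_eq_zero_of_notMem_tsupport fun hh => lt_irrefl _ (h.support hh).2

lemma IsTestFunction.hasDerivAt {T : ℝ} {φ : ℝ → ℝ} (h : IsTestFunction T φ) (t : ℝ) :
    HasDerivAt φ (_root_.deriv φ t) t :=
  (h.smooth.differentiable (by simp) t).hasDerivAt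

/-- Integration by parts against a piecewise `C¹` function with a jump at `s`. -/
lemma IsTestFunction.integral_deriv_mul_ite {T s : ℝ} (hs : s ∈ Icc 0 T) {φ : ℝ → ℝ}
    (hφ : IsTestFunction T φ) {f f' g g' : ℝ → ℝ}
    (hf : ∀ t, HasDerivAt f (f' t) t) (hf' : Continuous f')
    (hg : ∀ t, HasDerivAt g (g' t) t) (hg' : Continuous g') :
    ∫ t in Icc 0 T, _root_.deriv φ t * (if t ≤ s then f t else g t) =
      φ s * (f s - g s) - ∫ t in Icc 0 T, φ t * (if t ≤ s then f' t else g' t) := by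
  have hcf : Continuous f := continuous_iff_continuousAt.2 fun t => (hf t).continuousAt
  have hcg : Continuous g := continuous_iff_continuousAt.2 fun t => (hg t).continuousAt
  have hcd : Continuous (_root_.deriv φ) := hφ.deriv.smooth.continuous
  have hcφ := hφ.smooth.continuous
  -- Cut at `s`, where the integrand changes branch. Integration by parts on each piece leaves the
  -- jump at `s`; the terms at `0` and `T` vanish with `φ`.
  have split : ∀ (ψ a b : ℝ → ℝ), Continuous ψ → Continuous a → Continuous b →
      ∫ t in Icc 0 T, ψ t * (if t ≤ s then a t else b t) =
        (∫ t in (0 : ℝ)..s, ψ t * a t) + ∫ t in s..T, ψ t * b t := by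
    intro ψ a b hψ ha hb
    have e1 : EqOn (fun t => ψ t * a t) (fun t => ψ t * (if t ≤ s then a t else b t))
        (Ioc 0 s) := fun t ht => by simp only [if_pos ht.2]
    have e2 : EqOn (fun t => ψ t * b t) (fun t => ψ t * (if t ≤ s then a t else b t))
        (Ioc s T) := fun t ht => by simp only [if_neg ht.1.not_ge]
    have i1 : IntegrableOn (fun t => ψ t * a t) (Ioc 0 s) :=
      ((hψ.mul ha).integrableOn_Icc).mono_set Ioc_subset_Icc_self
    have i2 : IntegrableOn (fun t => ψ t * b t) (Ioc s T) :=
      ((hψ.mul hb).integrableOn_Icc).mono_set Ioc_subset_Icc_self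
    rw [integral_Icc_eq_integral_Ioc, ← Ioc_union_Ioc_eq_Ioc hs.1 hs.2,
      setIntegral_union (Ioc_disjoint_Ioc_of_le le_rfl) measurableSet_Ioc
        (i1.congr_fun e1 measurableSet_Ioc) (i2.congr_fun e2 measurableSet_Ioc),
      intervalIntegral.integral_of_le hs.1, intervalIntegral.integral_of_le hs.2,
      setIntegral_congr_fun measurableSet_Ioc e1, setIntegral_congr_fun measurableSet_Ioc e2]
  have parts : ∀ (a a' : ℝ → ℝ) (l r : ℝ), (∀ t, HasDerivAt a (a' t) t) → Continuous a' →
      ∫ t in l..r, _root_.deriv φ t * a t = φ r * a r - φ l * a l - ∫ t in l..r, φ t * a' t := by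
    intro a a' l r ha ha'
    rw [intervalIntegral.integral_mul_deriv_eq_deriv_mul (u := φ) (v := a)
      (fun t _ => hφ.hasDerivAt t) (fun t _ => ha t) (hcd.intervalIntegrable _ _)
      (ha'.intervalIntegrable _ _)]
    ring
  rw [split _ _ _ hcd hcf hcg, split _ _ _ hcφ hf' hg', parts f f' 0 s hf hf',
    parts g g' s T hg hg', hφ.left_value, hφ.right_value]
  ring

lemma IsTestFunction.integral_deriv_mul_bridgeCovDeriv {m T s : ℝ} (hm : m ≠ 0)
    (hs : s ∈ Icc 0 T) {φ : ℝ → ℝ} (hφ : IsTestFunction T φ) {j : ℕ} (hj : j ≤ 3) :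
    ∫ t in Icc 0 T, _root_.deriv φ t * bridgeCovDeriv m T j s t =
      (if j = 3 then -φ s / m ^ 2 else 0) - ∫ t in Icc 0 T, φ t * bridgeCovDeriv m T (j + 1) s t := by
  refine (hφ.integral_deriv_mul_ite hs (hasDerivAt_bridgeCovLower hm T hj s)
    ((continuous_bridgeCovLower m T (j + 1)).comp (continuous_const.prodMk continuous_id))
    (hasDerivAt_bridgeCovUpper hm T hj s)
    ((continuous_bridgeCovUpper m T (j + 1)).comp (continuous_const.prodMk continuous_id))).trans ?_
  congr 1
  split_ifs with h
  · rw [h, bridgeCovLower_sub_upper_three_diag]; ring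
  · rw [bridgeCovLower_eq_upper_diag m T (by omega), sub_self, mul_zero]

/-- The derivatives of `bridgeCov m T s` in the sense of distributions. -/
lemma IsTestFunction.integral_iteratedDeriv_mul_bridgeCov {m T s : ℝ} (hm : m ≠ 0)
    (hs : s ∈ Icc 0 T) {φ : ℝ → ℝ} (hφ : IsTestFunction T φ) {k : ℕ} (hk : k ≤ 4) :
    ∫ t in Icc 0 T, _root_.iteratedDeriv k φ t * bridgeCovDeriv m T 0 s t =
      (-1) ^ k * (∫ t in Icc 0 T, φ t * bridgeCovDeriv m T k s t) +
        if k = 4 then φ s / m ^ 2 else 0 := by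
  -- The derivatives are moved off the test function one at a time; only the step from the third to
  -- the fourth derivative of the kernel meets a jump.
  have key : ∀ j ≤ 3, ∀ ψ : ℝ → ℝ, IsTestFunction T ψ → _ :=
    fun j hj ψ hψ => hψ.integral_deriv_mul_bridgeCovDeriv hm hs hj
  interval_cases k
  · simp
  · rw [iteratedDeriv_one, key 0 (by norm_num) φ hφ]; simp
  · rw [iteratedDeriv_succ, key 0 (by norm_num) _ (hφ.iteratedDeriv _), iteratedDeriv_one,
      key 1 (by norm_num) _ hφ]
    simp
  · rw [iteratedDeriv_succ, key 0 (by norm_num) _ (hφ.iteratedDeriv _), iteratedDeriv_succ,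
      key 1 (by norm_num) _ (hφ.iteratedDeriv _), iteratedDeriv_one, key 2 (by norm_num) _ hφ]
    simp
    norm_num
  · rw [iteratedDeriv_succ, key 0 (by norm_num) _ (hφ.iteratedDeriv _), iteratedDeriv_succ,
      key 1 (by norm_num) _ (hφ.iteratedDeriv _), iteratedDeriv_succ,
      key 2 (by norm_num) _ (hφ.iteratedDeriv _), iteratedDeriv_one, key 3 (by norm_num) _ hφ]
    simp
    ring

/-! ### The Green's function and the mean path -/

/-- Smoothness is read off from an explicit list of successive derivatives, which also avoids
computing iterated derivatives of the closed formulas. -/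
lemma contDiff_of_hasDerivAt_chain {V : Type*} [NormedAddCommGroup V] [NormedSpace ℝ V] {n : ℕ}
    {F : ℕ → ℝ → V} (hF : ∀ j < n, ∀ t, HasDerivAt (F j) (F (j + 1) t) t)
    (hc : Continuous (F n)) : ContDiff ℝ n (F 0) := by
  induction n generalizing F with
  | zero => exact contDiff_zero.2 hc
  | succ n ih =>
    have h := ih (F := fun j => F (j + 1)) (fun j hj => hF (j + 1) (by omega)) hc
    rw [Nat.cast_succ, contDiff_succ_iff_deriv]
    refine ⟨fun t => (hF 0 (by omega) t).differentiableAt, by simp, ?_⟩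
    rwa [show deriv (F 0) = F (0 + 1) from funext fun t => (hF 0 (by omega) t).deriv]

lemma iteratedDeriv_of_hasDerivAt_chain {V : Type*} [NormedAddCommGroup V] [NormedSpace ℝ V]
    {n : ℕ} {F : ℕ → ℝ → V} (hF : ∀ j < n, ∀ t, HasDerivAt (F j) (F (j + 1) t) t) {j : ℕ}
    (hj : j ≤ n) : iteratedDeriv j (F 0) = F j := by
  induction j with
  | zero => exact iteratedDeriv_zero
  | succ j ih =>
    rw [iteratedDeriv_succ, ih (by omega)]
    exact funext fun t => (hF j (by omega) t).deriv

lemma iteratedDerivWithin_Icc_of_hasDerivAt_chain {V : Type*} [NormedAddCommGroup V]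
    [NormedSpace ℝ V] {n : ℕ} {F : ℕ → ℝ → V}
    (hF : ∀ j < n, ∀ t, HasDerivAt (F j) (F (j + 1) t) t) (hc : Continuous (F n)) {j : ℕ}
    (hj : j ≤ n) {T t : ℝ} (hT : 0 < T) (ht : t ∈ Icc 0 T) :
    iteratedDerivWithin j (F 0) (Icc 0 T) t = F j t := by
  rw [iteratedDerivWithin_eq_iteratedDeriv (uniqueDiffOn_Icc hT)
    ((contDiff_of_hasDerivAt_chain hF hc).of_le (by exact_mod_cast hj)).contDiffAt ht,
    iteratedDeriv_of_hasDerivAt_chain hF hj]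

/-- The covariance of the bridge is the Green's function of `m² ∂ₜ⁴ - ∂ₜ²`. -/
lemma isGreenFunction_bridgeCov {m T : ℝ} (hm : 0 < m) (hT : 0 < T) :
    IsGreenFunction m T (bridgeCov m T) := by
  have e : ∀ s, bridgeCovDeriv m T 0 s = bridgeCov m T s :=
    fun s => funext fun t => bridgeCovDeriv_zero m T s t
  have hF : ∀ s, ∀ j < 2, ∀ t, HasDerivAt (bridgeCovDeriv m T j s)
      (bridgeCovDeriv m T (j + 1) s t) t :=
    fun s j hj t => hasDerivAt_bridgeCovDeriv hm.ne' T (by omega) s t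
  have hc : ∀ s, Continuous (bridgeCovDeriv m T 2 s) := fun s =>
    (continuous_bridgeCovDeriv m T le_rfl).comp (continuous_const.prodMk continuous_id)
  have hd : ∀ s, ∀ j ≤ 2, ∀ t ∈ Icc (0 : ℝ) T,
      iteratedDerivWithin j (bridgeCov m T s) (Icc 0 T) t = bridgeCovDeriv m T j s t := by
    intro s j hj t ht
    rw [← e]
    exact iteratedDerivWithin_Icc_of_hasDerivAt_chain
      (F := fun j => bridgeCovDeriv m T j s) (hF s) (hc s) hj hT ht
  have h0 : (0 : ℝ) ∈ Icc 0 T := ⟨le_rfl, hT.le⟩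
  have h1 : T ∈ Icc 0 T := ⟨hT.le, le_rfl⟩
  refine ⟨(continuous_bridgeCov m T).continuousOn, fun s _ => ?_, fun s hs φ hφ => ?_,
    fun s hs => bridgeCov_zero_right m T hs.1, fun s hs => bridgeCov_self_right hm hT hs.2,
    fun s hs => ?_, fun s hs => ?_⟩
  · have := contDiff_of_hasDerivAt_chain (F := fun j => bridgeCovDeriv m T j s) (hF s) (hc s)
    rw [e] at this
    exact this.contDiffOn
  · have h4 := hφ.integral_iteratedDeriv_mul_bridgeCov hm.ne' hs (k := 4) le_rfl
    have h2 := hφ.integral_iteratedDeriv_mul_bridgeCov hm.ne' hs (k := 2) (by norm_num)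
    have hcont : Continuous (bridgeCovDeriv m T 0 s) :=
      (continuous_bridgeCovDeriv m T (j := 0) (by norm_num)).comp
        (continuous_const.prodMk continuous_id)
    have hi : ∀ k, IntegrableOn (fun t => _root_.iteratedDeriv k φ t * bridgeCovDeriv m T 0 s t)
        (Icc 0 T) := fun k => ((hφ.continuous_iteratedDeriv k).mul hcont).integrableOn_Icc
    simp only [bridgeCovDeriv_four, mul_div_assoc', integral_div] at h4
    -- Once the derivatives are moved to the kernel, the integrals of the fourth and second
    -- derivatives cancel by `bridgeCovDeriv_four` and only the point mass remains.
    have e2 : (fun t => bridgeCov m T s t * (m ^ 2 * iteratedDeriv 4 φ t - iteratedDeriv 2 φ t)) =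
        fun t => m ^ 2 * (iteratedDeriv 4 φ t * bridgeCovDeriv m T 0 s t) -
          iteratedDeriv 2 φ t * bridgeCovDeriv m T 0 s t := by
      funext t; rw [bridgeCovDeriv_zero]; ring
    rw [e2, integral_sub ((hi 4).const_mul _) (hi 2), integral_const_mul, h4, h2]
    simp
    field_simp
    ring
  · rw [hd s 2 le_rfl 0 h0, ← iteratedDerivWithin_one, hd s 1 (by norm_num) 0 h0,
      bridgeCovDeriv_robin_left hm.ne' T hs.1]
  · rw [hd s 2 le_rfl T h1, ← iteratedDerivWithin_one, hd s 1 (by norm_num) T h1,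
      bridgeCovDeriv_robin_right hm.ne' hs.2]

/-- The mean of the bridge. -/
def bridgeMean {d : ℕ} (m T : ℝ) (xminus xplus : E d) (t : ℝ) : E d :=
  xminus + bridgeCoeff m T t • (xplus - xminus)

lemma isMeanPath_bridgeMean {d : ℕ} {m T : ℝ} (hm : 0 < m) (hT : 0 < T) (xminus xplus : E d) :
    IsMeanPath m T xminus xplus (bridgeMean m T xminus xplus) := by
  -- The list of successive derivatives of the mean; the constant `xminus` survives only at order
  -- zero.
  set F : ℕ → ℝ → E d := fun j t => (if j = 0 then xminus else 0) +
    (lowerCovDeriv m j T t / lowerCov m T T) • (xplus - xminus) with hFdef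
  have hF : ∀ j < 4, ∀ t, HasDerivAt (F j) (F (j + 1) t) t := by
    intro j hj t
    have h := (((hasDerivAt_lowerCovDeriv hm.ne' (show j ≤ 3 by omega) T t).div_const
      (lowerCov m T T)).smul_const (xplus - xminus)).const_add (if j = 0 then xminus else 0)
    refine h.congr_deriv ?_
    simp [hFdef]
  have hc : Continuous (F 4) := by
    have : Continuous (lowerCovDeriv m 4 T) :=
      (continuous_lowerCovDeriv m 4).comp (continuous_const.prodMk continuous_id)
    exact continuous_const.add ((this.div_const _).smul continuous_const)
  have e : F 0 = bridgeMean m T xminus xplus := by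
    funext t; simp [hFdef, bridgeMean, bridgeCoeff, lowerCovDeriv]
  have hd : ∀ j ≤ 4, ∀ t ∈ Icc (0 : ℝ) T,
      iteratedDerivWithin j (bridgeMean m T xminus xplus) (Icc 0 T) t = F j t := by
    intro j hj t ht
    rw [← e]
    exact iteratedDerivWithin_Icc_of_hasDerivAt_chain hF hc hj hT ht
  have h0 : (0 : ℝ) ∈ Icc 0 T := ⟨le_rfl, hT.le⟩
  have h1 : T ∈ Icc 0 T := ⟨hT.le, le_rfl⟩
  refine ⟨?_, fun t ht => ?_, ?_, ?_, ?_, ?_⟩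
  · rw [← e]
    exact_mod_cast (contDiff_of_hasDerivAt_chain hF hc).contDiffOn
  · rw [hd 4 le_rfl t ht, hd 2 (by norm_num) t ht]
    have : lowerCovDeriv m 2 T t = m ^ 2 * lowerCovDeriv m 4 T t := by
      have := hm.ne'
      simp only [lowerCovDeriv]
      field_simp
    simp only [hFdef, this, OfNat.ofNat_ne_zero, if_false, zero_add, smul_smul]
    rw [mul_div_assoc, neg_mul, neg_smul, neg_add_cancel]
  · simp [bridgeMean, bridgeCoeff_zero]
  · simp [bridgeMean, bridgeCoeff_self hm hT]
  · rw [hd 2 (by norm_num) 0 h0, ← iteratedDerivWithin_one, hd 1 (by norm_num) 0 h0]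
    simp only [hFdef, OfNat.ofNat_ne_zero, one_ne_zero, if_false, zero_add, smul_smul]
    rw [← mul_div_assoc, lowerCovDeriv_robin_left hm.ne']
  · rw [hd 2 (by norm_num) T h1, ← iteratedDerivWithin_one, hd 1 (by norm_num) T h1]
    simp only [hFdef, OfNat.ofNat_ne_zero, one_ne_zero, if_false, zero_add, smul_smul]
    rw [← mul_div_assoc, lowerCovDeriv_robin_right hm.ne', neg_div, neg_smul]

/-! ### Uniqueness for the boundary value problem -/

/-- An energy argument. For a solution, `F = m² u''' u - m² u'' u' - u' u` has derivative `-(m² u''²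
+ u'²)`, while the boundary conditions give `F(0) = -m u'(0)² ≤ 0 ≤ m u'(T)² = F(T)`. Hence `F` is
constant, so `u' = 0`, and `u(0) = 0` finishes. Derivatives are required only in the open interval,
so that both classical and weak solutions are covered. -/
lemma eq_zero_of_robin_boundary {m T : ℝ} (hm : 0 < m) (hT : 0 < T) {U₀ U₁ U₂ U₃ : ℝ → ℝ}
    (hc₀ : ContinuousOn U₀ (Icc 0 T)) (hc₁ : ContinuousOn U₁ (Icc 0 T))
    (hc₂ : ContinuousOn U₂ (Icc 0 T)) (hc₃ : ContinuousOn U₃ (Icc 0 T))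
    (hd₀ : ∀ t ∈ Ioo 0 T, HasDerivAt U₀ (U₁ t) t) (hd₁ : ∀ t ∈ Ioo 0 T, HasDerivAt U₁ (U₂ t) t)
    (hd₂ : ∀ t ∈ Ioo 0 T, HasDerivAt U₂ (U₃ t) t)
    (hd₃ : ∀ t ∈ Ioo 0 T, HasDerivAt U₃ (U₂ t / m ^ 2) t)
    (hl : U₀ 0 = 0) (hr : U₀ T = 0) (hl' : m * U₂ 0 = U₁ 0) (hr' : m * U₂ T = -U₁ T) :
    ∀ t ∈ Icc 0 T, U₀ t = 0 := by
  set F : ℝ → ℝ := fun t => m ^ 2 * (U₃ t * U₀ t) - m ^ 2 * (U₂ t * U₁ t) - U₁ t * U₀ t with hF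
  have hFc : ContinuousOn F (Icc 0 T) := by fun_prop
  have hFd : ∀ t ∈ Ioo 0 T, HasDerivAt F (-(m ^ 2 * U₂ t ^ 2 + U₁ t ^ 2)) t := by
    intro t ht
    have h := ((((hd₃ t ht).mul (hd₀ t ht)).const_mul (m ^ 2)).sub
      (((hd₂ t ht).mul (hd₁ t ht)).const_mul (m ^ 2))).sub ((hd₁ t ht).mul (hd₀ t ht))
    refine h.congr_deriv ?_
    field_simp
    ring
  have hanti : AntitoneOn F (Icc 0 T) := by
    refine antitoneOn_of_deriv_nonpos (convex_Icc 0 T) hFc ?_ ?_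
    · rw [interior_Icc]
      exact fun t ht => (hFd t ht).differentiableAt.differentiableWithinAt
    · rw [interior_Icc]
      intro t ht
      rw [(hFd t ht).deriv]
      exact neg_nonpos.2 (by positivity)
  have h0 : (0 : ℝ) ∈ Icc 0 T := ⟨le_rfl, hT.le⟩
  have h1 : T ∈ Icc 0 T := ⟨hT.le, le_rfl⟩
  have hends : F 0 ≤ F T := by
    have e0 : F 0 = -(m * U₁ 0 ^ 2) := by
      simp only [hF, hl]; rw [← hl']; ring
    have e1 : F T = m * U₁ T ^ 2 := by
      simp only [hF, hr]; rw [← neg_eq_iff_eq_neg.2 hr']; ring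
    rw [e0, e1]
    have := mul_nonneg hm.le (sq_nonneg (U₁ 0))
    have := mul_nonneg hm.le (sq_nonneg (U₁ T))
    linarith
  have hconst : ∀ t ∈ Icc 0 T, F t = F 0 := fun t ht =>
    le_antisymm (hanti h0 ht ht.1) (hends.trans (hanti ht h1 ht.2))
  have hU₁ : ∀ t ∈ Ioo 0 T, U₁ t = 0 := by
    intro t ht
    have hd0 : HasDerivAt F 0 t := by
      refine (hasDerivAt_const t (F 0)).congr_of_eventuallyEq ?_
      filter_upwards [Ioo_mem_nhds ht.1 ht.2] with r hr using hconst r (Ioo_subset_Icc_self hr)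
    have h := (hFd t ht).unique hd0
    have h2 : 0 ≤ m ^ 2 * U₂ t ^ 2 := by positivity
    exact pow_eq_zero_iff two_ne_zero |>.1 (le_antisymm (by linarith) (sq_nonneg (U₁ t)))
  intro t ht
  rcases eq_or_lt_of_le ht.1 with rfl | h
  · exact hl
  · obtain ⟨c, hc, hslope⟩ := exists_hasDerivAt_eq_slope U₀ U₁ h
      (hc₀.mono (Icc_subset_Icc_right ht.2)) fun r hr => hd₀ r ⟨hr.1, hr.2.trans_le ht.2⟩
    rw [hU₁ c ⟨hc.1, hc.2.trans_le ht.2⟩, hl, eq_div_iff (by linarith)] at hslope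
    linarith

/-- The difference of two solutions satisfies the homogeneous problem, and each coordinate falls
under `eq_zero_of_robin_boundary`. -/
lemma IsMeanPath.eqOn {d : ℕ} {m T : ℝ} (hm : 0 < m) (hT : 0 < T) {a b : E d} {y z : ℝ → E d}
    (hy : IsMeanPath m T a b y) (hz : IsMeanPath m T a b z) : EqOn y z (Icc 0 T) := by
  have hu := uniqueDiffOn_Icc hT
  have hc : ∀ {w : ℝ → E d}, IsMeanPath m T a b w → ∀ j ≤ 4,
      ContinuousOn (iteratedDerivWithin j w (Icc 0 T)) (Icc 0 T) := fun hw j hj =>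
    hw.contDiffOn.continuousOn_iteratedDerivWithin (by exact_mod_cast hj) hu
  have hd : ∀ {w : ℝ → E d}, IsMeanPath m T a b w → ∀ j < 4, ∀ t ∈ Ioo 0 T,
      HasDerivAt (iteratedDerivWithin j w (Icc 0 T))
        (iteratedDerivWithin (j + 1) w (Icc 0 T) t) t := by
    intro w hw j hj t ht
    rw [iteratedDerivWithin_succ]
    exact ((hw.contDiffOn.differentiableOn_iteratedDerivWithin (by exact_mod_cast hj) hu) t
      (Ioo_subset_Icc_self ht)).hasDerivWithinAt.hasDerivAt (Icc_mem_nhds ht.1 ht.2)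
  intro t ht
  ext i
  set U : ℕ → ℝ → ℝ := fun j t =>
    (iteratedDerivWithin j y (Icc 0 T) t - iteratedDerivWithin j z (Icc 0 T) t) i with hU
  have hUc : ∀ j ≤ 4, ContinuousOn (U j) (Icc 0 T) := fun j hj =>
    (EuclideanSpace.proj (𝕜 := ℝ) i).continuous.comp_continuousOn ((hc hy j hj).sub (hc hz j hj))
  have hUd : ∀ j < 4, ∀ t ∈ Ioo 0 T, HasDerivAt (U j) (U (j + 1) t) t := fun j hj t ht =>
    (EuclideanSpace.proj (𝕜 := ℝ) i).hasFDerivAt.comp_hasDerivAt t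
      ((hd hy j hj t ht).sub (hd hz j hj t ht))
  have key := eq_zero_of_robin_boundary hm hT (hUc 0 (by norm_num)) (hUc 1 (by norm_num))
    (hUc 2 (by norm_num)) (hUc 3 (by norm_num)) (hUd 0 (by norm_num)) (hUd 1 (by norm_num))
    (hUd 2 (by norm_num)) (fun t ht => ?_) ?_ ?_ ?_ ?_ t ht
  · simpa [hU, sub_eq_zero] using key
  · refine (hUd 3 (by norm_num) t ht).congr_deriv ?_
    have e1 := congrArg (· i) (hy.equation t (Ioo_subset_Icc_self ht))
    have e2 := congrArg (· i) (hz.equation t (Ioo_subset_Icc_self ht))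
    simp only [PiLp.add_apply, PiLp.smul_apply, smul_eq_mul, PiLp.zero_apply] at e1 e2
    simp only [hU, PiLp.sub_apply]
    field_simp
    linarith
  · simp [hU, hy.left_value, hz.left_value]
  · simp [hU, hy.right_value, hz.right_value]
  · have e1 := congrArg (· i) hy.left_deriv
    have e2 := congrArg (· i) hz.left_deriv
    simp only [PiLp.smul_apply, smul_eq_mul] at e1 e2
    simp only [hU, PiLp.sub_apply, iteratedDerivWithin_one, mul_sub, e1, e2]
  · have e1 := congrArg (· i) hy.right_deriv
    have e2 := congrArg (· i) hz.right_deriv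
    simp only [PiLp.smul_apply, smul_eq_mul, PiLp.neg_apply] at e1 e2
    simp only [hU, PiLp.sub_apply, iteratedDerivWithin_one, mul_sub, e1, e2]
    ring

/-! ### Integral operators on `L²([0,T], ℝᵈ)` -/

lemma integrableOn_L2 {d : ℕ} {T : ℝ} (g : L2 d T) : IntegrableOn (fun t => g t) (Icc 0 T) :=
  (Lp.memLp g).integrable (by norm_num)

/-- The integral operator with kernel `H`, acting on the first variable. -/
def kernelIntegral {d : ℕ} {T : ℝ} (H : ℝ → ℝ → ℝ) (g : L2 d T) (s : ℝ) : E d :=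
  ∫ t in Icc 0 T, H t s • g t

/-- A kernel that is measurable and bounded on `[0,T]²`. -/
structure IsBoundedKernel (T : ℝ) (H : ℝ → ℝ → ℝ) : Prop where
  measurable : Measurable fun p : ℝ × ℝ => H p.1 p.2
  bounded : ∃ M, 0 ≤ M ∧ ∀ s ∈ Icc 0 T, ∀ t ∈ Icc 0 T, |H t s| ≤ M

namespace IsBoundedKernel

variable {d : ℕ} {T : ℝ} {H : ℝ → ℝ → ℝ}

lemma integrable (hH : IsBoundedKernel T H) (g : L2 d T) {s : ℝ} (hs : s ∈ Icc 0 T) :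
    IntegrableOn (fun t => H t s • g t) (Icc 0 T) := by
  obtain ⟨M, -, hM⟩ := hH.bounded
  refine Integrable.bdd_smul (φ := fun t => H t s) (integrableOn_L2 g) M ?_ ?_
  · exact (hH.measurable.comp (measurable_id.prodMk measurable_const)).aestronglyMeasurable
  · filter_upwards [ae_restrict_mem measurableSet_Icc] with t ht using hM s hs t ht

lemma integrable_prod (hH : IsBoundedKernel T H) (g : L2 d T) {ψ : ℝ → ℝ} (hψ : Continuous ψ) :
    Integrable (fun p : ℝ × ℝ => ψ p.1 • H p.2 p.1 • g p.2)
      ((volume.restrict (Icc 0 T)).prod (volume.restrict (Icc 0 T))) := by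
  obtain ⟨M, hM0, hM⟩ := hH.bounded
  obtain ⟨N, hN⟩ := isCompact_Icc.exists_bound_of_continuousOn (s := Icc 0 T) hψ.continuousOn
  simp_rw [smul_smul]
  refine Integrable.bdd_smul (φ := fun p : ℝ × ℝ => ψ p.1 * H p.2 p.1)
    ((integrableOn_L2 g).comp_snd (volume.restrict (Icc 0 T))) (N * M) ?_ ?_
  · exact ((hψ.measurable.comp measurable_fst).mul
      (hH.measurable.comp measurable_swap)).aestronglyMeasurable
  · rw [Measure.prod_restrict]
    filter_upwards [ae_restrict_mem (measurableSet_Icc.prod measurableSet_Icc)] with p hp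
    rw [norm_mul]
    exact mul_le_mul (hN _ hp.1) (hM _ hp.1 _ hp.2) (abs_nonneg _)
      ((norm_nonneg _).trans (hN _ hp.1))

lemma integral_smul_kernelIntegral (hH : IsBoundedKernel T H) (g : L2 d T) {ψ : ℝ → ℝ}
    (hψ : Continuous ψ) : ∫ s in Icc 0 T, ψ s • kernelIntegral H g s =
      ∫ t in Icc 0 T, (∫ s in Icc 0 T, ψ s * H t s) • g t := by
  simp_rw [kernelIntegral, ← integral_smul]
  rw [integral_integral_swap (hH.integrable_prod g hψ)]
  refine integral_congr_ae (Eventually.of_forall fun t => ?_)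
  simp only [smul_smul, integral_smul_const]

/-- On an interval of finite length the `L¹` norm is controlled by the `L²` norm; `c` is the Hölder
constant. -/
lemma norm_kernelIntegral_le (hH : IsBoundedKernel T H) :
    ∃ M, 0 ≤ M ∧ ∀ (g : L2 d T), ∀ s ∈ Icc 0 T, ‖kernelIntegral H g s‖ ≤ M * ‖g‖ := by
  obtain ⟨M, hM0, hM⟩ := hH.bounded
  set c : ENNReal := (volume.restrict (Icc 0 T) univ) ^ (1 / (1 : ENNReal).toReal - 1 / (2 : ENNReal).toReal)
  have hc : c ≠ ⊤ := ENNReal.rpow_ne_top_of_nonneg (by norm_num) (by simp)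
  refine ⟨M * c.toReal, by positivity, fun g s hs => ?_⟩
  have h1 : ∫ t in Icc 0 T, ‖g t‖ ≤ ‖g‖ * c.toReal := by
    rw [integral_norm_eq_lintegral_enorm (Lp.aestronglyMeasurable g), ← eLpNorm_one_eq_lintegral_enorm,
      Lp.norm_def, ← ENNReal.toReal_mul]
    exact ENNReal.toReal_mono (ENNReal.mul_ne_top (Lp.eLpNorm_ne_top g) hc)
      (eLpNorm_le_eLpNorm_mul_rpow_measure_univ (by norm_num) (Lp.aestronglyMeasurable g))
  calc ‖kernelIntegral H g s‖ ≤ ∫ t in Icc 0 T, M * ‖g t‖ := by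
        refine norm_integral_le_of_norm_le ((integrableOn_L2 g).norm.const_mul M) ?_
        filter_upwards [ae_restrict_mem measurableSet_Icc] with t ht
        rw [norm_smul]
        exact mul_le_mul_of_nonneg_right (hM s hs t ht) (norm_nonneg _)
    _ ≤ M * c.toReal * ‖g‖ := by
        rw [integral_const_mul, mul_assoc, mul_comm c.toReal]
        exact mul_le_mul_of_nonneg_left h1 hM0

lemma aestronglyMeasurable (hH : IsBoundedKernel T H) (g : L2 d T) :
    AEStronglyMeasurable (kernelIntegral H g) (volume.restrict (Icc 0 T)) := by
  have h := (hH.integrable_prod g (ψ := fun _ => 1) continuous_const).aestronglyMeasurable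
  simp only [one_smul] at h
  exact h.integral_prod_right'

lemma memLp (hH : IsBoundedKernel T H) (g : L2 d T) :
    MemLp (kernelIntegral H g) 2 (volume.restrict (Icc 0 T)) := by
  obtain ⟨M, hM0, hM⟩ := hH.norm_kernelIntegral_le (d := d)
  refine MemLp.of_bound (hH.aestronglyMeasurable g) (M * ‖g‖) ?_
  filter_upwards [ae_restrict_mem measurableSet_Icc] with s hs using hM g s hs

lemma kernelIntegral_add (hH : IsBoundedKernel T H) (g h : L2 d T) {s : ℝ} (hs : s ∈ Icc 0 T) :
    kernelIntegral H (g + h) s = kernelIntegral H g s + kernelIntegral H h s := by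
  rw [kernelIntegral, kernelIntegral, kernelIntegral,
    ← integral_add (hH.integrable g hs) (hH.integrable h hs)]
  refine integral_congr_ae ?_
  filter_upwards [Lp.coeFn_add g h] with t ht
  rw [ht, Pi.add_apply, smul_add]

lemma kernelIntegral_smul (H : ℝ → ℝ → ℝ) (c : ℝ) (g : L2 d T) (s : ℝ) :
    kernelIntegral H (c • g) s = c • kernelIntegral H g s := by
  rw [kernelIntegral, kernelIntegral, ← integral_smul]
  refine integral_congr_ae ?_
  filter_upwards [Lp.coeFn_smul c g] with t ht
  rw [ht, Pi.smul_apply, smul_comm]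

/-- The integral operator of a bounded kernel on `L²([0,T], ℝᵈ)`. -/
def toCLM (hH : IsBoundedKernel T H) (d : ℕ) : L2 d T →L[ℝ] L2 d T :=
  LinearMap.mkContinuousOfExistsBound
    { toFun := fun g => (hH.memLp g).toLp _
      map_add' := fun g h => by
        rw [← MemLp.toLp_add]
        refine MemLp.toLp_congr _ _ ?_
        filter_upwards [ae_restrict_mem measurableSet_Icc] with s hs
          using hH.kernelIntegral_add g h hs
      map_smul' := fun c g => by
        rw [RingHom.id_apply, ← MemLp.toLp_const_smul]
        exact MemLp.toLp_congr _ _ (Eventually.of_forall fun s => kernelIntegral_smul H c g s) }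
    (by
      obtain ⟨M, hM0, hM⟩ := hH.norm_kernelIntegral_le (d := d)
      refine ⟨measureUnivNNReal (volume.restrict (Icc 0 T)) ^ (2 : ENNReal).toReal⁻¹ * M,
        fun g => ?_⟩
      rw [mul_assoc]
      refine Lp.norm_le_of_ae_bound (by positivity) ?_
      filter_upwards [(hH.memLp g).coeFn_toLp, ae_restrict_mem measurableSet_Icc] with s hs hs'
      exact (congrArg norm hs).trans_le (hM g s hs'))

lemma toCLM_coeFn (hH : IsBoundedKernel T H) (g : L2 d T) :
    hH.toCLM d g =ᵐ[volume.restrict (Icc 0 T)] kernelIntegral H g :=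
  (hH.memLp g).coeFn_toLp

lemma continuousOn_kernelIntegral (hH : IsBoundedKernel T H)
    (hc : Continuous fun p : ℝ × ℝ => H p.1 p.2) (g : L2 d T) :
    ContinuousOn (kernelIntegral H g) (Icc 0 T) := by
  obtain ⟨M, hM0, hM⟩ := hH.bounded
  refine continuousOn_of_dominated (bound := fun t => M * ‖g t‖)
    (fun s hs => (hH.integrable g hs).aestronglyMeasurable) (fun s hs => ?_)
    ((integrableOn_L2 g).norm.const_mul M) (Eventually.of_forall fun t => ?_)
  · filter_upwards [ae_restrict_mem measurableSet_Icc] with t ht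
    rw [norm_smul]
    exact mul_le_mul_of_nonneg_right (hM s hs t ht) (norm_nonneg _)
  · exact ((hc.comp (continuous_const.prodMk continuous_id)).smul continuous_const).continuousOn

end IsBoundedKernel

/-! ### Weak derivatives -/

section WeakDerivative

variable {d : ℕ} {T : ℝ}

/-- By Fubini it suffices to differentiate each `H t` in the sense of distributions. A point mass `c
δ_t` in that derivative, integrated against `g t`, becomes the extra term `c • g`. -/
lemma IsWeakDeriv.of_ae_eq_kernelIntegral {H : ℝ → ℝ → ℝ} (hH : IsBoundedKernel T H)
    {H' : ℝ → ℝ → ℝ} (hH' : IsBoundedKernel T H') {k : ℕ} (c : ℝ) (g : L2 d T)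
    (h : ∀ t ∈ Icc 0 T, ∀ φ : ℝ → ℝ, IsTestFunction T φ →
      ∫ s in Icc 0 T, iteratedDeriv k φ s * H t s =
        (-1) ^ k * ((∫ s in Icc 0 T, φ s * H' t s) + c * φ t)) :
    IsWeakDeriv k (hH.toCLM d g) (hH'.toCLM d g + c • g) := by
  intro φ hφ
  have e1 : ∫ s in Icc 0 T, iteratedDeriv k φ s • (hH.toCLM d g) s =
      ∫ s in Icc 0 T, iteratedDeriv k φ s • kernelIntegral H g s := by
    refine integral_congr_ae ?_
    filter_upwards [hH.toCLM_coeFn g] with s hs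
    rw [hs]
  have e2 : ∫ s in Icc 0 T, φ s • (hH'.toCLM d g + c • g : L2 d T) s =
      (∫ s in Icc 0 T, φ s • kernelIntegral H' g s) + ∫ s in Icc 0 T, (c * φ s) • g s := by
    have i1 : IntegrableOn (fun s => φ s • kernelIntegral H' g s) (Icc 0 T) :=
      (integrable_smul_L2 hφ.smooth.continuous (hH'.toCLM d g)).congr (by
        filter_upwards [hH'.toCLM_coeFn g] with s hs
        rw [hs])
    have i2 : IntegrableOn (fun s => (c * φ s) • g s) (Icc 0 T) :=
      integrable_smul_L2 (continuous_const.mul hφ.smooth.continuous) g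
    rw [← integral_add i1 i2]
    refine integral_congr_ae ?_
    filter_upwards [hH'.toCLM_coeFn g, Lp.coeFn_add (hH'.toCLM d g) (c • g),
      Lp.coeFn_smul c g] with s h1 h2 h3
    rw [h2, Pi.add_apply, h3, Pi.smul_apply, h1, smul_add, smul_smul, mul_comm c]
  rw [e1, e2, hH.integral_smul_kernelIntegral g (hφ.continuous_iteratedDeriv k),
    hH'.integral_smul_kernelIntegral g hφ.smooth.continuous,
    ← integral_add, ← integral_smul]
  · refine integral_congr_ae ?_
    filter_upwards [ae_restrict_mem measurableSet_Icc] with t ht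
    rw [h t ht φ hφ, ← add_smul, smul_smul]
  · have := (hH'.integrable_prod g hφ.smooth.continuous).integral_prod_right
    simpa only [smul_smul, integral_smul_const] using this
  · exact integrable_smul_L2 (continuous_const.mul hφ.smooth.continuous) g

/-- Use `φ'` as the test function for `a`. This reduces higher order regularity to statements about
first derivatives. -/
lemma IsWeakDeriv.succ {k : ℕ} {u a b : L2 d T} (ha : IsWeakDeriv k u a)
    (hb : IsWeakDeriv (k + 1) u b) : IsWeakDeriv 1 a b := by
  intro φ hφ
  have h1 := ha _ hφ.deriv
  have h2 := hb _ hφ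
  rw [iteratedDeriv_succ', h1, pow_succ, mul_smul] at h2
  rw [iteratedDeriv_one]
  exact (smul_right_injective (E d) (pow_ne_zero k (by norm_num : (-1 : ℝ) ≠ 0)) h2).trans
    (by simp)

lemma exists_isTestFunction_integral_eq_one (hT : 0 < T) :
    ∃ φ, IsTestFunction T φ ∧ ∫ t in Icc 0 T, φ t = 1 := by
  let b : ContDiffBump (T / 2 : ℝ) := ⟨T / 8, T / 4, by linarith, by linarith⟩
  have hsub : tsupport (b.normed volume) ⊆ Ioo 0 T := by
    rw [b.tsupport_normed_eq, Real.closedBall_eq_Icc]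
    exact fun t ht => ⟨by have := ht.1; simp only [b] at this; linarith,
      by have := ht.2; simp only [b] at this; linarith⟩
  refine ⟨b.normed volume, ⟨b.contDiff_normed, b.hasCompactSupport_normed, hsub⟩, ?_⟩
  rw [setIntegral_eq_integral_of_forall_compl_eq_zero, b.integral_normed]
  exact fun t ht => image_eq_zero_of_notMem_tsupport
    fun hh => ht (Ioo_subset_Icc_self (hsub hh))

/-- A test function of integral zero is the derivative of a test function. -/
lemma IsTestFunction.exists_deriv_eq {χ : ℝ → ℝ} (hT : 0 < T) (hχ : IsTestFunction T χ)
    (h0 : ∫ t in Icc 0 T, χ t = 0) : ∃ φ, IsTestFunction T φ ∧ _root_.deriv φ = χ := by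
  have hd : ∀ t, HasDerivAt (fun t => ∫ s in (0 : ℝ)..t, χ s) (χ t) t := fun t =>
    intervalIntegral.integral_hasDerivAt_right (hχ.smooth.continuous.intervalIntegrable _ _)
      (hχ.smooth.continuous.stronglyMeasurableAtFilter _ _) hχ.smooth.continuous.continuousAt
  have hderiv : _root_.deriv (fun t => ∫ s in (0 : ℝ)..t, χ s) = χ := funext fun t => (hd t).deriv
  -- The support must be trapped in a compact interval inside `(0,T)`, so that the primitive has
  -- compact support there; if `χ = 0`, any interior point serves.
  have hab : ∃ a b, tsupport χ ⊆ Icc a b ∧ Icc a b ⊆ Ioo 0 T := by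
    rcases (tsupport χ).eq_empty_or_nonempty with he | hne
    · exact ⟨T / 2, T / 2, by simp [he], by rw [Icc_self, singleton_subset_iff]; constructor <;> linarith⟩
    · refine ⟨sInf (tsupport χ), sSup (tsupport χ), hχ.compact.isCompact.isBounded.subset_Icc_sInf_sSup, ?_⟩
      exact Icc_subset_Ioo (hχ.support (hχ.compact.isCompact.sInf_mem hne)).1
        (hχ.support (hχ.compact.isCompact.sSup_mem hne)).2
  obtain ⟨a, b, hsub, hI⟩ := hab
  have hz : ∀ t, t ∉ Icc a b → χ t = 0 := fun t ht =>
    image_eq_zero_of_notMem_tsupport fun hh => ht (hsub hh)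
  -- To the left of `a` nothing has been integrated yet; to the right of `b` the whole integral,
  -- which is zero, has.
  have hz2 : ∀ t ∉ Icc a b, ∫ s in (0 : ℝ)..t, χ s = 0 := by
    intro t ht
    rcases lt_or_ge t a with hta | hta
    · refine intervalIntegral.integral_zero_ae (Eventually.of_forall fun s hs => hz s fun hs' => ?_)
      have h0 : 0 < s := (hI hs').1
      rw [uIoc, mem_Ioc] at hs
      rcases le_total 0 t with h | h
      · rw [max_eq_right h] at hs; linarith [hs'.1, hs.2]
      · rw [max_eq_left h] at hs; linarith [hs.2]
    · have htb : b < t := by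
        by_contra hh
        exact ht ⟨hta, not_lt.1 hh⟩
      have e0 : ∫ s in (0 : ℝ)..T, χ s = 0 := by
        rw [intervalIntegral.integral_of_le hT.le, ← integral_Icc_eq_integral_Ioc, h0]
      rw [← intervalIntegral.integral_add_adjacent_intervals
        (hχ.smooth.continuous.intervalIntegrable 0 T) (hχ.smooth.continuous.intervalIntegrable T t),
        e0, zero_add]
      refine intervalIntegral.integral_zero_ae (Eventually.of_forall fun s hs => hz s fun hs' => ?_)
      have h0 : s < T := (hI hs').2
      rw [uIoc, mem_Ioc] at hs
      rcases le_total T t with h | h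
      · rw [min_eq_left h] at hs; linarith [hs.1]
      · rw [min_eq_right h] at hs; linarith [hs'.2, hs.1]
  have hts : tsupport (fun t => ∫ s in (0 : ℝ)..t, χ s) ⊆ Icc a b :=
    closure_minimal (fun t ht => by_contra fun hh => ht (hz2 t hh)) isClosed_Icc
  refine ⟨_, ⟨?_, isCompact_Icc.of_isClosed_subset (isClosed_tsupport _) hts, hts.trans hI⟩, hderiv⟩
  rw [contDiff_infty_iff_deriv, hderiv]
  exact ⟨fun t => (hd t).differentiableAt, hχ.smooth⟩

lemma IsTestFunction.sub_smul {φ ψ : ℝ → ℝ} (hφ : IsTestFunction T φ) (hψ : IsTestFunction T ψ)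
    (c : ℝ) : IsTestFunction T (fun t => φ t - c * ψ t) where
  smooth := hφ.smooth.sub (contDiff_const.mul hψ.smooth)
  compact := hφ.compact.sub (hψ.compact.mul_left (f := fun _ => c))
  support := by
    refine (tsupport_sub φ (fun t => c * ψ t)).trans (union_subset hφ.support ?_)
    exact (closure_mono (Function.support_mul_subset_right _ _)).trans hψ.support

/-- The lemma of du Bois-Reymond. -/
lemma IsWeakDeriv.ae_eq_const {u : L2 d T} (hT : 0 < T) (h : IsWeakDeriv 1 u 0) :
    ∃ c : E d, u =ᵐ[volume.restrict (Icc 0 T)] fun _ => c := by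
  obtain ⟨ψ, hψ, hψ1⟩ := exists_isTestFunction_integral_eq_one hT
  refine ⟨∫ t in Icc 0 T, ψ t • u t, ?_⟩
  set c := ∫ t in Icc 0 T, ψ t • u t with hc
  have hmem : MemLp (fun _ : ℝ => c) 2 (volume.restrict (Icc 0 T)) := memLp_const c
  have h0 : IsWeakDeriv 0 u u := fun φ _ => by simp
  -- A weak derivative of order zero is equality against all test functions, so uniqueness of weak
  -- derivatives identifies `u` with the constant.
  suffices h1 : IsWeakDeriv 0 u (hmem.toLp _) by
    rw [h0.unique h1]
    exact hmem.coeFn_toLp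
  intro φ hφ
  have hiφ : IntegrableOn φ (Icc 0 T) := hφ.smooth.continuous.integrableOn_Icc
  have hiψ : IntegrableOn ψ (Icc 0 T) := hψ.smooth.continuous.integrableOn_Icc
  -- Subtracting `(∫ φ) ψ` makes the integral vanish, so the difference is `θ'` for a test function
  -- `θ`, and the hypothesis gives `∫ φ u = (∫ φ) c`.
  obtain ⟨θ, hθ, hθd⟩ := (hφ.sub_smul hψ (∫ t in Icc 0 T, φ t)).exists_deriv_eq hT (by
    rw [integral_sub hiφ (hiψ.const_mul _), integral_const_mul, hψ1, mul_one, sub_self])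
  have h2 := h θ hθ
  have h3 : ∫ t in Icc 0 T, θ t • (0 : L2 d T) t = 0 := by
    rw [integral_congr_ae (g := fun _ => (0 : E d))
      (by filter_upwards [Lp.coeFn_zero (E d) 2 (volume.restrict (Icc 0 T))] with t ht; rw [ht]; simp)]
    simp
  rw [iteratedDeriv_one, hθd, h3, smul_zero] at h2
  simp only [sub_smul, mul_smul] at h2
  have hi : IntegrableOn (fun t => (∫ t in Icc 0 T, φ t) • ψ t • u t) (Icc 0 T) :=
    (integrable_smul_L2 hψ.smooth.continuous u).smul (∫ t in Icc 0 T, φ t)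
  rw [integral_sub (integrable_smul_L2 hφ.smooth.continuous u) hi, integral_smul, ← hc,
    sub_eq_zero] at h2
  rw [iteratedDeriv_zero, h2, pow_zero, one_smul, ← integral_smul_const]
  refine integral_congr_ae ?_
  filter_upwards [hmem.coeFn_toLp] with t ht
  rw [ht]

lemma isBoundedKernel_primitive : IsBoundedKernel T (fun t s => if t ≤ s then 1 else 0) where
  measurable := Measurable.ite (measurableSet_le measurable_fst measurable_snd)
    measurable_const measurable_const
  bounded := ⟨1, zero_le_one, fun s _ t _ => by split_ifs <;> simp⟩

lemma kernelIntegral_primitive (g : L2 d T) {s : ℝ} (hs : s ∈ Icc 0 T) :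
    kernelIntegral (fun t s => if t ≤ s then 1 else 0) g s = ∫ t in (0 : ℝ)..s, g t := by
  rw [kernelIntegral, intervalIntegral.integral_of_le hs.1, ← integral_Icc_eq_integral_Ioc]
  have e : (fun t => (if t ≤ s then (1 : ℝ) else 0) • g t) = (Iic s).indicator (fun t => g t) := by
    funext t
    by_cases h : t ≤ s <;> simp [h]
  rw [e, setIntegral_indicator measurableSet_Iic]
  congr 2
  ext t
  simp only [mem_inter_iff, mem_Icc, mem_Iic]
  exact ⟨fun h => ⟨h.1.1, h.2⟩, fun h => ⟨⟨h.1, h.2.trans hs.2⟩, h.2⟩⟩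

/-- A function with a weak derivative is a primitive of this derivative. -/
lemma IsWeakDeriv.ae_eq_primitive {u g : L2 d T} (hT : 0 < T) (h : IsWeakDeriv 1 u g) :
    ∃ c : E d, u =ᵐ[volume.restrict (Icc 0 T)] fun t => c + ∫ s in (0 : ℝ)..t, g s := by
  have hK : IsBoundedKernel T (fun _ _ => 0) :=
    ⟨measurable_const, 0, le_rfl, fun _ _ _ _ => by simp⟩
  -- The primitive of `g` has kernel `1_{t ≤ s}`, whose derivative in `s` is `δ_t`: zero regular
  -- part and point mass `1`. Hence `u` minus the primitive has weak derivative zero.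
  have h1 := IsWeakDeriv.of_ae_eq_kernelIntegral (isBoundedKernel_primitive (T := T)) hK
    (k := 1) 1 g fun t ht φ hφ => by
      have := hφ.integral_deriv_mul_ite ht (f := fun _ => 0) (f' := fun _ => 0)
        (g := fun _ => 1) (g' := fun _ => 0) (fun t => hasDerivAt_const t _) continuous_const
        (fun t => hasDerivAt_const t _) continuous_const
      rw [iteratedDeriv_one]
      simp only [mul_zero, integral_zero, ite_self, sub_zero, zero_sub, zero_add] at this ⊢
      -- The step function of the kernel and the one in the integration by parts differ only at `s =
      -- t`.
      have hne : ∀ᵐ s ∂(volume.restrict (Icc (0 : ℝ) T)), s ≠ t :=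
        ae_restrict_of_ae (Measure.ae_ne volume t)
      rw [pow_one, one_mul, neg_one_mul, ← mul_neg_one, ← this]
      refine integral_congr_ae ?_
      filter_upwards [hne] with s hs
      rcases lt_or_gt_of_ne hs with h | h
      · rw [if_neg h.not_ge, if_pos h.le]
      · rw [if_pos h.le, if_neg h.not_ge]
  have hz : hK.toCLM d g = 0 := by
    refine Lp.ext ?_
    filter_upwards [hK.toCLM_coeFn g, Lp.coeFn_zero (E d) 2 (volume.restrict (Icc 0 T))] with t h1 h2
    rw [h1, h2]; simp [kernelIntegral]
  rw [hz, zero_add, one_smul] at h1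
  have h2 := h.add (h1.smul (-1))
  rw [neg_one_smul, neg_one_smul, add_neg_cancel] at h2
  obtain ⟨c, hc⟩ := h2.ae_eq_const hT
  refine ⟨c, ?_⟩
  filter_upwards [hc, Lp.coeFn_add u (-(isBoundedKernel_primitive (T := T)).toCLM d g),
    Lp.coeFn_neg ((isBoundedKernel_primitive (T := T)).toCLM d g),
    (isBoundedKernel_primitive (T := T)).toCLM_coeFn g, ae_restrict_mem measurableSet_Icc]
    with t h1 h2 h3 h4 h5
  rw [h2, Pi.add_apply, h3, Pi.neg_apply, h4, kernelIntegral_primitive g h5, ← sub_eq_add_neg,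
    sub_eq_iff_eq_add] at h1
  exact h1

end WeakDerivative

section Operator

variable {d : ℕ} {m T : ℝ}

/-! ### The operator and its inverse -/

/-- Continuous representatives that agree almost everywhere agree on all of `[0,T]`, the interval
being nondegenerate, so boundary values do not depend on the representative. -/
lemma HasTrace.unique {u : L2 d T} (hT : 0 < T) {t : ℝ} (ht : t ∈ Icc 0 T) {a : E d}
    (h : HasTrace u t a) {c : ℝ → E d} (hc : ContinuousOn c (Icc 0 T))
    (huc : u =ᵐ[volume.restrict (Icc 0 T)] c) : c t = a := by
  obtain ⟨c', hc', huc', rfl⟩ := h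
  exact Measure.eqOn_Icc_of_ae_eq volume hT.ne (huc.symm.trans huc') hc hc' ht

lemma mem_domain_operatorL {u : L2 d T} :
    u ∈ (operatorL d m T).domain ↔ u ∈ operatorDomain d m T :=
  ⟨fun h => h.1, fun h => ⟨h, h.1.2, h.1.1.1.2⟩⟩

lemma operatorL_apply (u : (operatorL d m T).domain) {a b : L2 d T}
    (ha : IsWeakDeriv 4 (u : L2 d T) a) (hb : IsWeakDeriv 2 (u : L2 d T) b) :
    operatorL d m T u = -(m ^ 2) • a + b := by
  have h4 : (u : L2 d T) ∈ (weakDeriv d T 4).domain := ⟨a, ha⟩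
  have h2 : (u : L2 d T) ∈ (weakDeriv d T 2).domain := ⟨b, hb⟩
  have e : operatorL d m T u = -(m ^ 2) • weakDeriv d T 4 ⟨u, h4⟩ + weakDeriv d T 2 ⟨u, h2⟩ := rfl
  have e4 : weakDeriv d T 4 ⟨u, h4⟩ = a := (weakDeriv_spec (⟨u, h4⟩ : (weakDeriv d T 4).domain)).unique ha
  have e2 : weakDeriv d T 2 ⟨u, h2⟩ = b := (weakDeriv_spec (⟨u, h2⟩ : (weakDeriv d T 2).domain)).unique hb
  rw [e, e4, e2]

lemma primitive_hasDerivAt {g : L2 d T} {c : E d} {U V : ℝ → E d}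
    (hU : U = fun t => c + ∫ s in (0 : ℝ)..t, g s) (hV : ContinuousOn V (Icc 0 T))
    (hgV : g =ᵐ[volume.restrict (Icc 0 T)] V) : ∀ t ∈ Ioo 0 T, HasDerivAt U (V t) t := by
  intro t ht
  have hVI : ContinuousOn V (Ioo 0 T) := hV.mono Ioo_subset_Icc_self
  have h1 : HasDerivAt (fun t => c + ∫ s in (0 : ℝ)..t, V s) (V t) t := by
    refine (intervalIntegral.integral_hasDerivAt_right ?_ ?_ ?_).const_add c
    · refine ContinuousOn.intervalIntegrable (hV.mono ?_)
      rw [uIcc_of_le ht.1.le]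
      exact Icc_subset_Icc_right ht.2.le
    · exact hVI.stronglyMeasurableAtFilter isOpen_Ioo t ht
    · exact hVI.continuousAt (Ioo_mem_nhds ht.1 ht.2)
  refine h1.congr_of_eventuallyEq ?_
  filter_upwards [Ioo_mem_nhds ht.1 ht.2] with r hr
  rw [hU]
  simp only [add_right_inj]
  rw [intervalIntegral.integral_of_le hr.1.le, intervalIntegral.integral_of_le hr.1.le]
  refine integral_congr_ae (ae_restrict_of_ae_restrict_of_subset ?_ hgV)
  exact Ioc_subset_Icc_self.trans (Icc_subset_Icc_right hr.2.le)

lemma primitive_continuousOn (g : L2 d T) (c : E d) :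
    ContinuousOn (fun t => c + ∫ s in (0 : ℝ)..t, g s) (Icc 0 T) := by
  refine continuousOn_const.add ?_
  rcases le_or_gt 0 T with hT | hT
  · refine (intervalIntegral.continuousOn_primitive_interval' (b₁ := 0) (b₂ := T) ?_
      left_mem_uIcc).mono Icc_subset_uIcc
    rw [intervalIntegrable_iff_integrableOn_Ioc_of_le hT]
    exact (integrableOn_L2 g).mono_set Ioc_subset_Icc_self
  · exact (continuousOn_empty _).mono (Icc_eq_empty hT.not_ge).le

/-- A weak solution of `𝓛 u = 0` is classical: the first four weak derivatives make `u, …, u'''`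
primitives, and `u'''' = u''/m²` is then continuous as well. The energy argument applies to each
coordinate. -/
lemma operatorL_injective (hm : 0 < m) (hT : 0 < T) (u : (operatorL d m T).domain)
    (hu : operatorL d m T u = 0) : u = 0 := by
  obtain ⟨⟨⟨⟨⟨u₁, h1⟩, ⟨u₂, h2⟩⟩, ⟨u₃, h3⟩⟩, ⟨u₄, h4⟩⟩, htl, htr,
    ⟨v₁, v₂, a, b, hv1, hv2, hta, htb, hab⟩, ⟨w₁, w₂, a', b', hw1, hw2, hta', htb', hab'⟩⟩ :=
    mem_domain_operatorL.1 u.2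
  rw [hv1.unique h1] at hta
  rw [hv2.unique h2] at htb
  rw [hw1.unique h1] at hta'
  rw [hw2.unique h2] at htb'
  rw [operatorL_apply u h4 h2] at hu
  have h42 : u₄ = (m ^ 2)⁻¹ • u₂ := by
    rw [neg_smul, neg_add_eq_zero] at hu
    rw [← hu, smul_smul, inv_mul_cancel₀ (by positivity), one_smul]
  obtain ⟨c₀, e0⟩ := h1.ae_eq_primitive hT
  obtain ⟨c₁, e1⟩ := (h1.succ h2).ae_eq_primitive hT
  obtain ⟨c₂, e2⟩ := (h2.succ h3).ae_eq_primitive hT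
  obtain ⟨c₃, e3⟩ := (h3.succ h4).ae_eq_primitive hT
  have k0 := primitive_continuousOn u₁ c₀
  have k1 := primitive_continuousOn u₂ c₁
  have k2 := primitive_continuousOn u₃ c₂
  have k3 := primitive_continuousOn u₄ c₃
  have d0 := primitive_hasDerivAt rfl k1 e1 (c := c₀)
  have d1 := primitive_hasDerivAt rfl k2 e2 (c := c₁)
  have d2 := primitive_hasDerivAt rfl k3 e3 (c := c₂)
  have e4 : u₄ =ᵐ[volume.restrict (Icc 0 T)]
      fun t => (m ^ 2)⁻¹ • (c₂ + ∫ s in (0 : ℝ)..t, u₃ s) := by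
    rw [h42]
    filter_upwards [Lp.coeFn_smul ((m ^ 2)⁻¹) u₂, e2] with t ht ht'
    rw [ht, Pi.smul_apply, ht']
  have k4 : ContinuousOn (fun t => (m ^ 2)⁻¹ • (c₂ + ∫ s in (0 : ℝ)..t, u₃ s)) (Icc 0 T) :=
    k2.const_smul ((m ^ 2)⁻¹)
  have d3 := primitive_hasDerivAt rfl k4 e4 (c := c₃)
  have z0 : (0 : ℝ) ∈ Icc 0 T := ⟨le_rfl, hT.le⟩
  have z1 : T ∈ Icc 0 T := ⟨hT.le, le_rfl⟩
  have b0 := htl.unique hT z0 k0 e0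
  have b1 := htr.unique hT z1 k0 e0
  rw [← hta.unique hT z0 k1 e1, ← htb.unique hT z0 k2 e2, one_smul] at hab
  rw [← hta'.unique hT z1 k1 e1, ← htb'.unique hT z1 k2 e2, neg_one_smul] at hab'
  have key : ∀ t ∈ Icc 0 T, c₀ + ∫ s in (0 : ℝ)..t, u₁ s = 0 := by
    intro t ht
    ext i
    have pd : ∀ {U V : ℝ → E d}, (∀ t ∈ Ioo 0 T, HasDerivAt U (V t) t) →
        ∀ t ∈ Ioo 0 T, HasDerivAt (fun t => U t i) (V t i) t := fun h t ht =>
      (EuclideanSpace.proj (𝕜 := ℝ) i).hasFDerivAt.comp_hasDerivAt t (h t ht)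
    have pc : ∀ {U : ℝ → E d}, ContinuousOn U (Icc 0 T) →
        ContinuousOn (fun t => U t i) (Icc 0 T) := fun h =>
      (EuclideanSpace.proj (𝕜 := ℝ) i).continuous.comp_continuousOn h
    refine eq_zero_of_robin_boundary hm hT (pc k0) (pc k1) (pc k2) (pc k3) (pd d0) (pd d1) (pd d2)
      (fun t ht => (pd d3 t ht).congr_deriv ?_) ?_ ?_ ?_ ?_ t ht
    · simp only [PiLp.smul_apply, smul_eq_mul]
      ring
    · rw [b0]; rfl
    · rw [b1]; rfl
    · simpa using congrArg (· i) hab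
    · simpa [mul_add] using congrArg (· i) hab'
  refine Subtype.ext (Lp.ext ?_)
  filter_upwards [e0, ae_restrict_mem measurableSet_Icc,
    Lp.coeFn_zero (E d) 2 (volume.restrict (Icc 0 T))] with t h1 h2 h3
  rw [h1, key t h2, ZeroMemClass.coe_zero, h3]
  rfl

lemma isBoundedKernel_bridgeCovDeriv (m T : ℝ) (j : ℕ) :
    IsBoundedKernel T (bridgeCovDeriv m T j) where
  measurable := measurable_bridgeCovDeriv m T j
  bounded := by
    obtain ⟨M, hM⟩ := (isCompact_Icc.prod isCompact_Icc).exists_bound_of_continuousOn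
      (s := Icc 0 T ×ˢ Icc 0 T) (continuous_bridgeCovLower m T j).continuousOn
    obtain ⟨N, hN⟩ := (isCompact_Icc.prod isCompact_Icc).exists_bound_of_continuousOn
      (s := Icc 0 T ×ˢ Icc 0 T) (continuous_bridgeCovUpper m T j).continuousOn
    refine ⟨max 0 (max M N), le_max_left _ _, fun s hs t ht => ?_⟩
    unfold bridgeCovDeriv
    split_ifs
    · exact (hM (t, s) ⟨ht, hs⟩).trans ((le_max_left _ _).trans (le_max_right _ _))
    · exact (hN (t, s) ⟨ht, hs⟩).trans ((le_max_right _ _).trans (le_max_right _ _))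

/-- The integral operator of the Green's function. -/
def greenOperator (d : ℕ) (m T : ℝ) : L2 d T →L[ℝ] L2 d T :=
  (isBoundedKernel_bridgeCovDeriv m T 0).toCLM d

lemma greenOperator_coeFn (g : L2 d T) : greenOperator d m T g =ᵐ[volume.restrict (Icc 0 T)]
    fun s => ∫ t in Icc 0 T, bridgeCov m T s t • g t := by
  filter_upwards [(isBoundedKernel_bridgeCovDeriv m T 0).toCLM_coeFn g] with s hs
  refine hs.trans ?_
  simp only [kernelIntegral, bridgeCovDeriv_zero, bridgeCov_comm m T s]

/-- Only the fourth derivative produces a multiple of `g`; it comes from the jump of the third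
derivative of the kernel on the diagonal. -/
lemma isWeakDeriv_greenOperator (hm : m ≠ 0) {k : ℕ} (hk : k ≤ 4) (g : L2 d T) :
    IsWeakDeriv k (greenOperator d m T g)
      ((isBoundedKernel_bridgeCovDeriv m T k).toCLM d g +
        (if k = 4 then (m ^ 2)⁻¹ else 0 : ℝ) • g) := by
  refine IsWeakDeriv.of_ae_eq_kernelIntegral _ _ _ g fun t ht φ hφ => ?_
  rw [hφ.integral_iteratedDeriv_mul_bridgeCov hm ht hk]
  split_ifs with h
  · subst h
    ring
  · ring

lemma hasTrace_kernel {j : ℕ} (hj : j ≤ 2) (g : L2 d T) (t : ℝ) :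
    HasTrace ((isBoundedKernel_bridgeCovDeriv m T j).toCLM d g) t
      (kernelIntegral (bridgeCovDeriv m T j) g t) :=
  ⟨_, (isBoundedKernel_bridgeCovDeriv m T j).continuousOn_kernelIntegral
    (continuous_bridgeCovDeriv m T hj) g, (isBoundedKernel_bridgeCovDeriv m T j).toCLM_coeFn g, rfl⟩

lemma greenOperator_mem (hm : 0 < m) (hT : 0 < T) (g : L2 d T) :
    greenOperator d m T g ∈ operatorDomain d m T := by
  have hw : ∀ k ≤ 4, _ := fun k hk => isWeakDeriv_greenOperator (d := d) (T := T) hm.ne' hk g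
  have h1 := hw 1 (by norm_num)
  have h2 := hw 2 (by norm_num)
  rw [if_neg (by norm_num), zero_smul, add_zero] at h1 h2
  have hz : ∀ t, (∀ s ∈ Icc 0 T, bridgeCov m T s t = 0) →
      HasTrace (greenOperator d m T g) t 0 := by
    intro t ht
    have h := hasTrace_kernel (m := m) (j := 0) (by norm_num) g t
    rwa [kernelIntegral, setIntegral_congr_fun (g := fun _ => 0) measurableSet_Icc (fun s hs => by
      simp only [bridgeCovDeriv_zero, ht s hs, zero_smul]), integral_zero] at h
  refine ⟨⟨⟨⟨⟨_, h1⟩, ⟨_, h2⟩⟩, ⟨_, hw 3 (by norm_num)⟩⟩, ⟨_, hw 4 le_rfl⟩⟩,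
    hz 0 fun s hs => bridgeCov_zero_right m T hs.1,
    hz T fun s hs => bridgeCov_self_right hm hT hs.2,
    ⟨_, _, _, _, h1, h2, hasTrace_kernel (by norm_num) g 0, hasTrace_kernel le_rfl g 0, ?_⟩,
    ⟨_, _, _, _, h1, h2, hasTrace_kernel (by norm_num) g T, hasTrace_kernel le_rfl g T, ?_⟩⟩
  · rw [kernelIntegral, kernelIntegral, ← integral_smul, ← integral_smul]
    refine setIntegral_congr_fun measurableSet_Icc fun s hs => ?_
    simp only [smul_smul, bridgeCovDeriv_robin_left hm.ne' T hs.1, one_mul]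
  · rw [kernelIntegral, kernelIntegral, ← integral_smul, ← integral_smul]
    refine setIntegral_congr_fun measurableSet_Icc fun s hs => ?_
    simp only [smul_smul, bridgeCovDeriv_robin_right hm.ne' hs.2, neg_one_mul]

lemma isBoundedInverse_greenOperator (hm : 0 < m) (hT : 0 < T) :
    IsBoundedInverse (-operatorL d m T) (greenOperator d m T) := by
  have hr : ∀ g : L2 d T, ∃ hg : greenOperator d m T g ∈ (-operatorL d m T).domain,
      (-operatorL d m T) ⟨greenOperator d m T g, hg⟩ = g := by
    intro g
    have hg := mem_domain_operatorL.2 (greenOperator_mem hm hT g)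
    refine ⟨hg, ?_⟩
    rw [LinearPMap.neg_apply]
    have h4 := isWeakDeriv_greenOperator (d := d) (T := T) hm.ne' (le_refl 4) g
    have h2 := isWeakDeriv_greenOperator (d := d) (T := T) hm.ne' (show 2 ≤ 4 by norm_num) g
    rw [if_pos rfl] at h4
    rw [if_neg (by norm_num), zero_smul, add_zero] at h2
    -- The regular parts of `m² u''''` and `u''` cancel, leaving `m² (m²)⁻¹ g = g`.
    have e42 : (isBoundedKernel_bridgeCovDeriv m T 2).toCLM d g =
        m ^ 2 • (isBoundedKernel_bridgeCovDeriv m T 4).toCLM d g := by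
      refine Lp.ext ?_
      filter_upwards [(isBoundedKernel_bridgeCovDeriv m T 2).toCLM_coeFn g,
        (isBoundedKernel_bridgeCovDeriv m T 4).toCLM_coeFn g,
        Lp.coeFn_smul (m ^ 2) ((isBoundedKernel_bridgeCovDeriv m T 4).toCLM d g)] with s h1 h2 h3
      rw [h1, h3, Pi.smul_apply, h2, kernelIntegral, kernelIntegral, ← integral_smul]
      congr with t
      rw [smul_smul, bridgeCovDeriv_four, mul_div_cancel₀ _ (by positivity)]
    refine (congrArg Neg.neg (operatorL_apply ⟨_, hg⟩ h4 h2)).trans ?_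
    rw [e42, smul_add, neg_smul, neg_smul, smul_smul, mul_inv_cancel₀ (by positivity), one_smul]
    abel
  refine ⟨hr, fun u => ?_⟩
  obtain ⟨hg, hgu⟩ := hr ((-operatorL d m T) u)
  -- A right inverse of an injective operator is also a left inverse.
  have hsub : operatorL d m T (⟨_, hg⟩ - u) = 0 := by
    rw [LinearPMap.map_sub, sub_eq_zero]
    exact neg_injective hgu
  exact congrArg Subtype.val (sub_eq_zero.1 (operatorL_injective hm hT _ hsub))

end Operator

/-! ### Unbounded operators with a bounded inverse -/

section BoundedInverse

variable {H : Type*} [NormedAddCommGroup H] [InnerProductSpace ℝ H]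
  {A : H →ₗ.[ℝ] H} {C : H →L[ℝ] H}

/-- An operator with a symmetric bounded inverse is self-adjoint. -/
lemma IsBoundedInverse.isSelfAdjoint [CompleteSpace H] (h : IsBoundedInverse (-A) C)
    (hC : ∀ f g : H, ⟪C f, g⟫ = ⟪f, C g⟫) : IsSelfAdjoint A := by
  have hdense : Dense (A.domain : Set H) := by
    rw [Submodule.dense_iff_topologicalClosure_eq_top, Submodule.topologicalClosure_eq_top_iff,
      Submodule.eq_bot_iff]
    intro g hg
    -- If `g` is orthogonal to the domain, then `⟪C g, C g⟫ = ⟪g, C (C g)⟫ = 0`, because `C (C g)`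
    -- lies in the domain.
    have hCg : C g = 0 := by
      rw [← inner_self_eq_zero (𝕜 := ℝ), hC]
      obtain ⟨hm, -⟩ := h.right_inv (C g)
      exact (Submodule.mem_orthogonal' _ _).1 hg _ hm
    obtain ⟨hg', hgg⟩ := h.right_inv g
    rw [← hgg, show (⟨C g, hg'⟩ : (-A).domain) = 0 from Subtype.ext hCg, LinearPMap.map_zero]
  have hA : ∀ u : A.domain, C (A u) = -(u : H) := fun u => by
    have := h.left_inv u
    rw [LinearPMap.neg_apply, map_neg] at this
    rw [← this, neg_neg]
  have hAC : ∀ g : H, ∃ hg : C g ∈ A.domain, A ⟨C g, hg⟩ = -g := fun g => by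
    obtain ⟨hg, hgg⟩ := h.right_inv g
    exact ⟨hg, neg_eq_iff_eq_neg.1 hgg⟩
  have hformal : A.IsFormalAdjoint A := fun x y => by
    have hx : (x : H) = -C (A x) := by rw [hA, neg_neg]
    have hy : (y : H) = -C (A y) := by rw [hA, neg_neg]
    conv_lhs => rw [hy]
    conv_rhs => rw [hx]
    rw [inner_neg_left, inner_neg_right, hC]
  rw [LinearPMap.isSelfAdjoint_def]
  refine le_antisymm ?_ (hformal.le_adjoint hdense)
  -- Testing the adjoint relation on the range of `C` shows that `y = -C (A† y)`, so the domain of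
  -- the adjoint is no larger than that of `A`.
  have hadj : ∀ y : A.adjoint.domain, (y : H) = -C (A.adjoint y) := by
    intro y
    refine ext_inner_right ℝ fun g => ?_
    obtain ⟨hg, hgg⟩ := hAC g
    have := LinearPMap.adjoint_isFormalAdjoint hdense y ⟨C g, hg⟩
    rw [hgg, inner_neg_right] at this
    rw [inner_neg_left, hC, this, neg_neg]
  refine ⟨fun y hy => ?_, fun y z hyz => ?_⟩
  · have hmem := A.domain.neg_mem (hAC (A.adjoint ⟨y, hy⟩)).1
    rwa [← hadj ⟨y, hy⟩] at hmem
  · obtain ⟨hg, hgg⟩ := hAC (A.adjoint y)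
    have e : z = -⟨C (A.adjoint y), hg⟩ := Subtype.ext (by rw [← hyz, hadj y]; rfl)
    rw [e, LinearPMap.map_neg, hgg, neg_neg]

/-- An operator whose inverse is symmetric and negative semidefinite is negative definite. -/
lemma IsBoundedInverse.inner_neg (h : IsBoundedInverse (-A) C)
    (hC : ∀ f g : H, ⟪C f, g⟫ = ⟪f, C g⟫) (hpos : ∀ f : H, 0 ≤ ⟪C f, f⟫) (u : A.domain)
    (hu : u ≠ 0) : ⟪A u, (u : H)⟫ < 0 := by
  set g := A u with hg
  have hCg : (u : H) = -C g := by
    have := h.left_inv u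
    rw [LinearPMap.neg_apply, map_neg] at this
    exact this.symm
  rw [hCg, inner_neg_right, neg_lt_zero, ← hC]
  refine lt_of_le_of_ne (hpos g) fun h0 => hu (Subtype.ext ?_)
  rw [hCg]
  have hz : C g = 0 := by
    by_contra hne
    set k := C g with hk
    have hk2 : 0 < ⟪k, k⟫ := real_inner_self_pos.2 hne
    -- Since `⟪C g, g⟫ = 0`, positivity at `g + r k` with `k = C g` leaves a quadratic without
    -- constant term, whose nonzero linear term makes it negative for small `r < 0`.
    have hq : ∀ r : ℝ, 0 ≤ 2 * r * ⟪k, k⟫ + r ^ 2 * ⟪C k, k⟫ := by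
      intro r
      have := hpos (g + r • k)
      have e1 : ⟪C k, g⟫ = ⟪k, k⟫ := by rw [hC]
      simp only [map_add, map_smul, inner_add_left, inner_add_right, inner_smul_left,
        inner_smul_right, RCLike.conj_to_real, ← hk, ← h0, e1] at this
      linarith
    have hM := hpos k
    -- A suitable small negative `r`; adding `⟪k, k⟫` to the denominator keeps it positive when `⟪C
    -- k, k⟫ = 0`.
    have := hq (-⟪k, k⟫ / (⟪C k, k⟫ + ⟪k, k⟫))
    set a := ⟪k, k⟫
    set b := ⟪C k, k⟫
    have hab : 0 < b + a := by linarith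
    have e : 2 * (-a / (b + a)) * a + (-a / (b + a)) ^ 2 * b =
        -(a ^ 2 * (b + 2 * a)) / (b + a) ^ 2 := by
      field_simp
      ring
    rw [e] at this
    have hneg : -(a ^ 2 * (b + 2 * a)) / (b + a) ^ 2 < 0 :=
      div_neg_of_neg_of_pos (neg_neg_of_pos (by positivity)) (by positivity)
    linarith
  rw [hz, neg_zero]
  rfl

end BoundedInverse

/-! ### Separability of `L²` and the bilinear form of an integral operator -/

instance instSecondCountableTopologyL2 (d : ℕ) (T : ℝ) : SecondCountableTopology (L2 d T) :=
  haveI : Fact ((2 : ENNReal) ≠ ⊤) := ⟨by norm_num⟩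
  inferInstance

section Kernel

variable {d : ℕ} {T : ℝ} {H : ℝ → ℝ → ℝ}

lemma IsBoundedKernel.of_continuous (hc : Continuous fun p : ℝ × ℝ => H p.1 p.2) :
    IsBoundedKernel T H where
  measurable := hc.measurable
  bounded := by
    obtain ⟨M, hM⟩ := (isCompact_Icc.prod isCompact_Icc).exists_bound_of_continuousOn
      (s := Icc 0 T ×ˢ Icc 0 T) hc.continuousOn
    exact ⟨max 0 M, le_max_left _ _, fun s hs t ht =>
      (hM (t, s) ⟨ht, hs⟩).trans (le_max_right _ _)⟩

lemma integrable_norm_mul_norm (g h : L2 d T) :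
    Integrable (fun p : ℝ × ℝ => ‖h p.1‖ * ‖g p.2‖)
      ((volume.restrict (Icc 0 T)).prod (volume.restrict (Icc 0 T))) :=
  (integrableOn_L2 h).norm.mul_prod (integrableOn_L2 g).norm

lemma aestronglyMeasurable_mul_inner {F : ℝ × ℝ → ℝ} (hF : Measurable F) (g h : L2 d T) :
    AEStronglyMeasurable (fun p : ℝ × ℝ => F p * ⟪g p.2, h p.1⟫)
      ((volume.restrict (Icc 0 T)).prod (volume.restrict (Icc 0 T))) :=
  hF.aestronglyMeasurable.mul
    ((integrableOn_L2 g).comp_snd _ |>.aestronglyMeasurable.inner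
      ((integrableOn_L2 h).comp_fst _).aestronglyMeasurable)

lemma integrable_mul_inner {F : ℝ × ℝ → ℝ} (hF : Measurable F) {M : ℝ}
    (hM : ∀ s ∈ Icc 0 T, ∀ t ∈ Icc 0 T, |F (s, t)| ≤ M) (g h : L2 d T) :
    Integrable (fun p : ℝ × ℝ => F p * ⟪g p.2, h p.1⟫)
      ((volume.restrict (Icc 0 T)).prod (volume.restrict (Icc 0 T))) := by
  refine ((integrable_norm_mul_norm g h).const_mul M).mono'
    (aestronglyMeasurable_mul_inner hF g h) ?_
  rw [Measure.prod_restrict]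
  filter_upwards [ae_restrict_mem (measurableSet_Icc.prod measurableSet_Icc)] with p hp
  rw [norm_mul, mul_comm ‖h p.1‖]
  exact mul_le_mul (hM _ hp.1 _ hp.2) (norm_inner_le_norm _ _) (norm_nonneg _)
    ((abs_nonneg _).trans (hM _ hp.1 _ hp.2))

lemma IsBoundedKernel.inner_toCLM (hH : IsBoundedKernel T H) (g h : L2 d T) :
    ⟪hH.toCLM d g, h⟫ = ∫ s in Icc 0 T, ∫ t in Icc 0 T, H t s * ⟪g t, h s⟫ := by
  rw [L2.inner_def]
  refine integral_congr_ae ?_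
  filter_upwards [hH.toCLM_coeFn g, ae_restrict_mem measurableSet_Icc] with s hs hs'
  rw [hs, kernelIntegral, real_inner_comm, ← integral_inner (hH.integrable g hs')]
  congr with t
  rw [inner_smul_right, real_inner_comm]

lemma IsBoundedKernel.inner_toCLM_comm (hH : IsBoundedKernel T H) (hs : ∀ s t, H s t = H t s)
    (g h : L2 d T) : ⟪hH.toCLM d g, h⟫ = ⟪g, hH.toCLM d h⟫ := by
  obtain ⟨M, -, hM⟩ := hH.bounded
  rw [real_inner_comm (hH.toCLM d h), hH.inner_toCLM, hH.inner_toCLM,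
    integral_integral_swap
      (integrable_mul_inner (hH.measurable.comp measurable_swap) (M := M) hM g h)]
  simp only [hs, real_inner_comm]

end Kernel

/-! ### Gaussian fields -/

section Step

variable {d : ℕ} {T : ℝ}

/-- Simple functions approximating the identity on `[0,T]`. -/
def timeGrid {T : ℝ} (hT : 0 ≤ T) (n : ℕ) : SimpleFunc ℝ ℝ :=
  SimpleFunc.approxOn id measurable_id (Icc 0 T) 0 ⟨le_rfl, hT⟩ n

lemma timeGrid_mem (hT : 0 ≤ T) (n : ℕ) (t : ℝ) : timeGrid hT n t ∈ Icc 0 T :=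
  SimpleFunc.approxOn_mem _ _ _ _

lemma tendsto_timeGrid (hT : 0 ≤ T) {t : ℝ} (ht : t ∈ Icc 0 T) :
    Tendsto (fun n => timeGrid hT n t) atTop (nhds t) :=
  SimpleFunc.tendsto_approxOn measurable_id _ (subset_closure ht)

lemma timeGrid_range_subset (hT : 0 ≤ T) (n : ℕ) : (↑(timeGrid hT n).range : Set ℝ) ⊆ Icc 0 T := by
  intro y hy
  obtain ⟨t, rfl⟩ := SimpleFunc.mem_range.1 hy
  exact timeGrid_mem hT n t

/-- The integral of `g` over a level set of a simple function. -/
def levelIntegral (τ : SimpleFunc ℝ ℝ) (g : L2 d T) (y : ℝ) : E d :=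
  ∫ t in Icc 0 T, (τ ⁻¹' {y}).indicator (fun t => g t) t

/-- Pairing a sampled path with `g` is a finite linear combination of its values; this is how
finite-dimensional Gaussian laws reach `L²`. -/
lemma integral_inner_simpleFunc (τ : SimpleFunc ℝ ℝ) (F : ℝ → E d) (g : L2 d T) :
    ∫ t in Icc 0 T, ⟪F (τ t), g t⟫ = ∑ y ∈ τ.range, ⟪F y, levelIntegral τ g y⟫ := by
  have hi : ∀ y, IntegrableOn ((τ ⁻¹' {y}).indicator (fun t => g t)) (Icc 0 T) := fun y =>
    (integrableOn_L2 g).indicator (τ.measurableSet_fiber y)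
  have e : ∀ t, ⟪F (τ t), g t⟫ =
      ∑ y ∈ τ.range, ⟪F y, (τ ⁻¹' {y}).indicator (fun t => g t) t⟫ := by
    intro t
    rw [Finset.sum_eq_single_of_mem (τ t) (τ.mem_range_self t)]
    · rw [indicator_of_mem (by simp)]
    · intro y _ hy
      rw [indicator_of_notMem (by simpa using hy.symm), inner_zero_right]
  simp_rw [e]
  rw [integral_finsetSum _ fun y _ => (hi y).const_inner _]
  refine Finset.sum_congr rfl fun y _ => ?_
  rw [levelIntegral, ← integral_inner (hi y)]

lemma memLp_indicator_const {A : Set ℝ} (hA : MeasurableSet A) (c : E d) :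
    MemLp (A.indicator fun _ => c) 2 (volume.restrict (Icc 0 T)) :=
  (memLp_const c).indicator hA

/-- The constant function `c` on the set `A`, as an element of `L²`. -/
def indicatorL2 {A : Set ℝ} (hA : MeasurableSet A) (d : ℕ) (T : ℝ) : E d →ₗ[ℝ] L2 d T where
  toFun c := (memLp_indicator_const hA c).toLp _
  map_add' c c' := by
    rw [← MemLp.toLp_add]
    exact MemLp.toLp_congr _ _ (Eventually.of_forall fun t => by
      by_cases h : t ∈ A <;> simp [h])
  map_smul' r c := by
    rw [RingHom.id_apply, ← MemLp.toLp_const_smul]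
    exact MemLp.toLp_congr _ _ (Eventually.of_forall fun t => by
      by_cases h : t ∈ A <;> simp [h])

lemma indicatorL2_coeFn {A : Set ℝ} (hA : MeasurableSet A) (c : E d) :
    indicatorL2 hA d T c =ᵐ[volume.restrict (Icc 0 T)] A.indicator fun _ => c :=
  (memLp_indicator_const hA c).coeFn_toLp

/-- The step function `F ∘ τ` as an element of `L²`. -/
def stepL2 (T : ℝ) (τ : SimpleFunc ℝ ℝ) (F : ℝ → E d) : L2 d T :=
  ∑ y ∈ τ.range, indicatorL2 (τ.measurableSet_fiber y) d T (F y)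

lemma stepL2_coeFn (τ : SimpleFunc ℝ ℝ) (F : ℝ → E d) :
    stepL2 T τ F =ᵐ[volume.restrict (Icc 0 T)] fun t => F (τ t) := by
  have h : ∀ᵐ t ∂(volume.restrict (Icc 0 T)), ∀ y ∈ τ.range,
      indicatorL2 (τ.measurableSet_fiber y) d T (F y) t = (τ ⁻¹' {y}).indicator (fun _ => F y) t := by
    refine (ae_ball_iff τ.range.countable_toSet).2 fun y _ => ?_
    exact indicatorL2_coeFn (τ.measurableSet_fiber y) (F y)
  filter_upwards [h, Lp.coeFn_finsetSum τ.range
    fun y => indicatorL2 (τ.measurableSet_fiber y) d T (F y)] with t h1 h2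
  rw [stepL2, h2, Finset.sum_apply, Finset.sum_eq_single_of_mem (τ t) (τ.mem_range_self t),
    h1 _ (τ.mem_range_self t), indicator_of_mem (by simp)]
  intro y hy hne
  rw [h1 y hy, indicator_of_notMem (by simpa using hne.symm)]

lemma memLp_of_continuousOn {F : ℝ → E d} (hF : ContinuousOn F (Icc 0 T)) :
    MemLp F 2 (volume.restrict (Icc 0 T)) := by
  obtain ⟨M, hM⟩ := isCompact_Icc.exists_bound_of_continuousOn hF
  refine MemLp.of_bound (hF.aestronglyMeasurable measurableSet_Icc) M ?_
  filter_upwards [ae_restrict_mem measurableSet_Icc] with t ht using hM t ht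

lemma toL2_coeFn {F : ℝ → E d} (hF : ContinuousOn F (Icc 0 T)) :
    toL2 T F =ᵐ[volume.restrict (Icc 0 T)] F := by
  rw [toL2, dif_pos (memLp_of_continuousOn hF)]
  exact MemLp.coeFn_toLp _

/-- Dominated convergence, with bound `(2M)²`. The grid points stay in `[0,T]`, so continuity on
that interval is enough. -/
lemma tendsto_stepL2 (hT : 0 ≤ T) {F : ℝ → E d} (hF : ContinuousOn F (Icc 0 T)) :
    Tendsto (fun n => stepL2 T (timeGrid hT n) F) atTop (nhds (toL2 T F)) := by
  obtain ⟨M, hM⟩ := isCompact_Icc.exists_bound_of_continuousOn hF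
  rw [tendsto_iff_norm_sub_tendsto_zero]
  have hsq : Tendsto (fun n => ‖stepL2 T (timeGrid hT n) F - toL2 T F‖ ^ 2) atTop (nhds 0) := by
    have e : ∀ n, ‖stepL2 T (timeGrid hT n) F - toL2 T F‖ ^ 2 =
        ∫ t in Icc 0 T, ‖F (timeGrid hT n t) - F t‖ ^ 2 := by
      intro n
      rw [← real_inner_self_eq_norm_sq, L2.inner_def]
      refine integral_congr_ae ?_
      filter_upwards [Lp.coeFn_sub (stepL2 T (timeGrid hT n) F) (toL2 T F),
        stepL2_coeFn (T := T) (timeGrid hT n) F, toL2_coeFn hF] with t h1 h2 h3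
      rw [h1, Pi.sub_apply, h2, h3, real_inner_self_eq_norm_sq]
    simp_rw [e]
    have hint : IntegrableOn (fun _ => (M + M) ^ 2) (Icc 0 T) volume := by
      simp [integrableOn_const_iff]
    suffices key : Tendsto (fun n => ∫ t in Icc 0 T, ‖F (timeGrid hT n t) - F t‖ ^ 2) atTop
        (nhds (∫ t in Icc (0 : ℝ) T, (0 : ℝ))) by
      rwa [integral_zero] at key
    refine tendsto_integral_of_dominated_convergence (fun _ => (M + M) ^ 2) (fun n => ?_)
      hint (fun n => ?_) ?_
    · refine ((AEStronglyMeasurable.sub ?_ (hF.aestronglyMeasurable measurableSet_Icc)).norm.pow 2)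
      exact (Lp.aestronglyMeasurable (stepL2 T (timeGrid hT n) F)).congr
        (stepL2_coeFn (T := T) (timeGrid hT n) F)
    · filter_upwards [ae_restrict_mem measurableSet_Icc] with t ht
      rw [norm_pow, norm_norm]
      exact pow_le_pow_left₀ (norm_nonneg _) ((norm_sub_le _ _).trans
        (add_le_add (hM _ (timeGrid_mem hT n t)) (hM t ht))) 2
    · filter_upwards [ae_restrict_mem measurableSet_Icc] with t ht
      have h1 : Tendsto (fun n => F (timeGrid hT n t)) atTop (nhds (F t)) :=
        (hF t ht).tendsto.comp (tendsto_nhdsWithin_iff.2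
          ⟨tendsto_timeGrid hT ht, Eventually.of_forall fun n => timeGrid_mem hT n t⟩)
      simpa using (tendsto_iff_norm_sub_tendsto_zero.1 h1).pow 2
  simpa using hsq.sqrt

/-- The double sum is the double integral with `R` sampled at the grid points; dominated convergence
applies with majorant `M ‖g(s)‖ ‖g(t)‖`. -/
lemma tendsto_sum_levelIntegral (hT : 0 ≤ T) {R : ℝ → ℝ → ℝ}
    (hR : Continuous fun p : ℝ × ℝ => R p.1 p.2) (g : L2 d T) :
    Tendsto (fun n => ∑ y ∈ (timeGrid hT n).range, ∑ y' ∈ (timeGrid hT n).range,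
      R y' y * ⟪levelIntegral (timeGrid hT n) g y', levelIntegral (timeGrid hT n) g y⟫) atTop
      (nhds ⟪(IsBoundedKernel.of_continuous hR).toCLM d g, g⟫) := by
  obtain ⟨M, -, hM⟩ := (IsBoundedKernel.of_continuous (T := T) hR).bounded
  have hm : ∀ n, Measurable fun p : ℝ × ℝ => R (timeGrid hT n p.2) (timeGrid hT n p.1) := fun n =>
    hR.measurable.comp (((timeGrid hT n).measurable.comp measurable_snd).prodMk
      ((timeGrid hT n).measurable.comp measurable_fst))
  have hb : ∀ n, ∀ s ∈ Icc 0 T, ∀ t ∈ Icc 0 T,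
      |R (timeGrid hT n t) (timeGrid hT n s)| ≤ M := fun n s _ t _ =>
    hM _ (timeGrid_mem hT n s) _ (timeGrid_mem hT n t)
  have e : ∀ n, ∑ y ∈ (timeGrid hT n).range, ∑ y' ∈ (timeGrid hT n).range,
      R y' y * ⟪levelIntegral (timeGrid hT n) g y', levelIntegral (timeGrid hT n) g y⟫ =
      ∫ p, R (timeGrid hT n p.2) (timeGrid hT n p.1) * ⟪g p.2, g p.1⟫
        ∂((volume.restrict (Icc 0 T)).prod (volume.restrict (Icc 0 T))) := by
    intro n
    rw [integral_prod _ (integrable_mul_inner (hm n) (hb n) g g)]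
    have h1 : ∀ s, ∫ t in Icc 0 T, R (timeGrid hT n t) (timeGrid hT n s) * ⟪g t, g s⟫ =
        ⟪∑ y ∈ (timeGrid hT n).range,
          R y (timeGrid hT n s) • levelIntegral (timeGrid hT n) g y, g s⟫ := by
      intro s
      have := integral_inner_simpleFunc (timeGrid hT n)
        (fun y => R y (timeGrid hT n s) • g s) g
      simp only [inner_smul_left, RCLike.conj_to_real] at this
      simp_rw [real_inner_comm (g s)]
      rw [this, inner_sum]
      refine Finset.sum_congr rfl fun y _ => ?_
      rw [inner_smul_right]
    simp_rw [h1]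
    rw [integral_inner_simpleFunc (timeGrid hT n) (fun z => ∑ y ∈ (timeGrid hT n).range,
          R y z • levelIntegral (timeGrid hT n) g y) g]
    refine Finset.sum_congr rfl fun y _ => ?_
    rw [sum_inner]
    refine Finset.sum_congr rfl fun y' _ => ?_
    rw [inner_smul_left, RCLike.conj_to_real]
  simp_rw [e]
  rw [IsBoundedKernel.inner_toCLM,
    ← integral_prod (fun p : ℝ × ℝ => R p.2 p.1 * ⟪g p.2, g p.1⟫)
      (integrable_mul_inner (hR.measurable.comp measurable_swap) hM g g)]
  refine tendsto_integral_of_dominated_convergence (fun p => M * (‖g p.1‖ * ‖g p.2‖))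
    (fun n => aestronglyMeasurable_mul_inner (hm n) g g)
    ((integrable_norm_mul_norm g g).const_mul M) (fun n => ?_) ?_
  all_goals
    rw [Measure.prod_restrict]
    filter_upwards [ae_restrict_mem (measurableSet_Icc.prod measurableSet_Icc)] with p hp
  · rw [norm_mul, mul_comm ‖g p.1‖]
    exact mul_le_mul (hb n _ hp.1 _ hp.2) (norm_inner_le_norm _ _) (norm_nonneg _)
      ((abs_nonneg _).trans (hb n _ hp.1 _ hp.2))
  · refine Tendsto.mul_const _ ?_
    exact (hR.tendsto (p.2, p.1)).comp
      ((tendsto_timeGrid hT hp.2).prodMk_nhds (tendsto_timeGrid hT hp.1))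

end Step

section GaussianField

variable {Ω : Type*} [MeasurableSpace Ω] {d : ℕ} {T : ℝ} {P : Measure Ω}

/-- The `ℝᵈ`-valued process `Y` on `[0,T]` is centred and Gaussian with covariance `R(s,t) I` and is
independent of the centred Gaussian vector `ξ` with covariance `r I`. -/
structure IsGaussianField (P : Measure Ω) (T : ℝ) (Y : ℝ → Ω → E d) (ξ : Ω → E d)
    (R : ℝ → ℝ → ℝ) (r : ℝ) : Prop where
  aemeasurable : ∀ t ∈ Icc 0 T, AEMeasurable (Y t) P
  aemeasurable_vector : AEMeasurable ξ P
  continuous : ∀ᵐ ω ∂P, ContinuousOn (fun t => Y t ω) (Icc 0 T)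
  transform : ∀ (s : Finset ℝ), (↑s : Set ℝ) ⊆ Icc 0 T → ∀ (a : ℝ → E d) (c : E d),
    ∫ ω, Complex.exp ((∑ t ∈ s, ⟪Y t ω, a t⟫ + ⟪ξ ω, c⟫ : ℝ) * Complex.I) ∂P =
      Complex.exp (-((∑ t ∈ s, ∑ t' ∈ s, R t' t * ⟪a t', a t⟫ + r * ‖c‖ ^ 2) / 2 : ℝ))

variable {Y : ℝ → Ω → E d} {ξ : Ω → E d} {R : ℝ → ℝ → ℝ} {r : ℝ}

lemma IsGaussianField.aemeasurable_stepL2 (h : IsGaussianField P T Y ξ R r) (hT : 0 ≤ T) (n : ℕ) :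
    AEMeasurable (fun ω => stepL2 T (timeGrid hT n) (fun t => Y t ω)) P := by
  unfold stepL2
  refine Finset.aemeasurable_fun_sum _ fun y hy => ?_
  exact (LinearMap.continuous_of_finiteDimensional _).measurable.comp_aemeasurable
    (h.aemeasurable y (timeGrid_range_subset hT n hy))

lemma IsGaussianField.aemeasurable_toL2 (h : IsGaussianField P T Y ξ R r) (hT : 0 ≤ T) :
    AEMeasurable (fun ω => toL2 T (fun t => Y t ω)) P := by
  refine aemeasurable_of_tendsto_metrizable_ae atTop (h.aemeasurable_stepL2 hT) ?_
  filter_upwards [h.continuous] with ω hω using tendsto_stepL2 hT hω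

/-- For step approximations this is the finite-dimensional formula with coefficients
`levelIntegral`; both sides then pass to the limit. -/
lemma IsGaussianField.transform_toL2 [IsProbabilityMeasure P] (h : IsGaussianField P T Y ξ R r)
    (hT : 0 ≤ T) (hR : Continuous fun p : ℝ × ℝ => R p.1 p.2) (g : L2 d T) (c : E d) :
    ∫ ω, Complex.exp ((⟪toL2 T (fun t => Y t ω), g⟫ + ⟪ξ ω, c⟫ : ℝ) * Complex.I) ∂P =
      Complex.exp (-((⟪(IsBoundedKernel.of_continuous hR).toCLM d g, g⟫ + r * ‖c‖ ^ 2) / 2 : ℝ)) := by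
  have e : ∀ n, ∫ ω, Complex.exp ((⟪stepL2 T (timeGrid hT n) (fun t => Y t ω), g⟫ + ⟪ξ ω, c⟫ : ℝ)
      * Complex.I) ∂P =
      Complex.exp (-((∑ y ∈ (timeGrid hT n).range, ∑ y' ∈ (timeGrid hT n).range,
      R y' y * ⟪levelIntegral (timeGrid hT n) g y', levelIntegral (timeGrid hT n) g y⟫
        + r * ‖c‖ ^ 2) / 2 : ℝ)) := by
    intro n
    rw [← h.transform _ (timeGrid_range_subset hT n)]
    refine integral_congr_ae (Eventually.of_forall fun ω => ?_)
    simp only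
    congr 4
    rw [← integral_inner_simpleFunc (timeGrid hT n) (fun t => Y t ω) g, L2.inner_def]
    refine integral_congr_ae ?_
    filter_upwards [stepL2_coeFn (T := T) (timeGrid hT n) (fun t => Y t ω)] with t ht
    rw [ht]
  refine tendsto_nhds_unique (f := fun n => ∫ ω, Complex.exp ((⟪stepL2 T (timeGrid hT n)
    (fun t => Y t ω), g⟫ + ⟪ξ ω, c⟫ : ℝ) * Complex.I) ∂P) (l := atTop) ?_ ?_
  · refine tendsto_integral_of_dominated_convergence (fun _ => 1) (fun n => ?_)
      (integrable_const _) (fun n => Eventually.of_forall fun ω => ?_) ?_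
    · have h1 := h.aemeasurable_stepL2 hT n
      have h2 := h.aemeasurable_vector
      have h3 : AEMeasurable (fun ω => ⟪stepL2 T (timeGrid hT n) (fun t => Y t ω), g⟫ + ⟪ξ ω, c⟫) P :=
        (AEMeasurable.inner (𝕜 := ℝ) h1 aemeasurable_const).add
          (AEMeasurable.inner (𝕜 := ℝ) h2 aemeasurable_const)
      exact (Complex.measurable_exp.comp_aemeasurable
        ((Complex.measurable_ofReal.comp_aemeasurable h3).mul_const _)).aestronglyMeasurable
    · rw [Complex.norm_exp_ofReal_mul_I]
    · filter_upwards [h.continuous] with ω hω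
      have h1 := Tendsto.inner (𝕜 := ℝ) (tendsto_stepL2 hT hω) (tendsto_const_nhds (x := g))
      exact ((Complex.continuous_exp.comp (Complex.continuous_ofReal.mul continuous_const)).tendsto
        _).comp (h1.add_const ⟪ξ ω, c⟫)
  · simp_rw [e]
    exact ((Complex.continuous_exp.comp Complex.continuous_ofReal.neg).tendsto _).comp
      (((tendsto_sum_levelIntegral hT hR g).add_const _).div_const 2)

end GaussianField

/-! ### The driving noise as a Gaussian field -/

section Noise

variable {Ω : Type*} [MeasurableSpace Ω] {d : ℕ} {P : Measure Ω}

lemma charFun_map_real {X : Ω → ℝ} (hX : AEMeasurable X P) (a : ℝ) :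
    charFun (P.map X) a = ∫ ω, Complex.exp ((a * X ω : ℝ) * Complex.I) ∂P := by
  rw [charFun_apply_real, integral_map hX (by fun_prop)]
  simp

lemma charFun_map_inner {H : Type*} [NormedAddCommGroup H] [InnerProductSpace ℝ H]
    [MeasurableSpace H] [BorelSpace H] [SecondCountableTopology H] {X : Ω → H}
    (hX : AEMeasurable X P) (c : H) :
    charFun (P.map X) c = ∫ ω, Complex.exp ((⟪X ω, c⟫ : ℝ) * Complex.I) ∂P := by
  rw [charFun_apply, integral_map hX (by fun_prop)]

lemma integral_exp_sum_brownian [IsProbabilityMeasure P] {B : ℝ≥0 → Ω → ℝ}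
    (hB : IsBrownianReal B P) (s : Finset ℝ) (a : ℝ → ℝ) :
    ∫ ω, Complex.exp ((∑ t ∈ s, a t * B t.toNNReal ω : ℝ) * Complex.I) ∂P =
      Complex.exp (-((∑ t ∈ s, ∑ t' ∈ s,
        a t * (a t' * (min t.toNNReal t'.toNNReal : ℝ≥0))) / 2 : ℝ)) := by
  have hG := (hB.isGaussianProcess.comp_right Real.toNNReal).smul a
  have hS := hG.hasGaussianLaw_fun_sum (I := s)
  simp only [Function.comp_apply, smul_eq_mul] at hS
  have hmean : ∫ ω, ∑ t ∈ s, a t * B t.toNNReal ω ∂P = 0 := by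
    rw [integral_finsetSum _ fun t _ => (hB.integrable_eval _).const_mul _]
    refine Finset.sum_eq_zero fun t _ => ?_
    rw [integral_const_mul, hB.integral_eval, mul_zero]
  have hvar : Var[fun ω => ∑ t ∈ s, a t * B t.toNNReal ω; P] =
      ∑ t ∈ s, ∑ t' ∈ s, a t * (a t' * (min t.toNNReal t'.toNNReal : ℝ≥0)) := by
    rw [variance_fun_sum' fun t _ =>
      (hB.isGaussianProcess.hasGaussianLaw_eval t.toNNReal).memLp_two.const_mul (a t)]
    refine Finset.sum_congr rfl fun t _ => Finset.sum_congr rfl fun t' _ => ?_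
    rw [covariance_const_mul_left, covariance_const_mul_right, hB.covariance_fun_eval]
  have h1 := charFun_map_real hS.aemeasurable 1
  simp only [one_mul] at h1
  rw [← h1, hS.map_eq_gaussianReal, charFun_gaussianReal, hmean,
    Real.coe_toNNReal _ (variance_nonneg _ _), hvar]
  congr 1
  push_cast
  ring

/-- Independence of the coordinates turns the transform into a product of scalar ones, whose
exponents add up to inner products. -/
lemma integral_exp_sum_brownianVector [IsProbabilityMeasure P] {W : ℝ≥0 → Ω → E d}
    (hW : IsBrownianVector W P) {s : Finset ℝ} (hs : ∀ t ∈ s, 0 ≤ t) (a : ℝ → E d) :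
    ∫ ω, Complex.exp ((∑ t ∈ s, ⟪W t.toNNReal ω, a t⟫ : ℝ) * Complex.I) ∂P =
      Complex.exp (-((∑ t ∈ s, ∑ t' ∈ s, min t' t * ⟪a t', a t⟫) / 2 : ℝ)) := by
  have hm : ∀ i : Fin d, AEMeasurable (fun ω => ∑ t ∈ s, a t i * W t.toNNReal ω i) P := fun i =>
    Finset.aemeasurable_fun_sum _ fun t _ => ((hW.component i).aemeasurable _).const_mul _
  have hind : iIndepFun (fun (i : Fin d) ω => ∑ t ∈ s, a t i * W t.toNNReal ω i) P :=
    hW.indep.comp (fun i w => ∑ t ∈ s, a t i * w t.toNNReal) fun i => by fun_prop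
  have e1 : ∀ ω, ∑ t ∈ s, ⟪W t.toNNReal ω, a t⟫ = ∑ i, ∑ t ∈ s, a t i * W t.toNNReal ω i := by
    intro ω
    rw [Finset.sum_comm]
    refine Finset.sum_congr rfl fun t _ => ?_
    simp [PiLp.inner_apply]
  have h1 := charFun_map_real
    (Finset.aemeasurable_fun_sum Finset.univ fun (i : Fin d) _ => hm i) 1
  simp only [one_mul] at h1
  simp_rw [e1]
  rw [← h1, hind.charFun_map_fun_sum_eq_prod hm, Finset.prod_apply]
  have h2 : ∀ i : Fin d, charFun (P.map fun ω => ∑ t ∈ s, a t i * W t.toNNReal ω i) 1 =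
      Complex.exp (-((∑ t ∈ s, ∑ t' ∈ s,
        a t i * (a t' i * (min t.toNNReal t'.toNNReal : ℝ≥0))) / 2 : ℝ)) := by
    intro i
    rw [charFun_map_real (hm i) 1]
    simp only [one_mul]
    exact integral_exp_sum_brownian (hW.component i) s fun t => a t i
  simp_rw [h2]
  have key : ∑ t ∈ s, ∑ t' ∈ s, min t' t * ⟪a t', a t⟫ = ∑ i, ∑ t ∈ s, ∑ t' ∈ s,
      a t i * (a t' i * (min t.toNNReal t'.toNNReal : ℝ≥0)) := by
    rw [Finset.sum_comm (s := Finset.univ)]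
    refine Finset.sum_congr rfl fun t ht => ?_
    rw [Finset.sum_comm (s := Finset.univ)]
    refine Finset.sum_congr rfl fun t' ht' => ?_
    rw [NNReal.coe_min, Real.coe_toNNReal _ (hs t ht), Real.coe_toNNReal _ (hs t' ht'),
      PiLp.inner_apply, Finset.mul_sum, min_comm]
    refine Finset.sum_congr rfl fun i _ => ?_
    simp only [RCLike.inner_apply, conj_trivial]
    ring
  rw [← Complex.exp_sum, Finset.sum_neg_distrib, ← Complex.ofReal_sum, ← Finset.sum_div, key]

lemma IsBrownianVector.aemeasurable {W : ℝ≥0 → Ω → E d} (hW : IsBrownianVector W P) (t : ℝ≥0) :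
    AEMeasurable (W t) P := by
  have h : AEMeasurable (fun ω => (W t ω).ofLp) P :=
    aemeasurable_pi_lambda _ fun i => (hW.component i).aemeasurable t
  exact (WithLp.measurable_toLp 2 _).comp_aemeasurable h

lemma IsBrownianVector.continuous {W : ℝ≥0 → Ω → E d} (hW : IsBrownianVector W P) :
    ∀ᵐ ω ∂P, Continuous fun t => W t ω := by
  filter_upwards [ae_all_iff.2 fun i => (hW.component i).cont] with ω hω
  exact (PiLp.continuous_toLp 2 _).comp (continuous_pi hω)

lemma charFun_velocityLaw {m : ℝ} (hm : 0 < m) (c : E d) :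
    charFun (velocityLaw d m) c = Complex.exp (-(1 / (2 * m) * ‖c‖ ^ 2 / 2 : ℝ)) := by
  rw [velocityLaw, charFun_map_smul, charFun_stdGaussian, ← Complex.ofReal_pow, norm_smul, mul_pow,
    norm_inv, Real.norm_of_nonneg (Real.sqrt_nonneg _), inv_pow, Real.sq_sqrt (by positivity)]
  congr 1
  push_cast
  ring

variable {m T : ℝ} {f : E d → E d} {x₀ : E d} {W : ℝ≥0 → Ω → E d} {x v : ℝ → Ω → E d}

/-- The driving Brownian motion together with the initial velocity. -/
lemma IsLangevinSolution.isGaussianField_noise [IsProbabilityMeasure P] (hm : 0 < m)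
    (hsol : IsLangevinSolution m T f x₀ P W x v) :
    IsGaussianField P T (fun t ω => W t.toNNReal ω) (v 0) (fun s t => min s t) (1 / (2 * m)) where
  aemeasurable t _ := hsol.brownian.aemeasurable _
  aemeasurable_vector := hsol.velocity_law.aemeasurable
  continuous := by
    filter_upwards [hsol.brownian.continuous] with ω hω
    exact (hω.comp continuous_real_toNNReal).continuousOn
  transform s hs a c := by
    have hA : AEMeasurable (fun ω => ∑ t ∈ s, ⟪W t.toNNReal ω, a t⟫) P :=
      Finset.aemeasurable_fun_sum _ fun t _ =>
        AEMeasurable.inner (𝕜 := ℝ) (hsol.brownian.aemeasurable _) aemeasurable_const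
    have hV : AEMeasurable (fun ω => ⟪v 0 ω, c⟫) P :=
      AEMeasurable.inner (𝕜 := ℝ) hsol.velocity_law.aemeasurable aemeasurable_const
    have hind : IndepFun (fun ω => ∑ t ∈ s, ⟪W t.toNNReal ω, a t⟫) (fun ω => ⟪v 0 ω, c⟫) P :=
      hsol.velocity_indep.symm.comp (φ := fun w : ℝ≥0 → E d => ∑ t ∈ s, ⟪w t.toNNReal, a t⟫)
        (ψ := fun y => ⟪y, c⟫) (by fun_prop) (by fun_prop)
    have h1 := charFun_map_real (hA.add hV) 1
    have h2 := charFun_map_real hA 1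
    have h3 := charFun_map_inner hsol.velocity_law.aemeasurable c
    have h4 := charFun_map_real hV 1
    simp only [one_mul, Pi.add_apply] at h1 h2 h4
    rw [← h1]
    change charFun (P.map fun ω => ∑ t ∈ s, ⟪W t.toNNReal ω, a t⟫ + ⟪v 0 ω, c⟫) 1 = _
    rw [hind.charFun_map_fun_add_eq_mul hA hV, Pi.mul_apply, h2, h4, ← h3,
      integral_exp_sum_brownianVector hsol.brownian (fun t ht => (hs ht).1), hsol.velocity_law.map_eq,
      charFun_velocityLaw hm, ← Complex.exp_add]
    congr 1
    push_cast
    ring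

end Noise

/-! ### The explicit solution of the linear Langevin equation -/

section Path

variable {d : ℕ} {m T : ℝ}

/-- The response of the position at time `t` to the initial velocity. -/
def velocityCoeff (m t : ℝ) : ℝ := m * (1 - Real.exp (-t / m))

/-- The response of the position at time `t` to the driving noise at time `u`. -/
def noiseKernel (m t : ℝ) : ℝ → ℝ := (Iic t).indicator fun u => m⁻¹ * Real.exp ((u - t) / m)

lemma integral_noiseKernel_smul {G : Type*} [NormedAddCommGroup G] [NormedSpace ℝ G] {t : ℝ}
    (ht : t ∈ Icc 0 T) (F : ℝ → G) :
    ∫ u in Icc 0 T, noiseKernel m t u • F u =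
      ∫ u in (0 : ℝ)..t, (m⁻¹ * Real.exp ((u - t) / m)) • F u := by
  have e : ∀ u, noiseKernel m t u • F u =
      (Iic t).indicator (fun u => (m⁻¹ * Real.exp ((u - t) / m)) • F u) u := by
    intro u
    by_cases h : u ∈ Iic t <;> simp [noiseKernel, h]
  simp_rw [e]
  rw [setIntegral_indicator measurableSet_Iic, intervalIntegral.integral_of_le ht.1,
    ← integral_Icc_eq_integral_Ioc]
  congr 2
  ext u
  simp only [mem_inter_iff, mem_Icc, mem_Iic]
  exact ⟨fun h => ⟨h.1.1, h.2⟩, fun h => ⟨⟨h.1, h.2.trans ht.2⟩, h.2⟩⟩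

/-- With `y = x - x₀` the system becomes `y' = v(0) - y/m + w/m`, in which the noise is not
differentiated. The integrating factor `exp(s/m)` solves it path by path. -/
lemma path_eq (hm : 0 < m) {x v w : ℝ → E d} {x₀ : E d}
    (hv : ContinuousOn v (Icc 0 T)) (hw : ContinuousOn w (Icc 0 T))
    (hx : ∀ t ∈ Icc 0 T, x t = x₀ + ∫ s in (0 : ℝ)..t, v s)
    (hvw : ∀ t ∈ Icc 0 T, m • v t = m • v 0 - (∫ s in (0 : ℝ)..t, v s) + w t)
    {t : ℝ} (ht : t ∈ Icc 0 T) :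
    x t - x₀ = velocityCoeff m t • v 0 + ∫ u in Icc 0 T, noiseKernel m t u • w u := by
  have hsub : Icc 0 t ⊆ Icc 0 T := Icc_subset_Icc le_rfl ht.2
  set y : ℝ → E d := fun s => ∫ r in (0 : ℝ)..s, v r with hy
  have hyx : x t - x₀ = y t := by rw [hx t ht, add_sub_cancel_left]
  have hvi : IntervalIntegrable v volume 0 t :=
    (hv.mono (by rw [uIcc_of_le ht.1]; exact hsub)).intervalIntegrable
  have hyc : ContinuousOn y (Icc 0 t) := by
    have := intervalIntegral.continuousOn_primitive_interval
      ((intervalIntegrable_iff_integrableOn_Icc_of_le ht.1).1 hvi |>.congr_set_ae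
        (by rw [uIcc_of_le ht.1]; exact EventuallyEq.rfl))
    rwa [uIcc_of_le ht.1] at this
  have hexp : ∀ s : ℝ, HasDerivAt (fun s => Real.exp (s / m)) (Real.exp (s / m) * (1 / m)) s :=
    fun s => ((hasDerivAt_id s).div_const m).exp
  have hd : ∀ s ∈ Ioo 0 t, HasDerivAt (fun s => Real.exp (s / m) • y s)
      (Real.exp (s / m) • (v 0 + m⁻¹ • w s)) s := by
    intro s hs
    have hsT : s ∈ Icc 0 T := hsub (Ioo_subset_Icc_self hs)
    have hnhds : Icc 0 t ∈ nhds s := Icc_mem_nhds hs.1 hs.2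
    have h1 : HasDerivAt y (v s) s := by
      refine intervalIntegral.integral_hasDerivAt_right
        (hvi.mono_set (by rw [uIcc_of_le ht.1, uIcc_of_le hs.1.le]; exact Icc_subset_Icc le_rfl hs.2.le))
        ?_ ((hv.mono hsub).continuousAt hnhds)
      exact (hv.mono hsub).stronglyMeasurableAtFilter_nhdsWithin measurableSet_Icc s |>.filter_mono
        (by rw [nhdsWithin_eq_nhds.2 hnhds])
    refine ((hexp s).smul h1).congr_deriv ?_
    have h2 : v s = v 0 - m⁻¹ • y s + m⁻¹ • w s := by
      have := congrArg (fun z => m⁻¹ • z) (hvw s hsT)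
      simpa only [smul_add, smul_sub, inv_smul_smul₀ hm.ne'] using this
    rw [h2]
    module
  have hwi : IntervalIntegrable (fun s => Real.exp (s / m) • (v 0 + m⁻¹ • w s)) volume 0 t := by
    refine ContinuousOn.intervalIntegrable ?_
    rw [uIcc_of_le ht.1]
    have := hw.mono hsub
    fun_prop
  have key := intervalIntegral.integral_eq_sub_of_hasDerivAt_of_le ht.1
    ((by fun_prop : ContinuousOn (fun s => Real.exp (s / m) • y s) (Icc 0 t))) hd hwi
  have hy0 : y 0 = 0 := intervalIntegral.integral_same
  rw [hy0, smul_zero, sub_zero] at key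
  have hint : ∫ s in (0 : ℝ)..t, Real.exp (s / m) = m * (Real.exp (t / m) - 1) := by
    rw [intervalIntegral.integral_eq_sub_of_hasDerivAt (f := fun s => m * Real.exp (s / m))
      (fun s _ => ((hexp s).const_mul m).congr_deriv (by field_simp))
      (Continuous.intervalIntegrable (by fun_prop) _ _)]
    simp
    ring
  rw [hyx, integral_noiseKernel_smul ht]
  have h3 : y t = Real.exp (-t / m) • ∫ s in (0 : ℝ)..t, Real.exp (s / m) • (v 0 + m⁻¹ • w s) := by
    rw [key, smul_smul, ← Real.exp_add]
    simp [neg_div]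
  have hwc := hw.mono hsub
  have h4 : ∫ s in (0 : ℝ)..t, Real.exp (s / m) • (v 0 + m⁻¹ • w s) =
      (∫ s in (0 : ℝ)..t, Real.exp (s / m)) • v 0 +
        ∫ s in (0 : ℝ)..t, (Real.exp (s / m) * m⁻¹) • w s := by
    rw [← intervalIntegral.integral_smul_const, ← intervalIntegral.integral_add]
    · simp only [smul_add, smul_smul]
    · exact Continuous.intervalIntegrable (by fun_prop) _ _
    · refine ContinuousOn.intervalIntegrable ?_
      rw [uIcc_of_le ht.1]
      fun_prop
  rw [h3, h4, smul_add, smul_smul, hint, ← intervalIntegral.integral_smul]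
  congr 1
  · congr 1
    rw [velocityCoeff, mul_left_comm, mul_sub, ← Real.exp_add]
    simp [neg_div]
  · refine intervalIntegral.integral_congr fun s _ => ?_
    simp only [smul_smul]
    rw [sub_div, sub_eq_add_neg, Real.exp_add, neg_div, ← mul_assoc, mul_comm (Real.exp _),
      mul_comm _ m⁻¹]

/-! ### The covariance of the free path -/

lemma measurable_noiseKernel (m t : ℝ) : Measurable (noiseKernel m t) :=
  Measurable.indicator (by fun_prop) measurableSet_Iic

lemma abs_noiseKernel_le (hm : 0 < m) (t u : ℝ) : |noiseKernel m t u| ≤ m⁻¹ := by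
  by_cases h : u ∈ Iic t
  · have h' : u ≤ t := h
    rw [noiseKernel, indicator_of_mem h, abs_of_pos (by positivity)]
    refine mul_le_of_le_one_right (by positivity) (Real.exp_le_one_iff.2 ?_)
    exact div_nonpos_of_nonpos_of_nonneg (by linarith) hm.le
  · rw [noiseKernel, indicator_of_notMem h, abs_zero]
    positivity

lemma memLp_noiseKernel (hm : 0 < m) (t : ℝ) (a : E d) :
    MemLp (fun u => noiseKernel m t u • a) 2 (volume.restrict (Icc 0 T)) := by
  refine MemLp.of_bound ((measurable_noiseKernel m t).smul_const a).aestronglyMeasurable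
    (m⁻¹ * ‖a‖) (Eventually.of_forall fun u => ?_)
  rw [norm_smul]
  exact mul_le_mul_of_nonneg_right (abs_noiseKernel_le hm t u) (norm_nonneg _)

lemma toL2_noiseKernel_coeFn (hm : 0 < m) (t : ℝ) (a : E d) :
    toL2 T (fun u => noiseKernel m t u • a) =ᵐ[volume.restrict (Icc 0 T)]
      fun u => noiseKernel m t u • a := by
  rw [toL2, dif_pos (memLp_noiseKernel hm t a)]
  exact MemLp.coeFn_toLp _

/-- Exhibits the noise part of `⟪x(t), a⟫` as the pairing of the noise path with a fixed element of
`L²`, the form required by `IsGaussianField.transform_toL2`. -/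
lemma inner_toL2_noiseKernel (hm : 0 < m) {w : ℝ → E d} (hw : ContinuousOn w (Icc 0 T)) (t : ℝ)
    (a : E d) :
    ⟪toL2 T w, toL2 T (fun u => noiseKernel m t u • a)⟫ =
      ⟪∫ u in Icc 0 T, noiseKernel m t u • w u, a⟫ := by
  have hi : IntegrableOn (fun u => noiseKernel m t u • w u) (Icc 0 T) := by
    refine (hw.integrableOn_compact isCompact_Icc).bdd_smul m⁻¹
      (measurable_noiseKernel m t).aestronglyMeasurable (Eventually.of_forall fun u => ?_)
    exact abs_noiseKernel_le hm t u
  rw [L2.inner_def, real_inner_comm, ← integral_inner hi]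
  refine integral_congr_ae ?_
  filter_upwards [toL2_coeFn hw, toL2_noiseKernel_coeFn (T := T) hm t a] with u h1 h2
  rw [h1, h2, inner_smul_right, inner_smul_right, real_inner_comm]

lemma hasDerivAt_exp_sub_div (m t u : ℝ) :
    HasDerivAt (fun u => Real.exp ((u - t) / m)) (Real.exp ((u - t) / m) * (1 / m)) u :=
  (((hasDerivAt_id u).sub_const t).div_const m).exp

lemma integral_noiseKernel_mul_min (hm : 0 < m) {s u : ℝ} (hs : s ∈ Icc 0 T) (hu : u ∈ Icc 0 s) :
    ∫ r in Icc 0 T, noiseKernel m s r * min r u =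
      u + m * Real.exp (-s / m) - m * Real.exp ((u - s) / m) := by
  have h := integral_noiseKernel_smul (m := m) hs (fun r => min r u)
  simp only [smul_eq_mul] at h
  have hc : Continuous fun r => m⁻¹ * Real.exp ((r - s) / m) * min r u := by fun_prop
  rw [h, ← intervalIntegral.integral_add_adjacent_intervals (b := u)
    (hc.intervalIntegrable _ _) (hc.intervalIntegrable _ _)]
  have h1 : ∫ r in (0 : ℝ)..u, m⁻¹ * Real.exp ((r - s) / m) * min r u =
      Real.exp ((u - s) / m) * (u - m) - Real.exp ((0 - s) / m) * (0 - m) := by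
    rw [intervalIntegral.integral_congr (g := fun r => m⁻¹ * Real.exp ((r - s) / m) * r),
      intervalIntegral.integral_eq_sub_of_hasDerivAt
        (f := fun r => Real.exp ((r - s) / m) * (r - m))]
    · intro r _
      refine ((hasDerivAt_exp_sub_div m s r).mul ((hasDerivAt_id r).sub_const m)).congr_deriv ?_
      simp only [id]
      field_simp
      ring
    · exact Continuous.intervalIntegrable (by fun_prop) _ _
    · intro r hr
      rw [uIcc_of_le hu.1] at hr
      simp only [min_eq_left hr.2]
  have h2 : ∫ r in u..s, m⁻¹ * Real.exp ((r - s) / m) * min r u =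
      Real.exp ((s - s) / m) * u - Real.exp ((u - s) / m) * u := by
    rw [intervalIntegral.integral_congr (g := fun r => m⁻¹ * Real.exp ((r - s) / m) * u),
      intervalIntegral.integral_eq_sub_of_hasDerivAt (f := fun r => Real.exp ((r - s) / m) * u)]
    · intro r _
      refine ((hasDerivAt_exp_sub_div m s r).mul_const u).congr_deriv ?_
      field_simp
    · exact Continuous.intervalIntegrable (by fun_prop) _ _
    · intro r hr
      rw [uIcc_of_le hu.2] at hr
      simp only [min_eq_right hr.1]
  rw [h1, h2, sub_self, zero_div, Real.exp_zero, zero_sub]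
  ring

/-- The subtracted product is the contribution of the initial velocity, whose variance is `1/(2m)`;
what remains is due to the noise. -/
lemma integral_noiseKernel_noiseKernel_min (hm : 0 < m) {s t : ℝ} (hs : s ∈ Icc 0 T)
    (ht : t ∈ Icc 0 s) :
    ∫ u in Icc 0 T, noiseKernel m t u * ∫ r in Icc 0 T, noiseKernel m s r * min r u =
      freeCov m s t - velocityCoeff m s * velocityCoeff m t / (2 * m) := by
  have h := integral_noiseKernel_smul (m := m) (T := T) ⟨ht.1, ht.2.trans hs.2⟩
    (fun u => ∫ r in Icc 0 T, noiseKernel m s r * min r u)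
  simp only [smul_eq_mul] at h
  have e1 : ∀ u, Real.exp ((u - t) / m) = Real.exp (-t / m) * Real.exp (u / m) := fun u => by
    rw [← Real.exp_add]; congr 1; ring
  have e2 : ∀ u, Real.exp ((u - s) / m) = Real.exp (-s / m) * Real.exp (u / m) := fun u => by
    rw [← Real.exp_add]; congr 1; ring
  rw [h, intervalIntegral.integral_congr (g := fun u => m⁻¹ * Real.exp ((u - t) / m) *
      (u + m * Real.exp (-s / m) - m * Real.exp ((u - s) / m))),
    -- An explicit antiderivative; the factor `m / 2` arises because two exponentials are
    -- multiplied.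
    intervalIntegral.integral_eq_sub_of_hasDerivAt (f := fun u => Real.exp ((u - t) / m) *
      (u - m + m * Real.exp (-s / m) - m / 2 * Real.exp ((u - s) / m)))]
  · have h1 : Real.exp (-t / m) * Real.exp (t / m) = 1 := by
      rw [← Real.exp_add, neg_div, neg_add_cancel, Real.exp_zero]
    rw [freeCov_of_le ht.2, lowerCov, velocityCoeff, velocityCoeff, e1, e2, e2, e1, h1]
    simp only [zero_div, Real.exp_zero]
    field_simp
    ring
  · intro u _
    refine ((hasDerivAt_exp_sub_div m t u).mul ((((hasDerivAt_id u).sub_const m).add_const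
      (m * Real.exp (-s / m))).sub ((hasDerivAt_exp_sub_div m s u).const_mul (m / 2)))).congr_deriv ?_
    simp only [id, Pi.sub_apply]
    field_simp
    ring
  · exact Continuous.intervalIntegrable (by fun_prop) _ _
  · intro u hu
    rw [uIcc_of_le ht.1] at hu
    simp only [integral_noiseKernel_mul_min hm hs ⟨hu.1, hu.2.trans ht.2⟩]

lemma continuous_min_prod : Continuous fun p : ℝ × ℝ => min p.1 p.2 :=
  continuous_fst.min continuous_snd

lemma inner_toCLM_noiseKernel (hm : 0 < m) {s t : ℝ} (hs : s ∈ Icc 0 T) (ht : t ∈ Icc 0 T)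
    (a b : E d) :
    ⟪(IsBoundedKernel.of_continuous (T := T) continuous_min_prod).toCLM d
        (toL2 T fun u => noiseKernel m s u • a), toL2 T fun u => noiseKernel m t u • b⟫ =
      (freeCov m s t - velocityCoeff m s * velocityCoeff m t / (2 * m)) * ⟪a, b⟫ := by
  wlog h : t ≤ s generalizing s t a b
  · rw [IsBoundedKernel.inner_toCLM_comm _ fun s t => min_comm s t, real_inner_comm,
      this ht hs b a (le_of_not_ge h), freeCov_comm, real_inner_comm]
    ring
  rw [IsBoundedKernel.inner_toCLM, ← integral_noiseKernel_noiseKernel_min hm hs ⟨ht.1, h⟩,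
    ← integral_mul_const]
  refine integral_congr_ae ?_
  filter_upwards [toL2_noiseKernel_coeFn (T := T) hm t b] with u hu
  rw [mul_assoc, ← integral_mul_const, ← integral_const_mul]
  refine integral_congr_ae ?_
  filter_upwards [toL2_noiseKernel_coeFn (T := T) hm s a] with r hr
  rw [hu, hr, inner_smul_left, inner_smul_right, conj_trivial]
  ring

end Path

/-! ### The bridge as a Gaussian field -/

section Bridge

variable {Ω : Type*} [MeasurableSpace Ω] {d : ℕ} {P : Measure Ω} {m T : ℝ} {x₀ : E d}
  {W : ℝ≥0 → Ω → E d} {x v : ℝ → Ω → E d}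

lemma IsLangevinSolution.ae_inner_sum (hm : 0 < m)
    (hsol : IsLangevinSolution m T (fun _ => 0) x₀ P W x v) {ι : Type*} (s : Finset ι)
    {τ : ι → ℝ} (hτ : ∀ i ∈ s, τ i ∈ Icc 0 T) (a : ι → E d) :
    ∀ᵐ ω ∂P, ∑ i ∈ s, ⟪x (τ i) ω - x₀, a i⟫ =
      ⟪toL2 T (fun t => W t.toNNReal ω),
        ∑ i ∈ s, toL2 T fun u => noiseKernel m (τ i) u • a i⟫ +
      ⟪v 0 ω, ∑ i ∈ s, velocityCoeff m (τ i) • a i⟫ := by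
  filter_upwards [hsol.continuous_velocity, hsol.position_eq, hsol.velocity_eq,
    hsol.brownian.continuous] with ω h1 h2 h3 h4
  have hw : ContinuousOn (fun t : ℝ => W t.toNNReal ω) (Icc 0 T) :=
    (h4.comp continuous_real_toNNReal).continuousOn
  rw [inner_sum, inner_sum, ← Finset.sum_add_distrib]
  refine Finset.sum_congr rfl fun i hi => ?_
  have h5 := path_eq hm h1 hw h2 (fun t ht => by simpa using h3 t ht) (hτ i hi)
  rw [h5, inner_toL2_noiseKernel hm hw, inner_add_left, inner_smul_left, inner_smul_right,
    conj_trivial, add_comm]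

/-- The initial velocity and noise contributions add up to `freeCov`. A general index type allows a
time to occur twice, so the endpoint may be added to times that already contain `T`. -/
lemma IsLangevinSolution.integral_exp_sum [IsProbabilityMeasure P] (hm : 0 < m) (hT : 0 ≤ T)
    (hsol : IsLangevinSolution m T (fun _ => 0) x₀ P W x v) {ι : Type*} (s : Finset ι)
    {τ : ι → ℝ} (hτ : ∀ i ∈ s, τ i ∈ Icc 0 T) (a : ι → E d) :
    ∫ ω, Complex.exp ((∑ i ∈ s, ⟪x (τ i) ω - x₀, a i⟫ : ℝ) * Complex.I) ∂P =
      Complex.exp (-((∑ i ∈ s, ∑ j ∈ s, freeCov m (τ j) (τ i) * ⟪a j, a i⟫) / 2 : ℝ)) := by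
  have h := (hsol.isGaussianField_noise hm).transform_toL2 hT continuous_min_prod
    (∑ i ∈ s, toL2 T fun u => noiseKernel m (τ i) u • a i)
    (∑ i ∈ s, velocityCoeff m (τ i) • a i)
  rw [integral_congr_ae (g := fun ω => Complex.exp (((⟪toL2 T (fun t => W t.toNNReal ω),
        ∑ i ∈ s, toL2 T fun u => noiseKernel m (τ i) u • a i⟫ +
      ⟪v 0 ω, ∑ i ∈ s, velocityCoeff m (τ i) • a i⟫ : ℝ)) * Complex.I)), h]
  · congr 4
    rw [← real_inner_self_eq_norm_sq, map_sum, inner_sum, inner_sum, Finset.mul_sum,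
      ← Finset.sum_add_distrib]
    refine Finset.sum_congr rfl fun i hi => ?_
    rw [sum_inner, sum_inner, Finset.mul_sum, ← Finset.sum_add_distrib]
    refine Finset.sum_congr rfl fun j hj => ?_
    rw [inner_toCLM_noiseKernel hm (hτ j hj) (hτ i hi), inner_smul_left, inner_smul_right,
      conj_trivial]
    ring
  · filter_upwards [hsol.ae_inner_sum hm s hτ a] with ω hω
    rw [hω]

lemma lowerCov_eq_mul (hm : 0 < m) (hT : 0 < T) (t : ℝ) :
    lowerCov m T t = lowerCov m T T * bridgeCoeff m T t := by
  rw [bridgeCoeff, mul_div_cancel₀ _ (lowerCov_self_pos hm hT).ne']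

/-- The part of the path that is uncorrelated with its endpoint, together with the endpoint. -/
lemma IsLangevinSolution.isGaussianField_bridge [IsProbabilityMeasure P] (hm : 0 < m) (hT : 0 < T)
    (hsol : IsLangevinSolution m T (fun _ => 0) x₀ P W x v) :
    IsGaussianField P T (fun t ω => (x t ω - x₀) - bridgeCoeff m T t • (x T ω - x₀))
      (fun ω => x T ω - x₀) (bridgeCov m T) (lowerCov m T T) where
  aemeasurable t ht := by
    have h1 := hsol.aemeasurable_position t ht
    have h2 := hsol.aemeasurable_position T ⟨hT.le, le_rfl⟩
    fun_prop
  aemeasurable_vector := (hsol.aemeasurable_position T ⟨hT.le, le_rfl⟩).sub_const _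
  continuous := by
    filter_upwards [hsol.continuous_position] with ω hω
    have := (continuous_bridgeCoeff m T).continuousOn (s := Icc 0 T)
    fun_prop
  transform s hs a c := by
    -- The regression terms contribute `-S` to the coefficient of the endpoint, whose total is `c -
    -- S`; the index `none` stands for the time `T`.
    set S : E d := ∑ t ∈ s, bridgeCoeff m T t • a t with hS
    have h := hsol.integral_exp_sum hm hT.le (Finset.insertNone s) (τ := fun o => o.getD T)
      (fun o ho => by
        rcases o with _ | t
        · exact ⟨hT.le, le_rfl⟩
        · exact hs (Finset.some_mem_insertNone.1 ho))
      (fun o => o.elim (c - S) a)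
    simp only [Finset.sum_insertNone, Option.getD_some, Option.getD_none, Option.elim_some,
      Option.elim_none] at h
    have e : ∀ ω, ∑ t ∈ s, ⟪(x t ω - x₀) - bridgeCoeff m T t • (x T ω - x₀), a t⟫ +
        ⟪x T ω - x₀, c⟫ = ⟪x T ω - x₀, c - S⟫ + ∑ t ∈ s, ⟪x t ω - x₀, a t⟫ := by
      intro ω
      rw [hS, inner_sub_right, inner_sum]
      simp only [inner_sub_left (_ - _), inner_smul_left, inner_smul_right, conj_trivial,
        Finset.sum_sub_distrib]
      ring
    simp_rw [e]
    rw [h]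
    congr 4
    -- With `r = lowerCov m T T` the endpoint terms are `r ‖c - S‖² + 2 r ⟪S, c - S⟫ = r ‖c‖² - r
    -- ‖S‖²`. No cross term is left, and `-r ‖S‖²` turns `freeCov` into `bridgeCov`.
    have hF : ∀ t ∈ s, freeCov m t T = lowerCov m T T * bridgeCoeff m T t := fun t ht => by
      rw [freeCov_of_ge (hs ht).2, lowerCov_eq_mul hm hT]
    have h1 : ∑ t ∈ s, freeCov m t T * ⟪a t, c - S⟫ = lowerCov m T T * ⟪S, c - S⟫ := by
      rw [hS, sum_inner, Finset.mul_sum]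
      refine Finset.sum_congr rfl fun t ht => ?_
      rw [hF t ht, inner_smul_left, conj_trivial, mul_assoc]
    have h2 : ∑ t ∈ s, freeCov m T t * ⟪c - S, a t⟫ = lowerCov m T T * ⟪S, c - S⟫ := by
      rw [← h1]
      refine Finset.sum_congr rfl fun t _ => ?_
      rw [freeCov_comm, real_inner_comm]
    have h3 : ∑ t ∈ s, ∑ t' ∈ s, bridgeCov m T t' t * ⟪a t', a t⟫ =
        ∑ t ∈ s, ∑ t' ∈ s, freeCov m t' t * ⟪a t', a t⟫ - lowerCov m T T * ⟪S, S⟫ := by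
      rw [hS, inner_sum, Finset.mul_sum, ← Finset.sum_sub_distrib]
      refine Finset.sum_congr rfl fun t _ => ?_
      rw [sum_inner, Finset.mul_sum, ← Finset.sum_sub_distrib]
      refine Finset.sum_congr rfl fun t' _ => ?_
      rw [bridgeCov, lowerCov_eq_mul hm hT t, inner_smul_left, inner_smul_right, conj_trivial]
      ring
    rw [Finset.sum_add_distrib, h1, h2, h3, freeCov_of_le le_rfl, ← real_inner_self_eq_norm_sq]
    simp only [inner_sub_left, inner_sub_right, real_inner_comm c S]
    ring

end Bridge

/-! ### Gaussian measures given by their characteristic function -/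

section Gaussian

variable {H : Type*} [NormedAddCommGroup H] [InnerProductSpace ℝ H] [MeasurableSpace H]
  {μ : Measure H} [IsProbabilityMeasure μ] {C : H →L[ℝ] H}

/-- A characteristic function is bounded by `1` in modulus. This supplies the positivity of the
Green operator. -/
lemma inner_nonneg_of_charFun
    (h : ∀ g, charFun μ g = Complex.exp (-(⟪C g, g⟫ / 2 : ℝ))) (g : H) : 0 ≤ ⟪C g, g⟫ := by
  have h1 := norm_charFun_le_one (μ := μ) g
  rw [h, Complex.norm_exp, Real.exp_le_one_iff] at h1
  simp only [Complex.neg_re, Complex.ofReal_re] at h1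
  linarith

lemma isGaussianWith_map_add [BorelSpace H] [SecondCountableTopology H] [CompleteSpace H]
    (h : ∀ g, charFun μ g = Complex.exp (-(⟪C g, g⟫ / 2 : ℝ)))
    (hC : ∀ f g, ⟪C f, g⟫ = ⟪f, C g⟫) (a : H) :
    IsGaussianWith (μ.map fun u => u + a) a C := by
  have : IsProbabilityMeasure (μ.map fun u => u + a) :=
    Measure.isProbabilityMeasure_map (by fun_prop)
  set f : H →L[ℝ] H →L[ℝ] ℝ := (innerSL ℝ).comp C
  have hf : f.toBilinForm.IsPosSemidef :=
    { eq := fun g k => by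
        change ⟪C g, k⟫ = ⟪C k, g⟫
        rw [hC, real_inner_comm]
      nonneg := fun g => inner_nonneg_of_charFun h g }
  have hchar : ∀ t, charFun (μ.map fun u => u + a) t =
      Complex.exp ((⟪t, a⟫ : ℝ) * Complex.I - (f t t : ℝ) / 2) := by
    intro t
    rw [charFun_map_add_const, h, ← Complex.exp_add, real_inner_comm t a]
    congr 1
    change _ = _ - ((⟪C t, t⟫ : ℝ) : ℂ) / 2
    push_cast
    ring
  obtain ⟨h1, h2⟩ := gaussian_charFun_congr a f hf hchar
  exact ⟨isGaussian_iff_gaussian_charFun.2 ⟨a, f, hf, hchar⟩, h1.symm, fun g k => by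
    rw [← h2]; rfl⟩

end Gaussian

lemma isOpenPosMeasure_stdGaussian (d : ℕ) : (stdGaussian (E d)).IsOpenPosMeasure := by
  have h1 : (gaussianReal 0 1).IsOpenPosMeasure :=
    (gaussianReal_absolutelyContinuous' 0 one_ne_zero).isOpenPosMeasure
  rw [← map_pi_eq_stdGaussian]
  exact (PiLp.continuous_toLp 2 _).isOpenPosMeasure_map (WithLp.toLp_surjective 2)

/-- Such a measure is the image of the standard Gaussian under the surjective scaling by `√r`. -/
lemma isOpenPosMeasure_of_charFun {d : ℕ} {μ : Measure (E d)} [IsFiniteMeasure μ] {r : ℝ}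
    (hr : 0 < r) (h : ∀ c, charFun μ c = Complex.exp (-(r * ‖c‖ ^ 2 / 2 : ℝ))) :
    μ.IsOpenPosMeasure := by
  have h1 := isOpenPosMeasure_stdGaussian d
  have h2 : μ = (stdGaussian (E d)).map (Real.sqrt r • ·) := by
    refine Measure.ext_of_charFun (funext fun c => ?_)
    rw [h, charFun_map_smul, charFun_stdGaussian, ← Complex.ofReal_pow, norm_smul, mul_pow,
      Real.norm_of_nonneg (Real.sqrt_nonneg _), Real.sq_sqrt hr.le]
    congr 1
    push_cast
    ring
  rw [h2]
  exact (continuous_const_smul _).isOpenPosMeasure_map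
    (MulAction.surjective₀ (Real.sqrt_pos.2 hr).ne')

/-! ### Conditioned laws -/

section Conditioning

variable {Ω 𝓧 𝓨 : Type*} [MeasurableSpace Ω] {P : Measure Ω} [IsProbabilityMeasure P]
  [NormedAddCommGroup 𝓧] [MeasurableSpace 𝓧] [BorelSpace 𝓧] [SecondCountableTopology 𝓧]
  [TopologicalSpace 𝓨] [MeasurableSpace 𝓨] {X Z : Ω → 𝓧} {Y : Ω → 𝓨}

/-- Two regular conditional distributions agree for almost every value of `Y`; weak continuity and
full support extend this to every value. -/
lemma IsConditionedLaw.unique (hY : (P.map Y).IsOpenPosMeasure) {y : 𝓨} {Q Q' : Measure 𝓧}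
    (h : IsConditionedLaw P X Y y Q) (h' : IsConditionedLaw P X Y y Q') : Q = Q' := by
  obtain ⟨κ, hκ, hc, hd, rfl⟩ := h
  obtain ⟨κ', hκ', hc', hd', rfl⟩ := h'
  have hPY : IsProbabilityMeasure (P.map Y) := Measure.isProbabilityMeasure_map hd.aemeasurable_fst
  have h1 : (P.map Y) ⊗ₘ κ = (P.map Y) ⊗ₘ κ' := hd.map_eq.symm.trans hd'.map_eq
  have h2 := Kernel.ae_eq_of_compProd_eq h1
  refine ext_of_forall_integral_eq_of_IsFiniteMeasure fun F => ?_
  refine congrFun ((Continuous.ae_eq_iff_eq (P.map Y) (hc F) (hc' F)).1 ?_) y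
  filter_upwards [h2] with z hz
  rw [hz]

/-- Fixing `Y = z` leaves the law of `Z` unchanged, so the kernel is `z ↦ Law(Z + A z)`. It is
weakly continuous by dominated convergence, because `A` is continuous. -/
lemma isConditionedLaw_of_indepFun [BorelSpace 𝓨] [SecondCountableTopology 𝓨]
    (hZ : AEMeasurable Z P) (hY : AEMeasurable Y P) (hind : IndepFun Z Y P) {A : 𝓨 → 𝓧}
    (hA : Continuous A) (hX : ∀ᵐ ω ∂P, X ω = Z ω + A (Y ω)) (y : 𝓨) :
    IsConditionedLaw P X Y y ((P.map Z).map fun u => u + A y) := by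
  have hPZ : IsProbabilityMeasure (P.map Z) := Measure.isProbabilityMeasure_map hZ
  have hPY : IsProbabilityMeasure (P.map Y) := Measure.isProbabilityMeasure_map hY
  have hg : Measurable fun p : 𝓨 × 𝓧 => p.2 + A p.1 := by fun_prop
  set κ : Kernel 𝓨 𝓧 := (Kernel.id ×ₖ Kernel.const 𝓨 (P.map Z)).map fun p => p.2 + A p.1 with hκ
  have hκy : ∀ z, κ z = (P.map Z).map fun u => u + A z := by
    intro z
    rw [hκ, Kernel.map_apply _ hg, Kernel.prod_apply, Kernel.id_apply, Kernel.const_apply,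
      Measure.dirac_prod, Measure.map_map hg measurable_prodMk_left]
    rfl
  refine ⟨κ, Kernel.IsMarkovKernel.map _ hg, fun F => ?_, ?_, hκy y⟩
  · have e : ∀ z, ∫ u, F u ∂(κ z) = ∫ u, F (u + A z) ∂(P.map Z) := fun z => by
      rw [hκy, integral_map (by fun_prop) (by fun_prop)]
    simp_rw [e]
    refine continuous_of_dominated (bound := fun _ => ‖F‖) (fun z => ?_)
      (fun z => Eventually.of_forall fun u => F.norm_coe_le_norm _) (integrable_const _)
      (Eventually.of_forall fun u => by fun_prop)
    exact (F.continuous.comp (continuous_id.add continuous_const)).aestronglyMeasurable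
  · have hYX : (fun ω => (Y ω, X ω)) =ᵐ[P] fun ω => (Y ω, Z ω + A (Y ω)) := by
      filter_upwards [hX] with ω hω
      rw [hω]
    have hm : AEMeasurable (fun ω => (Y ω, Z ω + A (Y ω))) P :=
      hY.prodMk (hZ.add (hA.measurable.comp_aemeasurable hY))
    refine ⟨hm.congr hYX.symm, ?_⟩
    rw [Measure.map_congr hYX]
    have hg' : Measurable fun p : 𝓨 × 𝓧 => (p.1, p.2 + A p.1) := measurable_fst.prodMk hg
    have h1 : P.map (fun ω => (Y ω, Z ω + A (Y ω))) =
        ((P.map Y).prod (P.map Z)).map fun p => (p.1, p.2 + A p.1) := by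
      rw [← (indepFun_iff_map_prod_eq_prod_map_map hY hZ).1 hind.symm,
        AEMeasurable.map_map_of_aemeasurable hg'.aemeasurable (hY.prodMk hZ)]
      rfl
    rw [h1]
    refine Measure.ext_of_lintegral _ fun F hF => ?_
    have hFg : Measurable fun p : 𝓨 × 𝓧 => F (p.1, p.2 + A p.1) := hF.comp hg'
    rw [lintegral_map hF hg', lintegral_prod _ hFg.aemeasurable,
      Measure.lintegral_compProd hF]
    refine lintegral_congr fun z => ?_
    have hFz : Measurable fun u => F (z, u) := hF.comp measurable_prodMk_left
    rw [hκy, lintegral_map hFz (by fun_prop)]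

end Conditioning

/-! ### Continuous paths as elements of `L²` -/

section ToL2

variable {d : ℕ} {T : ℝ}

lemma toL2_eq_toLp {F : ℝ → E d} (hF : MemLp F 2 (volume.restrict (Icc 0 T))) :
    toL2 T F = hF.toLp F := dif_pos hF

lemma toL2_add {F G : ℝ → E d} (hF : ContinuousOn F (Icc 0 T)) (hG : ContinuousOn G (Icc 0 T)) :
    toL2 T (fun t => F t + G t) = toL2 T F + toL2 T G := by
  rw [toL2_eq_toLp (memLp_of_continuousOn hF), toL2_eq_toLp (memLp_of_continuousOn hG),
    ← MemLp.toLp_add]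
  exact toL2_eq_toLp _

lemma toL2_congr {F G : ℝ → E d} (h : EqOn F G (Icc 0 T)) (hF : ContinuousOn F (Icc 0 T)) :
    toL2 T F = toL2 T G := by
  rw [toL2_eq_toLp (memLp_of_continuousOn hF), toL2_eq_toLp (memLp_of_continuousOn (hF.congr h.symm))]
  refine MemLp.toLp_congr _ _ ?_
  filter_upwards [ae_restrict_mem measurableSet_Icc] with t ht using h ht

lemma continuous_toL2_smul {b : ℝ → ℝ} (hb : Continuous b) :
    Continuous fun c : E d => toL2 T fun t => b t • c := by
  have hc : ∀ c : E d, ContinuousOn (fun t => b t • c) (Icc 0 T) := fun c => by fun_prop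
  let L : E d →ₗ[ℝ] L2 d T :=
    { toFun := fun c => toL2 T fun t => b t • c
      map_add' := fun c c' => by
        simp only [smul_add]
        exact toL2_add (hc c) (hc c')
      map_smul' := fun r c => by
        rw [RingHom.id_apply, toL2_eq_toLp (memLp_of_continuousOn (hc c)), ← MemLp.toLp_const_smul,
          toL2_eq_toLp (memLp_of_continuousOn (hc (r • c)))]
        exact MemLp.toLp_congr _ _ (Eventually.of_forall fun t => smul_comm _ _ _) }
  exact LinearMap.continuous_of_finiteDimensional L

lemma continuous_bridgeMean (m T : ℝ) (xminus xplus : E d) :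
    Continuous (bridgeMean m T xminus xplus) := by
  have := continuous_bridgeCoeff m T
  unfold bridgeMean
  fun_prop

lemma continuous_toL2_bridgeMean (m T : ℝ) (xminus : E d) :
    Continuous fun y => toL2 T (bridgeMean m T xminus y) := by
  have hb := continuous_bridgeCoeff m T
  have e : ∀ y, toL2 T (bridgeMean m T xminus y) =
      toL2 T (fun _ => xminus) + toL2 T fun t => bridgeCoeff m T t • (y - xminus) := fun y =>
    toL2_add continuousOn_const (by fun_prop)
  simp_rw [e]
  exact continuous_const.add ((continuous_toL2_smul hb).comp (continuous_id.sub continuous_const))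

end ToL2

/-! ### The law of the bridge -/

section Law

variable {Ω : Type*} [MeasurableSpace Ω] {d : ℕ} {P : Measure Ω} {m T : ℝ} {Y : ℝ → Ω → E d}
  {ξ : Ω → E d} {R : ℝ → ℝ → ℝ} {r : ℝ}

lemma IsGaussianField.charFun_toL2 [IsProbabilityMeasure P] (h : IsGaussianField P T Y ξ R r)
    (hT : 0 ≤ T) (hR : Continuous fun p : ℝ × ℝ => R p.1 p.2) (g : L2 d T) :
    charFun (P.map fun ω => toL2 T fun t => Y t ω) g =
      Complex.exp (-(⟪(IsBoundedKernel.of_continuous hR).toCLM d g, g⟫ / 2 : ℝ)) := by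
  have h1 := h.transform_toL2 hT hR g 0
  rw [charFun_map_inner (h.aemeasurable_toL2 hT)]
  simpa using h1

lemma IsGaussianField.charFun_vector [IsProbabilityMeasure P] (h : IsGaussianField P T Y ξ R r)
    (c : E d) : charFun (P.map ξ) c = Complex.exp (-(r * ‖c‖ ^ 2 / 2 : ℝ)) := by
  have h1 := h.transform ∅ (by simp) 0 c
  rw [charFun_map_inner h.aemeasurable_vector]
  simpa using h1

/-- The joint transform has no cross term, so the joint characteristic function factorises. -/
lemma IsGaussianField.indepFun [IsProbabilityMeasure P] (h : IsGaussianField P T Y ξ R r)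
    (hT : 0 ≤ T) (hR : Continuous fun p : ℝ × ℝ => R p.1 p.2) :
    IndepFun (fun ω => toL2 T fun t => Y t ω) ξ P := by
  refine (indepFun_iff_charFun_prod (h.aemeasurable_toL2 hT) h.aemeasurable_vector).2 fun p => ?_
  rw [h.charFun_toL2 hT hR, h.charFun_vector, ← Complex.exp_add, charFun_map_inner]
  · simp only [WithLp.prod_inner_apply]
    rw [h.transform_toL2 hT hR]
    congr 1
    push_cast
    ring
  · exact (WithLp.measurable_toLp 2 _).comp_aemeasurable
      ((h.aemeasurable_toL2 hT).prodMk h.aemeasurable_vector)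

/-- Identifies the covariance operator of the Gaussian field with the inverse found through the
piecewise kernel. -/
lemma toCLM_bridgeCov (d : ℕ) (m T : ℝ) :
    (IsBoundedKernel.of_continuous (continuous_bridgeCov m T)).toCLM d = greenOperator d m T := by
  ext1 g
  refine Lp.ext ?_
  filter_upwards [greenOperator_coeFn (m := m) g,
    (IsBoundedKernel.of_continuous (T := T) (continuous_bridgeCov m T)).toCLM_coeFn g] with s h1 h2
  rw [h1, h2, kernelIntegral]
  simp only [bridgeCov_comm m T s]

lemma inner_greenOperator_comm (f g : L2 d T) :
    ⟪greenOperator d m T f, g⟫ = ⟪f, greenOperator d m T g⟫ := by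
  rw [← toCLM_bridgeCov]
  exact IsBoundedKernel.inner_toCLM_comm _ (bridgeCov_comm m T) f g

end Law

end LangevinBridge

end

/-! ### The main theorem -/

open LangevinBridge in
theorem lemma4p1 {d : ℕ} {m T : ℝ} (hm : 0 < m) (hT : 0 < T) (xminus xplus : E d)
    {Ω : Type*} [MeasurableSpace Ω] (P : Measure Ω) [IsProbabilityMeasure P]
    (W : ℝ≥0 → Ω → E d) (x v : ℝ → Ω → E d)
    (hsol : IsLangevinSolution m T (fun _ => 0) xminus P W x v) :
    -- the operator is self-adjoint and negative definite
    IsSelfAdjoint (operatorL d m T) ∧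
    (∀ u : (operatorL d m T).domain, u ≠ 0 → ⟪operatorL d m T u, (u : L2 d T)⟫ < 0) ∧
    -- the boundary value problem for the mean has exactly one solution on `[0,T]`
    ∃ xbar : ℝ → E d, IsMeanPath m T xminus xplus xbar ∧
      (∀ y, IsMeanPath m T xminus xplus y → EqOn y xbar (Icc 0 T)) ∧
    -- the inverse `-𝓛⁻¹` exists and is the integral operator of the Green's function
    ∃ C : L2 d T →L[ℝ] L2 d T, IsBoundedInverse (-operatorL d m T) C ∧
      (∃ G : ℝ → ℝ → ℝ, IsGreenFunction m T G ∧
        ∀ g : L2 d T, C g =ᵐ[volume.restrict (Icc (0 : ℝ) T)]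
          fun s => ∫ t in Icc (0 : ℝ) T, G s t • g t) ∧
    -- the target distribution exists, is unique, and is `𝒩(x̄, -𝓛⁻¹)`
    ∃ Q : Measure (L2 d T), IsGaussianWith Q (toL2 T xbar) C ∧
      ∀ Q' : Measure (L2 d T), IsTargetLaw T P x xplus Q' ↔ Q' = Q := by
  have hfield := hsol.isGaussianField_bridge hm hT
  have hcont := continuous_bridgeCov m T
  set Z : Ω → L2 d T := fun ω =>
    toL2 T fun t => (x t ω - xminus) - bridgeCoeff m T t • (x T ω - xminus) with hZ
  have hZm : AEMeasurable Z P := hfield.aemeasurable_toL2 hT.le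
  have hPZ : IsProbabilityMeasure (P.map Z) := Measure.isProbabilityMeasure_map hZm
  have hchar : ∀ g, charFun (P.map Z) g =
      Complex.exp (-(⟪greenOperator d m T g, g⟫ / 2 : ℝ)) := by
    rw [← toCLM_bridgeCov]
    exact hfield.charFun_toL2 hT.le hcont
  have hinv := isBoundedInverse_greenOperator (d := d) hm hT
  have hmean := isMeanPath_bridgeMean hm hT xminus xplus
  have hxT : AEMeasurable (x T) P := hsol.aemeasurable_position T ⟨hT.le, le_rfl⟩
  have hind : IndepFun Z (x T) P := by
    have := (hfield.indepFun hT.le hcont).comp (measurable_id (α := L2 d T))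
      (measurable_id.add_const xminus : Measurable fun y : E d => y + xminus)
    simpa only [Function.comp_def, id, sub_add_cancel] using this
  -- The path is the independent remainder plus the mean path evaluated at the random endpoint.
  have hX : ∀ᵐ ω ∂P, toL2 T (fun t => x t ω) =
      Z ω + toL2 T (bridgeMean m T xminus (x T ω)) := by
    filter_upwards [hsol.continuous_position, hfield.continuous] with ω h1 h2
    rw [hZ, ← toL2_add h2 (continuous_bridgeMean m T xminus _).continuousOn]
    refine toL2_congr (fun t _ => ?_) h1
    simp only [bridgeMean]
    abel
  -- The endpoint displacement is Gaussian with variance `lowerCov m T T > 0` in each coordinate;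
  -- translation preserves full support.
  have hopen : (P.map (x T)).IsOpenPosMeasure := by
    have hP : IsProbabilityMeasure (P.map fun ω => x T ω - xminus) :=
      Measure.isProbabilityMeasure_map hfield.aemeasurable_vector
    have h1 := isOpenPosMeasure_of_charFun (lowerCov_self_pos hm hT) hfield.charFun_vector
    have h2 : P.map (x T) = (P.map fun ω => x T ω - xminus).map (· + xminus) := by
      rw [AEMeasurable.map_map_of_aemeasurable (by fun_prop) (by fun_prop)]
      simp [Function.comp_def]
    rw [h2]
    exact (continuous_id.add continuous_const).isOpenPosMeasure_map (add_right_surjective _)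
  have htarget := isConditionedLaw_of_indepFun hZm hxT hind
    (continuous_toL2_bridgeMean m T xminus) hX xplus
  exact ⟨hinv.isSelfAdjoint inner_greenOperator_comm,
    hinv.inner_neg inner_greenOperator_comm (inner_nonneg_of_charFun hchar),
    bridgeMean m T xminus xplus, hmean, fun y hy => hy.eqOn hm hT hmean,
    greenOperator d m T, hinv, ⟨bridgeCov m T, isGreenFunction_bridgeCov hm hT, greenOperator_coeFn⟩,
    _, isGaussianWith_map_add hchar inner_greenOperator_comm _,
    fun Q' => ⟨fun h => h.unique hopen htarget, fun h => h ▸ htarget⟩⟩
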